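/- **Setting.** Let $0=h_0<h_1<\dots<h_n=1$, let $a_1,\dots,a_n\in\mathbb{R}$, $b_1,\dots,b_n>0$ and $\alpha_1,\dots,\alpha_n\in\mathbb{R}$. On the square $[0,1]^2$ consider the piecewise constant vector field $Z$ and the piecewise constant function $f$ given on the $i$-th horizontal strip $h_{i-1}<y<h_i$ by $Z=(a_i,b_i)$ and $f=\alpha_i$ ($i=1,\dots,n$). Let $\mathbb{T}^2$ be the torus obtained from $[0,1]^2$ by identifying $(x,0)\sim(x,1)$ and $(0,y)\sim(1,y)$, and let $\mathbb{K}^2$ be the Klein bottle obtained by identifying $(x,0)\sim(x,1)$ and $(0,y)\sim(1,1-y)$. On $M=\mathbb{T}^2$ or $M=\mathbb{K}^2$ let $\lambda$ be the area measure and $\nu=f\cdot\lambda$ (a signed measure if the $\alpha_i$ do not all have the same sign). Solutions are understood in the sense of Filippov: a solution is an absolutely continuous curve $\phi$ in $M$, defined for all times, with $\dot\phi(t)\in\mathcal{F}_Z(\phi(t))$ for almost every $t$, where, in local flat coordinates, $\mathcal{F}_Z(p)=\bigcap_{\delta>0}\bigcap_{\lambda(N)=0}\overline{\mathrm{co}}\,Z(B(p,\delta)\setminus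 N)$. For $A\subset M$ and $t\in\mathbb{R}$ let $Z_t(A)$ be the set of all $\phi(t)$ with $\phi$ a solution such that $\phi(0)\in A$. The system *preserves* $\nu$ if for every $t\in\mathbb{R}$ and every Borel set $A\subset M$ the set $Z_t(A)$ is measurable for the completion of $\lambda$ and $\nu(Z_t(A))=\nu(A)$. **Proposition.** (a) The system defined by $Z$ on $\mathbb{T}^2$ preserves $\nu=f\cdot\lambda$ if and only if there is $\alpha\in\mathbb{R}$ such that $\alpha_i=\alpha/b_i$ for each $i\in\{1,\dots,n\}$. (b) Suppose that the strip decomposition is symmetric under $y\mapsto 1-y$, that is, $h_{n-i}=1-h_i$ for $i=0,\dots,n$, and that the $\alpha_i$ are not all zero. Then the system defined by $Z$ on $\mathbb{K}^2$ preserves $\nu=f\cdot\lambda$ if and only if there is $\alpha\in\mathbb{R}$ such that $\alpha_i=\alpha/b_i$ for each $i\in\{1,\dots,n\}$, and $$\frac{a_i}{b_i}=\frac{a_{n-i+1}}{b_{n-i+1}}\qquad\text{for each } i\in\{1,\dots,n\}.$$ -/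

import Mathlib

open MeasureTheory Set

noncomputable section

/-! ### The two surfaces, as quotients of the plane -/

/-- The torus relation: `(x, y) ∼ (z, w)` iff `z - x ∈ ℤ` and `w - y ∈ ℤ`. -/
def torusSetoid : Setoid (ℝ × ℝ) where
  r p q := ∃ m k : ℤ, q.1 = p.1 + m ∧ q.2 = p.2 + k
  iseqv :=
    { refl := fun p => ⟨0, 0, by simp, by simp⟩
      symm := by
        rintro p q ⟨m, k, h1, h2⟩
        exact ⟨-m, -k, by push_cast; linarith, by push_cast; linarith⟩
      trans := by
        rintro p q r ⟨m, k, h1, h2⟩ ⟨m', k', h1', h2'⟩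
        exact ⟨m + m', k + k', by push_cast; linarith, by push_cast; linarith⟩ }

/-- The Klein bottle relation, generated by `(x, y) ∼ (x, y + 1)` and `(x, y) ∼ (x + 1, 1 - y)`.
On the square `[0,1]²` it glues `(x, 0)` to `(x, 1)` and `(0, y)` to `(1, 1 - y)`, and nothing
else except what these imply at the corners. -/
def kleinSetoid : Setoid (ℝ × ℝ) where
  r p q := ∃ m k : ℤ, q.1 = p.1 + m ∧ q.2 = (if Even m then p.2 else -p.2) + k
  iseqv :=
    { refl := fun p => ⟨0, 0, by simp, by simp⟩
      symm := by
        rintro p q ⟨m, k, h1, h2⟩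
        by_cases hm : Even m
        · refine ⟨-m, -k, by push_cast; linarith, ?_⟩
          simp only [even_neg, hm, if_true] at h2 ⊢
          push_cast; linarith
        · refine ⟨-m, k, by push_cast; linarith, ?_⟩
          simp only [even_neg, hm, if_false] at h2 ⊢
          linarith
      trans := by
        rintro p q r ⟨m, k, h1, h2⟩ ⟨m', k', h1', h2'⟩
        by_cases hm : Even m <;> by_cases hm' : Even m'
        · refine ⟨m + m', k + k', by push_cast; linarith, ?_⟩
          simp only [Int.even_add, hm, hm', if_true] at h2 h2' ⊢
          push_cast; linarith
        · refine ⟨m + m', -k + k', by push_cast; linarith, ?_⟩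
          simp only [Int.even_add, hm, hm', if_true, if_false, iff_false, not_true] at h2 h2' ⊢
          push_cast; linarith
        · refine ⟨m + m', k + k', by push_cast; linarith, ?_⟩
          simp only [Int.even_add, hm, hm', if_true, if_false, iff_true] at h2 h2' ⊢
          push_cast; linarith
        · refine ⟨m + m', -k + k', by push_cast; linarith, ?_⟩
          simp only [Int.even_add, hm, hm', if_true, if_false] at h2 h2' ⊢
          push_cast; linarith }

/-! ### Filippov solutions -/

/-- Filippov's set-valued regularisation of a planar vector field:
the intersection, over all radii `δ > 0` and all Lebesgue null sets `N`, of the closed convex hulls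
of the values of `Z` on `B(p, δ) \ N`. For a piecewise smooth field this is the convex hull of the
limits at `p` from the adjacent regions of smoothness: the single vector `Z p` inside such a region,
and the segment between the two one-sided limits on a discontinuity line separating two of them. -/
def filippovSet (Z : ℝ × ℝ → ℝ × ℝ) (p : ℝ × ℝ) : Set (ℝ × ℝ) :=
  ⋂ (δ : ℝ) (_ : 0 < δ) (N : Set (ℝ × ℝ)) (_ : volume N = 0),
    closure (convexHull ℝ (Z '' (Metric.ball p δ \ N)))

/-- A locally absolutely continuous curve `γ : ℝ → ℝ²` satisfying the inclusion
`γ' ∈ filippovSet Z γ` almost everywhere. (The fields used below are bounded, so that every maximal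
solution is defined for all times.) -/
def IsFilippovSolution (Z : ℝ × ℝ → ℝ × ℝ) (γ : ℝ → ℝ × ℝ) : Prop :=
  (∀ s t : ℝ, AbsolutelyContinuousOnInterval γ s t) ∧
    ∀ᵐ t : ℝ, ∃ v ∈ filippovSet Z (γ t), HasDerivAt γ v t

/-- `Z_t(A)` on the surface `ℝ² / r`: the set of all positions at time `t` of solutions that are in
`A` at time `0`. Here `Z` is the lift of the field of the surface to `ℝ²`; as `ℝ² → ℝ² / r` is a
covering by local isometries, the solutions on the surface are the projections of the solutions
in the plane. -/
def timeImage (r : Setoid (ℝ × ℝ)) (Z : ℝ × ℝ → ℝ × ℝ) (t : ℝ) (A : Set (Quotient r)) :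
    Set (Quotient r) :=
  {q | ∃ γ : ℝ → ℝ × ℝ, IsFilippovSolution Z γ ∧
    Quotient.mk r (γ 0) ∈ A ∧ Quotient.mk r (γ t) = q}

/-- The part of the fundamental square `[0,1)²` that lies over a subset `B` of the surface. -/
def overSquare (r : Setoid (ℝ × ℝ)) (B : Set (Quotient r)) : Set (ℝ × ℝ) :=
  (Ico (0 : ℝ) 1 ×ˢ Ico (0 : ℝ) 1) ∩ Quotient.mk r ⁻¹' B

/-- `(f · λ)(B)` for a subset `B` of the surface `ℝ² / r`, where `λ` is the area measure of the
surface and the density `f` is given on the fundamental square. -/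
def densityMeasure (r : Setoid (ℝ × ℝ)) (f : ℝ × ℝ → ℝ) (B : Set (Quotient r)) : ℝ :=
  ∫ p in overSquare r B, f p

/-- The Filippov system of `Z` on the surface `ℝ² / r` preserves the (possibly signed) measure
`ν = f · λ`: for every time `t ∈ ℝ` and every Borel set `A`, the set `Z_t(A)` is measurable for the
completion of `λ` and `ν(Z_t(A)) = ν(A)`. -/
def PreservesDensity (r : Setoid (ℝ × ℝ)) (Z : ℝ × ℝ → ℝ × ℝ) (f : ℝ × ℝ → ℝ) : Prop :=
  ∀ (t : ℝ) (A : Set (Quotient r)), MeasurableSet[borel (Quotient r)] A →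
    NullMeasurableSet (overSquare r (timeImage r Z t A)) volume ∧
      densityMeasure r f (timeImage r Z t A) = densityMeasure r f A

/-! ### Piecewise constant data on horizontal strips -/

/-- The function of the height `y ∈ [0,1)` that takes the value `v i` on the `i`-th strip
`h i ≤ y < h (i + 1)`, for `0 = h 0 < h 1 < ⋯ < h n = 1`. -/
def stripValue {n : ℕ} {V : Type*} [AddCommMonoid V] (h : Fin (n + 1) → ℝ) (v : Fin n → V)
    (y : ℝ) : V :=
  ∑ i : Fin n, (Ico (h i.castSucc) (h i.succ)).indicator (fun _ => v i) y

/-- The piecewise constant density on the fundamental square. -/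
def stripDensity {n : ℕ} (h : Fin (n + 1) → ℝ) (α : Fin n → ℝ) (p : ℝ × ℝ) : ℝ :=
  stripValue h α p.2

/-- The lift to `ℝ²` of the field equal to `(a i, b i)` on the `i`-th strip of the torus. -/
def torusField {n : ℕ} (h : Fin (n + 1) → ℝ) (a b : Fin n → ℝ) (p : ℝ × ℝ) : ℝ × ℝ :=
  stripValue h (fun i => (a i, b i)) (Int.fract p.2)

/-- The lift to `ℝ²` of the field equal to `(a i, b i)` on the `i`-th strip of the square `[0,1)²`,
regarded as a fundamental domain of the Klein bottle: the unique extension of the field on the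
square that is invariant under `(x, y) ↦ (x, y + 1)` and `(x, y) ↦ (x + 1, -y)`. The latter map
sends the vector `(u, v)` to `(u, -v)`. -/
def kleinField {n : ℕ} (h : Fin (n + 1) → ℝ) (a b : Fin n → ℝ) (p : ℝ × ℝ) : ℝ × ℝ :=
  if Even ⌊p.1⌋ then stripValue h (fun i => (a i, b i)) (Int.fract p.2)
  else stripValue h (fun i => (a i, -b i)) (Int.fract (-p.2))

end

open Filter Topology

/-! On the torus the field depends on the height only and has positive vertical component. In the
coordinates given by the crossing time ∫ dy/b and by x - ∫ (a/b) dy, every solution is a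
translation: it crosses the discontinuity lines transversally, so what happens on them does not
matter. Hence λ/b is invariant. In the plane only the outer measure inequality μ(Z_t E) ≤ μ(E) is
proved. Applied over a set and over its complement, whose images together cover almost everything,
it gives null measurability and equality on the surface (`DeckSystem.preservesDensity`).

On the Klein bottle, strip i meets the reflected strip, with reversed vertical direction, across
each wall x ∈ ℤ. If the slopes a/b are symmetric, 1/b is proportional to 1/|a| with the same factor
on both sides. So in strips with a ≠ 0 the measure λ/b is also invariant for the shear across the
wall, in a chart with x and y exchanged. Neither chart is available at wall points of strips with a
= 0 or at the corners of strips and walls. These points are controlled by the first integral ∫₀^y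
a/b - `triangleWave` x, which is constant along every solution (`firstIntegral_eq`). Its values at
such points form a closed countable set with null preimage. At a fixed distance from that set, every
point lies well inside one of the two charts, with a uniform radius. Time can therefore be cut into
uniform short steps, and solutions exist by gluing.

The converse compares fluxes. A thin layer below a discontinuity line moves into the next strip, so
αᵢbᵢ = s αⱼbⱼ with s ∈ [0,1]; going once around the cycle of strips forces equality
(`exists_density_eq`). At a wall reached from strip i there are two cases. If the field beyond does
not lead away from the wall, a whole cell collapses onto the wall and αᵢ = 0, which is impossible
when α = c/b with c ≠ 0 (`density_eq_zero_of_sticky`). Otherwise the flux comparison, made for strip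
i and for its reflection, gives equal slopes (`slope_symm_of_preservesDensity`). -/

/-! ### Absolutely continuous functions -/

/-- A function that is in a countable set has derivative zero almost everywhere there. -/
theorem ae_hasDerivAt_eq_zero_of_mem_countable (f : ℝ → ℝ) {K : Set ℝ} (hK : K.Countable) :
    ∀ᵐ t, f t ∈ K → ∀ d, HasDerivAt f d t → d = 0 := by
  -- A point of a level set at which the derivative is nonzero is isolated in that level set. Such
  -- points form a discrete subset of the line, hence a countable one.
  have hc : (⋃ y ∈ K, {t | f t = y ∧ ∃ d, d ≠ 0 ∧ HasDerivAt f d t}).Countable := by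
    refine hK.biUnion fun y _ => ?_
    refine IsLindelof.countable_of_isDiscrete (HereditarilyLindelofSpace.isLindelof _) ?_
    rw [isDiscrete_iff_nhdsNE]
    rintro t ⟨rfl, d, hd, hf⟩
    rw [← disjoint_iff, disjoint_principal_right]
    filter_upwards [hf.eventually_ne hd (c := f t)] with z hz hz'
    exact hz hz'.1
  filter_upwards [hc.ae_notMem volume] with t ht hft d hd
  by_contra h0
  exact ht (mem_biUnion hft ⟨rfl, d, h0, hd⟩)

theorem LipschitzWith.comp_absolutelyContinuousOnInterval {X Y : Type*} [PseudoMetricSpace X]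
    [PseudoMetricSpace Y] {K : NNReal} {T : X → Y} (hT : LipschitzWith K T) {f : ℝ → X} {s t : ℝ}
    (hf : AbsolutelyContinuousOnInterval f s t) :
    AbsolutelyContinuousOnInterval (fun r => T (f r)) s t := by
  rw [absolutelyContinuousOnInterval_iff] at hf ⊢
  intro ε hε
  -- K + 1 is used because K may be zero.
  obtain ⟨δ, hδ, H⟩ := hf (ε / (K + 1)) (by positivity)
  refine ⟨δ, hδ, fun E hE hlt => ?_⟩
  have h1 := H E hE hlt
  calc ∑ i ∈ Finset.range E.1, dist (T (f (E.2 i).1)) (T (f (E.2 i).2))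
      ≤ ∑ i ∈ Finset.range E.1, (K + 1) * dist (f (E.2 i).1) (f (E.2 i).2) := by
        refine Finset.sum_le_sum fun i _ => (hT.dist_le_mul _ _).trans ?_
        gcongr
        simp
    _ = (K + 1) * ∑ i ∈ Finset.range E.1, dist (f (E.2 i).1) (f (E.2 i).2) := by
        rw [Finset.mul_sum]
    _ < (K + 1) * (ε / (K + 1)) := by gcongr
    _ = ε := by field_simp

/-! ### Increments from almost everywhere information on the derivative. -/

namespace AbsolutelyContinuousOnInterval

variable {f : ℝ → ℝ} {s t : ℝ}

theorem sub_eq_of_ae_hasDerivAt (hf : AbsolutelyContinuousOnInterval f s t) (c : ℝ)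
    (h : ∀ᵐ r, r ∈ uIcc s t → HasDerivAt f c r) : f t - f s = c * (t - s) := by
  rw [← hf.integral_deriv_eq_sub, intervalIntegral.integral_congr_ae (g := fun _ => c)]
  · simp [mul_comm]
  · filter_upwards [h] with r hr hrs
    exact (hr (uIoc_subset_uIcc hrs)).deriv

/-- The hypothesis only constrains derivatives that exist; their existence almost everywhere comes
from absolute continuity. -/
theorem mul_le_sub_of_ae_le_deriv (hf : AbsolutelyContinuousOnInterval f s t) (hst : s ≤ t)
    (m : ℝ) (h : ∀ᵐ r, r ∈ uIcc s t → ∀ d, HasDerivAt f d r → m ≤ d) :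
    m * (t - s) ≤ f t - f s := by
  rw [← hf.integral_deriv_eq_sub]
  have h1 : ∫ _ in s..t, m = m * (t - s) := by simp [mul_comm]
  rw [← h1, intervalIntegral.integral_of_le hst, intervalIntegral.integral_of_le hst]
  refine setIntegral_mono_on_ae (by simp) ?_ measurableSet_Ioc ?_
  · exact (intervalIntegrable_iff_integrableOn_Ioc_of_le hst).1 hf.intervalIntegrable_deriv
  · filter_upwards [h, hf.ae_differentiableAt] with r hr hd hrs
    have hm : r ∈ uIcc s t := by rw [uIcc_of_le hst]; exact Ioc_subset_Icc_self hrs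
    exact hr hm _ (hd hm).hasDerivAt

theorem sub_le_mul_of_ae_deriv_le (hf : AbsolutelyContinuousOnInterval f s t) (hst : s ≤ t)
    (m : ℝ) (h : ∀ᵐ r, r ∈ uIcc s t → ∀ d, HasDerivAt f d r → d ≤ m) :
    f t - f s ≤ m * (t - s) := by
  have := (hf.neg).mul_le_sub_of_ae_le_deriv hst (-m) (by
    filter_upwards [h] with r hr hrs d hd
    have := hr hrs _ (by simpa using hd.neg)
    linarith)
  simp only [Pi.neg_apply] at this
  linarith

theorem abs_sub_le_of_ae_abs_deriv_le (hf : AbsolutelyContinuousOnInterval f s t)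
    (V : ℝ) (h : ∀ᵐ r, r ∈ uIcc s t → ∀ d, HasDerivAt f d r → |d| ≤ V) :
    |f t - f s| ≤ V * |t - s| := by
  wlog hst : s ≤ t generalizing s t
  · have := this hf.symm (by rwa [uIcc_comm]) (by linarith)
    rwa [abs_sub_comm, abs_sub_comm t s]
  rw [abs_of_nonneg (sub_nonneg.2 hst), abs_le]
  constructor
  · have := hf.mul_le_sub_of_ae_le_deriv hst (-V) (by
      filter_upwards [h] with r hr hrs d hd using (abs_le.1 (hr hrs d hd)).1)
    linarith
  · exact hf.sub_le_mul_of_ae_deriv_le hst V (by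
      filter_upwards [h] with r hr hrs d hd using (abs_le.1 (hr hrs d hd)).2)

end AbsolutelyContinuousOnInterval

/-! ### The Filippov set -/

/-- The null set N = ∅ and one small radius already give the upper estimate, which therefore also
applies at points of discontinuity. -/
theorem filippovSet_subset {Z : ℝ × ℝ → ℝ × ℝ} {p : ℝ × ℝ} {K : Set (ℝ × ℝ)} (hK : Convex ℝ K)
    (hKc : IsClosed K) (h : ∀ᶠ q in 𝓝 p, Z q ∈ K) : filippovSet Z p ⊆ K := by
  obtain ⟨δ, hδ, hb⟩ := Metric.eventually_nhds_iff_ball.1 h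
  intro v hv
  simp only [filippovSet, mem_iInter] at hv
  refine closure_minimal (convexHull_min ?_ hK) hKc (hv δ hδ ∅ (by simp))
  rintro _ ⟨q, hq, rfl⟩
  exact hb q hq.1

theorem filippovSet_eq_singleton {Z : ℝ × ℝ → ℝ × ℝ} {p v : ℝ × ℝ}
    (h : ∀ᶠ q in 𝓝 p, Z q = v) : filippovSet Z p = {v} := by
  refine Subset.antisymm
    (filippovSet_subset (convex_singleton v) isClosed_singleton (by simpa using h)) ?_
  rintro _ rfl
  obtain ⟨ε, hε, hb⟩ := Metric.eventually_nhds_iff_ball.1 h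
  simp only [filippovSet, mem_iInter]
  intro δ hδ N hN
  -- A ball without a null set still has positive measure, so the value v is attained there.
  have hpos : volume (Metric.ball p (min δ ε) \ N) ≠ 0 := by
    rw [measure_sdiff_null hN]
    exact (Metric.measure_ball_pos volume p (lt_min hδ hε)).ne'
  obtain ⟨q, hq, hqN⟩ := nonempty_of_measure_ne_zero hpos
  refine subset_closure (subset_convexHull ℝ _ ⟨q, ⟨?_, hqN⟩, ?_⟩)
  · exact Metric.ball_subset_ball (min_le_left _ _) hq
  · exact hb q (Metric.ball_subset_ball (min_le_right _ _) hq)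

/-- If `g` is a homeomorphism of the plane that maps balls to balls of the same radius and null sets
to null sets, and `L` a linear map relating the field at `p` and at `g p`, then `L` maps the
Filippov set at `p` into the one at `g p`. -/
theorem map_mem_filippovSet {Z : ℝ × ℝ → ℝ × ℝ} {g : ℝ × ℝ → ℝ × ℝ} (L : ℝ × ℝ →L[ℝ] ℝ × ℝ)
    (hg : ∀ N, volume N = 0 → volume (g ⁻¹' N) = 0) (hgi : Isometry g)
    (hZ : ∀ q, Z (g q) = L (Z q)) {p v : ℝ × ℝ} (hv : v ∈ filippovSet Z p) :
    L v ∈ filippovSet Z (g p) := by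
  simp only [filippovSet, mem_iInter] at hv ⊢
  intro δ hδ N hN
  have h1 := hv δ hδ (g ⁻¹' N) (hg N hN)
  have h2 := image_closure_subset_closure_image L.continuous (mem_image_of_mem L h1)
  have h3 : L '' (convexHull ℝ) (Z '' (Metric.ball p δ \ g ⁻¹' N)) =
      convexHull ℝ (L '' (Z '' (Metric.ball p δ \ g ⁻¹' N))) :=
    L.toLinearMap.image_convexHull _
  rw [h3] at h2
  refine closure_mono (convexHull_mono ?_) h2
  rintro _ ⟨_, ⟨q, ⟨hq, hqN⟩, rfl⟩, rfl⟩
  refine ⟨g q, ⟨?_, hqN⟩, hZ q⟩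
  rw [Metric.mem_ball] at hq ⊢
  rwa [hgi.dist_eq]

/-! ### Shear charts -/

/-- Coefficients of a shear field `v' = ± 1 / τ v`, `u' = σ v * v'`, where `τ` and `σ` are bounded,
locally constant away from a countable set, and `τ` is bounded away from zero. -/
structure ShearData where
  τ : ℝ → ℝ
  σ : ℝ → ℝ
  D : Set ℝ
  m : ℝ
  M : ℝ
  m_pos : 0 < m
  le_τ : ∀ v, m ≤ τ v
  τ_le : ∀ v, τ v ≤ M
  abs_σ_le : ∀ v, |σ v| ≤ M
  measurable_τ : Measurable τ
  measurable_σ : Measurable σ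
  countable_D : D.Countable
  locConst : ∀ v ∉ D, ∀ᶠ z in 𝓝 v, τ z = τ v ∧ σ z = σ v

/-- A bounded measurable function is interval integrable. -/
theorem intervalIntegrable_of_abs_le {f : ℝ → ℝ} (hf : Measurable f) {M : ℝ}
    (hM : ∀ v, |f v| ≤ M) (a b : ℝ) : IntervalIntegrable f volume a b :=
  (intervalIntegrable_const (c := M)).mono_fun hf.aestronglyMeasurable
    (ae_of_all _ fun v => (hM v).trans (le_abs_self M))

theorem hasDerivAt_integral_of_eventuallyEq {f : ℝ → ℝ} (hf : Measurable f) {M : ℝ}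
    (hM : ∀ v, |f v| ≤ M) {v : ℝ} (hv : ∀ᶠ z in 𝓝 v, f z = f v) :
    HasDerivAt (fun x => ∫ z in (0 : ℝ)..x, f z) (f v) v :=
  intervalIntegral.integral_hasDerivAt_right (intervalIntegrable_of_abs_le hf hM _ _)
    hf.stronglyMeasurable.stronglyMeasurableAtFilter
    (continuousAt_const.congr (hv.mono fun _ h => h.symm))

theorem lipschitzWith_integral {f : ℝ → ℝ} (hf : Measurable f) {M : ℝ}
    (hM : ∀ v, |f v| ≤ M) : LipschitzWith M.toNNReal (fun x => ∫ z in (0 : ℝ)..x, f z) := by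
  have h0 : 0 ≤ M := (abs_nonneg _).trans (hM 0)
  refine LipschitzWith.of_dist_le_mul fun x y => ?_
  rw [Real.coe_toNNReal M h0, Real.dist_eq, Real.dist_eq,
    intervalIntegral.integral_interval_sub_left (intervalIntegrable_of_abs_le hf hM _ _)
      (intervalIntegrable_of_abs_le hf hM _ _)]
  exact intervalIntegral.norm_integral_le_of_norm_le_const (f := f) (C := M) fun z _ => hM z

namespace ShearData

variable (c : ShearData)

/-- The time needed to reach the coordinate `v`. -/
noncomputable def clock (v : ℝ) : ℝ := ∫ z in (0 : ℝ)..v, c.τ z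

/-- The displacement of the transversal coordinate. -/
noncomputable def drift (v : ℝ) : ℝ := ∫ z in (0 : ℝ)..v, c.σ z

theorem τ_pos (v : ℝ) : 0 < c.τ v := c.m_pos.trans_le (c.le_τ v)

theorem abs_τ_le (v : ℝ) : |c.τ v| ≤ c.M := by
  rw [abs_of_pos (c.τ_pos v)]; exact c.τ_le v

theorem hasDerivAt_clock {v : ℝ} (hv : v ∉ c.D) : HasDerivAt c.clock (c.τ v) v :=
  hasDerivAt_integral_of_eventuallyEq c.measurable_τ c.abs_τ_le
    ((c.locConst v hv).mono fun _ h => h.1)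

theorem hasDerivAt_drift {v : ℝ} (hv : v ∉ c.D) : HasDerivAt c.drift (c.σ v) v :=
  hasDerivAt_integral_of_eventuallyEq c.measurable_σ c.abs_σ_le
    ((c.locConst v hv).mono fun _ h => h.2)

theorem lipschitz_clock : LipschitzWith c.M.toNNReal c.clock :=
  lipschitzWith_integral c.measurable_τ c.abs_τ_le

theorem lipschitz_drift : LipschitzWith c.M.toNNReal c.drift :=
  lipschitzWith_integral c.measurable_σ c.abs_σ_le

theorem intervalIntegrable_τ (a b : ℝ) : IntervalIntegrable c.τ volume a b :=
  intervalIntegrable_of_abs_le c.measurable_τ c.abs_τ_le a b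

theorem clock_sub (a b : ℝ) : c.clock b - c.clock a = ∫ z in a..b, c.τ z :=
  intervalIntegral.integral_interval_sub_left (c.intervalIntegrable_τ _ _)
    (c.intervalIntegrable_τ _ _)

/-- The bound τ ≥ m integrates to this expansion estimate, the source of strict monotonicity,
surjectivity and the Lipschitz inverse of the clock. -/
theorem mul_sub_le_clock_sub {a b : ℝ} (hab : a ≤ b) :
    c.m * (b - a) ≤ c.clock b - c.clock a := by
  rw [c.clock_sub]
  have h1 : ∫ _ in a..b, c.m = c.m * (b - a) := by simp [mul_comm]
  rw [← h1]
  exact intervalIntegral.integral_mono_on hab (by simp) (c.intervalIntegrable_τ _ _)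
    fun z _ => c.le_τ z

theorem strictMono_clock : StrictMono c.clock := by
  intro a b hab
  have := c.mul_sub_le_clock_sub hab.le
  have h2 := mul_pos c.m_pos (sub_pos.2 hab)
  linarith

theorem surjective_clock : Function.Surjective c.clock := by
  refine c.lipschitz_clock.continuous.surjective ?_ ?_
  · refine tendsto_atTop_mono' _ ?_ (tendsto_id.const_mul_atTop c.m_pos)
    filter_upwards [eventually_ge_atTop 0] with x hx
    have := c.mul_sub_le_clock_sub hx
    simp only [clock, intervalIntegral.integral_same] at this ⊢
    simpa using this
  · refine tendsto_atBot_mono' _ ?_ (tendsto_id.const_mul_atBot c.m_pos)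
    filter_upwards [eventually_le_atBot 0] with x hx
    have := c.mul_sub_le_clock_sub hx
    simp only [clock, intervalIntegral.integral_same] at this ⊢
    simp only [id]
    linarith

/-- The clock as an order isomorphism of the line. -/
noncomputable def clockIso : ℝ ≃o ℝ :=
  c.strictMono_clock.orderIsoOfSurjective c.clock c.surjective_clock

@[simp] theorem clockIso_apply (v : ℝ) : c.clockIso v = c.clock v := rfl

@[simp] theorem clock_symm (x : ℝ) : c.clock (c.clockIso.symm x) = x :=
  c.clockIso.apply_symm_apply x

@[simp] theorem symm_clock (v : ℝ) : c.clockIso.symm (c.clock v) = v :=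
  c.clockIso.symm_apply_apply v

theorem lipschitz_symm : LipschitzWith (c.m⁻¹).toNNReal c.clockIso.symm := by
  refine LipschitzWith.of_dist_le_mul fun x y => ?_
  rw [Real.coe_toNNReal _ (inv_nonneg.2 c.m_pos.le)]
  wlog hxy : x ≤ y generalizing x y
  · rw [dist_comm, dist_comm x y]; exact this y x (le_of_not_ge hxy)
  have h1 := c.mul_sub_le_clock_sub (c.clockIso.symm.monotone hxy)
  rw [c.clock_symm, c.clock_symm] at h1
  rw [dist_comm, dist_comm x, Real.dist_eq, Real.dist_eq, abs_of_nonneg (sub_nonneg.2 hxy),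
    abs_of_nonneg (sub_nonneg.2 (c.clockIso.symm.monotone hxy))]
  rw [inv_mul_eq_div, le_div_iff₀ c.m_pos]
  linarith

/-- Along a solution curve of the shear field the clock moves with unit speed, and the sheared
transversal coordinate is constant. -/
theorem conj {v u : ℝ → ℝ} {s₀ s₁ s : ℝ} (hv : AbsolutelyContinuousOnInterval v s₀ s₁)
    (hu : AbsolutelyContinuousOnInterval u s₀ s₁)
    (h : ∀ᵐ t, t ∈ uIcc s₀ s₁ → ∃ dv du, HasDerivAt v dv t ∧ HasDerivAt u du t ∧ dv ≠ 0 ∧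
      (v t ∉ c.D → dv * c.τ (v t) = s ∧ du = c.σ (v t) * dv)) :
    c.clock (v s₁) = c.clock (v s₀) + s * (s₁ - s₀) ∧
      u s₁ - c.drift (v s₁) = u s₀ - c.drift (v s₀) := by
  have hD := ae_hasDerivAt_eq_zero_of_mem_countable v c.countable_D
  have h1 := (c.lipschitz_clock.comp_absolutelyContinuousOnInterval hv).sub_eq_of_ae_hasDerivAt s
    (by
      filter_upwards [h, hD] with t ht htD hts
      -- Transversality enters here: v has nonzero derivative at almost every time, so it avoids the
      -- countable set D at almost every time, and the velocity on D is irrelevant.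
      obtain ⟨dv, du, hdv, -, h0, hc⟩ := ht hts
      have hvD : v t ∉ c.D := fun hm => h0 (htD hm dv hdv)
      have := (c.hasDerivAt_clock hvD).comp t hdv
      rwa [mul_comm, (hc hvD).1] at this)
  have h2 := (hu.sub (c.lipschitz_drift.comp_absolutelyContinuousOnInterval hv)
    ).sub_eq_of_ae_hasDerivAt 0
    (by
      filter_upwards [h, hD] with t ht htD hts
      obtain ⟨dv, du, hdv, hdu, h0, hc⟩ := ht hts
      have hvD : v t ∉ c.D := fun hm => h0 (htD hm dv hdv)
      have := hdu.sub ((c.hasDerivAt_drift hvD).comp t hdv)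
      rwa [(hc hvD).2, sub_self] at this)
  simp only [Pi.sub_apply, zero_mul] at h1 h2
  exact ⟨by linarith, by linarith⟩

/-- Solution curves of the shear field exist for all times. -/
theorem exists_curve (v₀ u₀ : ℝ) {s : ℝ} (hs : s ≠ 0) :
    ∃ (v u : ℝ → ℝ) (K : NNReal), v 0 = v₀ ∧ u 0 = u₀ ∧ LipschitzWith K v ∧ LipschitzWith K u ∧
      ∀ᵐ t, v t ∉ c.D ∧ HasDerivAt v (s / c.τ (v t)) t ∧
        HasDerivAt u (c.σ (v t) * (s / c.τ (v t))) t := by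
  -- The curve is explicit: the clock runs linearly, and v is recovered by inverting it.
  set v : ℝ → ℝ := fun t => c.clockIso.symm (c.clock v₀ + s * t) with hvdef
  have hlin : LipschitzWith (|s|).toNNReal (fun t : ℝ => c.clock v₀ + s * t) := by
    refine LipschitzWith.of_dist_le_mul fun x y => ?_
    rw [Real.coe_toNNReal _ (abs_nonneg s), Real.dist_eq, Real.dist_eq, ← abs_mul]
    apply le_of_eq; congr 1; ring
  have hvL := c.lipschitz_symm.comp hlin
  have huL : LipschitzWith (c.M.toNNReal * ((c.m⁻¹).toNNReal * (|s|).toNNReal))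
      (fun t => u₀ - c.drift v₀ + c.drift (v t)) := by
    refine LipschitzWith.of_dist_le_mul fun x y => ?_
    rw [dist_add_left]
    exact (c.lipschitz_drift.comp hvL).dist_le_mul x y
  refine ⟨v, fun t => u₀ - c.drift v₀ + c.drift (v t), _, by simp [hvdef], by simp [hvdef],
    hvL.weaken (le_max_left _ _),
    huL.weaken (le_max_right _ _), ?_⟩
  have hinj : Function.Injective v := by
    intro x y hxy
    have := c.clockIso.symm.injective hxy
    simpa [hs] using this
  -- As v is injective, it visits the countable set D at countably many times only.
  filter_upwards [(c.countable_D.preimage_of_injOn hinj.injOn).ae_notMem volume] with t ht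
  have ht' : v t ∉ c.D := ht
  have h1 : HasDerivAt v (s / c.τ (v t)) t := by
    have ha : HasDerivAt c.clockIso.symm (c.τ (v t))⁻¹ (c.clock v₀ + s * t) :=
      HasDerivAt.of_local_left_inverse c.lipschitz_symm.continuous.continuousAt
        (c.hasDerivAt_clock ht') (c.τ_pos _).ne' (Eventually.of_forall fun x => c.clock_symm x)
    have hb : HasDerivAt (fun t : ℝ => c.clock v₀ + s * t) s t := by
      simpa using ((hasDerivAt_id t).const_mul s).const_add (c.clock v₀)
    have := ha.comp t hb
    rwa [inv_mul_eq_div] at this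
  exact ⟨ht', h1, ((c.hasDerivAt_drift ht').comp t h1).const_add _⟩

/-- The clock is the primitive of τ, so an interval pulls back to an interval on which τ integrates
to its length; comparing on rational intervals suffices. -/
theorem measurePreserving_clock :
    MeasurePreserving c.clock (volume.withDensity fun v => ENNReal.ofReal (c.τ v)) volume := by
  have hm : Measurable c.clock := c.lipschitz_clock.continuous.measurable
  refine ⟨hm, (Real.measure_ext_Ioo_rat fun p q => ?_).symm⟩
  have hpre : c.clock ⁻¹' Ioo (p : ℝ) q = Ioo (c.clockIso.symm p) (c.clockIso.symm q) := by
    ext v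
    simp only [mem_preimage, mem_Ioo, ← c.clockIso_apply, OrderIso.lt_symm_apply,
      OrderIso.symm_apply_lt]
  rw [Measure.map_apply hm measurableSet_Ioo, hpre, withDensity_apply _ measurableSet_Ioo,
    Real.volume_Ioo]
  rcases le_total (p : ℝ) q with hpq | hpq
  · have hle := c.clockIso.symm.monotone hpq
    rw [setLIntegral_congr Ioo_ae_eq_Ioc, ← ofReal_integral_eq_lintegral_ofReal
      ((intervalIntegrable_iff_integrableOn_Ioc_of_le hle).1 (c.intervalIntegrable_τ _ _))
      (ae_of_all _ fun v => (c.τ_pos v).le), ← intervalIntegral.integral_of_le hle, ← c.clock_sub]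
    simp
  · rw [Ioo_eq_empty (not_lt.2 (c.clockIso.symm.monotone hpq))]
    simp [hpq]

/-- The chart in which the shear field becomes a constant field. -/
noncomputable def chart (p : ℝ × ℝ) : ℝ × ℝ := (c.clock p.1, p.2 - c.drift p.1)

/-- The invariant measure of the shear field. -/
noncomputable def meas : Measure (ℝ × ℝ) := volume.withDensity fun p => ENNReal.ofReal (c.τ p.1)

/-- The chart is a skew product: the clock on the base and, for each v, a translation of the fibre.
-/
theorem measurePreserving_chart : MeasurePreserving c.chart c.meas volume := by
  have h1 : c.meas = (volume.withDensity fun v => ENNReal.ofReal (c.τ v)).prod volume := by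
    rw [prod_withDensity_left (by exact c.measurable_τ.ennreal_ofReal)]
    rfl
  rw [h1, Measure.volume_eq_prod]
  refine c.measurePreserving_clock.skew_product (g := fun v u => u - c.drift v) ?_ ?_
  · exact measurable_snd.sub (c.lipschitz_drift.continuous.measurable.comp measurable_fst)
  · exact ae_of_all _ fun v => (measurePreserving_sub_right volume (c.drift v)).map_eq

/-- The chart as a homeomorphism. -/
noncomputable def chartHomeo : ℝ × ℝ ≃ₜ ℝ × ℝ where
  toFun := c.chart
  invFun q := (c.clockIso.symm q.1, q.2 + c.drift (c.clockIso.symm q.1))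
  left_inv p := by simp [chart]
  right_inv q := by simp [chart]
  continuous_toFun := by
    have := c.lipschitz_clock.continuous
    have := c.lipschitz_drift.continuous
    unfold chart
    fun_prop
  continuous_invFun := by
    have := c.lipschitz_symm.continuous
    have := c.lipschitz_drift.continuous
    fun_prop

/-- The set E is arbitrary because time images are not known to be measurable; for a homeomorphism
the identity of outer measures still holds. -/
theorem meas_preimage_chart (E : Set (ℝ × ℝ)) : c.meas (c.chart ⁻¹' E) = volume E := by
  have := c.measurePreserving_chart.measure_preimage_equiv (f := c.chartHomeo.toMeasurableEquiv) E
  exact this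

/-- If the points of `B'` arise from points of `B` by a translation in the chart, then `B'` is not
larger than `B` in measure. -/
theorem meas_le_of_translate {B B' : Set (ℝ × ℝ)} (e : ℝ × ℝ)
    (h : ∀ q ∈ B', ∃ p ∈ B, c.chart q = c.chart p + e) : c.meas B' ≤ c.meas B := by
  have hi : Function.Injective c.chart := c.chartHomeo.injective
  -- Only an inclusion into the translate of B is needed, so no point of B has to carry a solution.
  have h1 : B' ⊆ c.chart ⁻¹' ((fun x => x - e) ⁻¹' (c.chart '' B)) := by
    intro q hq
    obtain ⟨p, hp, hpq⟩ := h q hq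
    exact ⟨p, hp, by rw [hpq]; simp⟩
  refine (measure_mono h1).trans ?_
  rw [c.meas_preimage_chart]
  have h2 := (measurePreserving_sub_right (volume : Measure (ℝ × ℝ)) e).measure_preimage_equiv
    (f := (Homeomorph.subRight e).toMeasurableEquiv) (c.chart '' B)
  have h3 : volume ((fun x => x - e) ⁻¹' (c.chart '' B)) = volume (c.chart '' B) := h2
  rw [h3, ← c.meas_preimage_chart, preimage_image_eq _ hi]

end ShearData

/-! ### Deck transformations -/

/-- The half-open unit square. -/
def unitSquare : Set (ℝ × ℝ) := Ico (0 : ℝ) 1 ×ˢ Ico (0 : ℝ) 1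

/-- The transformation `(x, y) ↦ (x + m, ε m * y + k)`. -/
def deck (ε : ℤ → ℝ) (m k : ℤ) (p : ℝ × ℝ) : ℝ × ℝ := (p.1 + m, ε m * p.2 + k)

/-- A planar field `Z` that descends to the quotient of the plane by `r`, where `r` is the orbit
relation of the transformations `deck ε m k`. -/
structure DeckSystem (r : Setoid (ℝ × ℝ)) (ε : ℤ → ℝ) (Z : ℝ × ℝ → ℝ × ℝ) : Prop where
  sign : ∀ m, ε m = 1 ∨ ε m = -1
  sign_zero : ε 0 = 1
  rel_iff : ∀ p q, r p q ↔ ∃ m k : ℤ, q = deck ε m k p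
  equivariant : ∀ m k p, Z (deck ε m k p) = ((Z p).1, ε m * (Z p).2)

/-- The positions at time `t` of the planar solutions that are in `E` at time `0`. -/
def planeImage (Z : ℝ × ℝ → ℝ × ℝ) (t : ℝ) (E : Set (ℝ × ℝ)) : Set (ℝ × ℝ) :=
  {q | ∃ γ : ℝ → ℝ × ℝ, IsFilippovSolution Z γ ∧ γ 0 ∈ E ∧ γ t = q}

theorem planeImage_mono {Z : ℝ × ℝ → ℝ × ℝ} {t : ℝ} {E E' : Set (ℝ × ℝ)} (h : E ⊆ E') :
    planeImage Z t E ⊆ planeImage Z t E' :=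
  fun _ ⟨γ, h1, h2, h3⟩ => ⟨γ, h1, h h2, h3⟩

theorem measurableSet_unitSquare : MeasurableSet unitSquare :=
  measurableSet_Ico.prod measurableSet_Ico

theorem exists_deck_mem (ε : ℤ → ℝ) (p : ℝ × ℝ) : ∃ m k : ℤ, deck ε m k p ∈ unitSquare := by
  refine ⟨-⌊p.1⌋, -⌊ε (-⌊p.1⌋) * p.2⌋, ?_⟩
  simp only [unitSquare, deck, mem_prod, mem_Ico, Int.cast_neg, ← sub_eq_add_neg,
    Int.self_sub_floor]
  exact ⟨⟨Int.fract_nonneg _, Int.fract_lt_one _⟩, Int.fract_nonneg _, Int.fract_lt_one _⟩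

theorem deck_inj_of_mem {ε : ℤ → ℝ} {m k m' k' : ℤ} {p : ℝ × ℝ}
    (h : deck ε m k p ∈ unitSquare) (h' : deck ε m' k' p ∈ unitSquare) : m = m' ∧ k = k' := by
  simp only [unitSquare, deck, mem_prod, mem_Ico] at h h'
  have key : ∀ {x : ℝ} {i j : ℤ}, 0 ≤ x + i → x + i < 1 → 0 ≤ x + j → x + j < 1 → i = j := by
    intro x i j h1 h2 h3 h4
    have h5 : (i : ℝ) < j + 1 := by linarith
    have h6 : (j : ℝ) < i + 1 := by linarith
    have h7 : i < j + 1 := by exact_mod_cast h5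
    have h8 : j < i + 1 := by exact_mod_cast h6
    omega
  have hm : m = m' := key h.1.1 h.1.2 h'.1.1 h'.1.2
  subst hm
  exact ⟨rfl, key h.2.1 h.2.2 h'.2.1 h'.2.2⟩

theorem measurableSet_overSquare {r : Setoid (ℝ × ℝ)} {A : Set (Quotient r)}
    (hA : MeasurableSet[borel (Quotient r)] A) :
    MeasurableSet (overSquare r A) := by
  refine measurableSet_unitSquare.inter ?_
  borelize (Quotient r)
  exact continuous_quotient_mk'.measurable hA

/-! ### From the plane to the quotient surface. -/

namespace DeckSystem

variable {r : Setoid (ℝ × ℝ)} {ε : ℤ → ℝ} {Z : ℝ × ℝ → ℝ × ℝ} (hS : DeckSystem r ε Z)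

include hS

theorem abs_sign (m : ℤ) : |ε m| = 1 := by
  rcases hS.sign m with h | h <;> simp [h]

theorem isometry_deck (m k : ℤ) : Isometry (deck ε m k) := by
  refine Isometry.of_dist_eq fun p q => ?_
  simp only [deck, Prod.dist_eq, Real.dist_eq, add_sub_add_right_eq_sub, ← mul_sub, abs_mul,
    hS.abs_sign, one_mul]

theorem measurePreserving_deck (m k : ℤ) : MeasurePreserving (deck ε m k) volume volume := by
  have h1 : MeasurePreserving (fun x : ℝ => x + (m : ℝ)) volume volume :=
    measurePreserving_add_right volume _
  have h2 : MeasurePreserving (fun y : ℝ => ε m * y + (k : ℝ)) volume volume := by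
    rcases hS.sign m with h | h
    · simpa [h] using measurePreserving_add_right volume (k : ℝ)
    · simpa [h, Function.comp_def] using
        (measurePreserving_add_right volume (k : ℝ)).comp (Measure.measurePreserving_neg volume)
  exact h1.prod h2

theorem measurableEmbedding_deck (m k : ℤ) : MeasurableEmbedding (deck ε m k) :=
  (hS.isometry_deck m k).isClosedEmbedding.measurableEmbedding

/-- Deck transformations are isometric affine maps under which the field is equivariant. This allows
the starting point of a lifted solution to be moved into the unit square. -/
theorem solution_deck {γ : ℝ → ℝ × ℝ} (hγ : IsFilippovSolution Z γ) (m k : ℤ) :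
    IsFilippovSolution Z (fun t => deck ε m k (γ t)) := by
  refine ⟨fun s t =>
    (hS.isometry_deck m k).lipschitz.comp_absolutelyContinuousOnInterval (hγ.1 s t), ?_⟩
  set L : ℝ × ℝ →L[ℝ] ℝ × ℝ := (ContinuousLinearMap.fst ℝ ℝ ℝ).prod
    (ε m • ContinuousLinearMap.snd ℝ ℝ ℝ) with hL
  filter_upwards [hγ.2] with t ⟨v, hv, hd⟩
  refine ⟨L v, map_mem_filippovSet L (fun N hN => ?_) (hS.isometry_deck m k)
    (fun q => by rw [hS.equivariant]; simp [hL]) hv, ?_⟩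
  · rwa [(hS.measurePreserving_deck m k).measure_preimage_emb (hS.measurableEmbedding_deck m k)]
  · have h1 : (fun t => deck ε m k (γ t)) = fun t => L (γ t) + ((m : ℝ), (k : ℝ)) := by
      ext t <;> simp [deck, hL]
    rw [h1]
    exact (L.hasFDerivAt.comp_hasDerivAt t hd).add_const _

theorem mk_eq_iff (p q : ℝ × ℝ) :
    Quotient.mk r p = Quotient.mk r q ↔ ∃ m k : ℤ, q = deck ε m k p := by
  rw [Quotient.eq]; exact hS.rel_iff p q

theorem mk_deck (m k : ℤ) (p : ℝ × ℝ) : Quotient.mk r (deck ε m k p) = Quotient.mk r p :=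
  ((hS.mk_eq_iff _ _).2 ⟨m, k, rfl⟩).symm

theorem deck_zero (p : ℝ × ℝ) : deck ε 0 0 p = p := by simp [deck, hS.sign_zero]

theorem eq_of_mk_eq {p q : ℝ × ℝ} (hp : p ∈ unitSquare) (hq : q ∈ unitSquare)
    (h : Quotient.mk r p = Quotient.mk r q) : p = q := by
  obtain ⟨m, k, rfl⟩ := (hS.mk_eq_iff p q).1 h
  have := deck_inj_of_mem (p := p) (ε := ε) (m := 0) (k := 0) (by rwa [hS.deck_zero]) hq
  rw [← this.1, ← this.2, hS.deck_zero]

/-- Moving the lift so that it starts in the unit square changes its endpoint by a deck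
transformation only. -/
theorem overSquare_timeImage_subset (t : ℝ) (A : Set (Quotient r)) :
    overSquare r (timeImage r Z t A) ⊆
      ⋃ mk : ℤ × ℤ, unitSquare ∩ deck ε mk.1 mk.2 '' planeImage Z t (overSquare r A) := by
  rintro q ⟨hq, γ, hγ, h0, ht⟩
  obtain ⟨m, k, hmk⟩ := exists_deck_mem ε (γ 0)
  have h1 : Quotient.mk r (deck ε m k (γ t)) = Quotient.mk r q := by rw [hS.mk_deck, ht]
  obtain ⟨m', k', rfl⟩ := (hS.mk_eq_iff _ _).1 h1
  refine mem_iUnion.2 ⟨(m', k'), hq, mem_image_of_mem _ ⟨_, hS.solution_deck hγ m k, ⟨hmk, ?_⟩, rfl⟩⟩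
  rw [mem_preimage, hS.mk_deck]
  exact h0

/-- The planar image is cut along the translates of the unit square, and each piece is moved back
into the square. The tiles are disjoint, so nothing is counted twice. The image need not be
measurable; additivity over the measurable tiles is applied to the restriction of μ to it. -/
theorem measure_overSquare_timeImage_le {μ : Measure (ℝ × ℝ)}
    (hμ : ∀ m k, MeasurePreserving (deck ε m k) μ μ) (t : ℝ) (A : Set (Quotient r)) :
    μ (overSquare r (timeImage r Z t A)) ≤ μ (planeImage Z t (overSquare r A)) := by
  set F := planeImage Z t (overSquare r A)
  have hm : ∀ mk : ℤ × ℤ, MeasurableSet (deck ε mk.1 mk.2 ⁻¹' unitSquare) := fun mk =>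
    (hμ mk.1 mk.2).measurable measurableSet_unitSquare
  calc μ (overSquare r (timeImage r Z t A))
      ≤ ∑' mk : ℤ × ℤ, μ (unitSquare ∩ deck ε mk.1 mk.2 '' F) :=
        (measure_mono (hS.overSquare_timeImage_subset t A)).trans (measure_iUnion_le _)
    _ = ∑' mk : ℤ × ℤ, μ.restrict F (deck ε mk.1 mk.2 ⁻¹' unitSquare) := by
        refine tsum_congr fun mk => ?_
        rw [← (hμ mk.1 mk.2).measure_preimage_emb (hS.measurableEmbedding_deck _ _),
          preimage_inter, preimage_image_eq _ (hS.isometry_deck _ _).injective,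
          Measure.restrict_apply (hm mk)]
    _ = μ.restrict F (⋃ mk : ℤ × ℤ, deck ε mk.1 mk.2 ⁻¹' unitSquare) := by
        refine (measure_iUnion (fun i j hij => ?_) hm).symm
        refine disjoint_left.2 fun p hp hp' => hij ?_
        have := deck_inj_of_mem hp hp'
        exact Prod.ext this.1 this.2
    _ ≤ μ F := by
        refine (measure_mono (subset_univ _)).trans ?_
        rw [Measure.restrict_apply_univ]

end DeckSystem

/-- If two sets cover a space of finite measure and are not larger in measure than the members of a
measurable partition, then they are null measurable of the same measure. -/
theorem nullMeasurableSet_of_cover {Ω : Type*} [MeasurableSpace Ω] {μ : Measure Ω}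
    {S X Y E : Set Ω} (hS : MeasurableSet S) (hSf : μ S ≠ ⊤) (hE : MeasurableSet E) (hES : E ⊆ S)
    (hXS : X ⊆ S) (hcov : μ (S \ (X ∪ Y)) = 0) (hX : μ X ≤ μ E) (hY : μ Y ≤ μ (S \ E)) :
    NullMeasurableSet X μ ∧ μ X = μ E := by
  have hsum : μ E + μ (S \ E) = μ S := by
    rw [← measure_inter_add_sdiff S hE, inter_eq_self_of_subset_right hES]
  have hEf : μ E ≠ ⊤ := measure_ne_top_of_subset hES hSf
  have hEf' : μ (S \ E) ≠ ⊤ := measure_ne_top_of_subset sdiff_subset hSf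
  -- The measurable hulls of X and Y cover S up to a null set, while their measures add up to at
  -- most that of S. Hence they overlap in a null set, and X differs from its hull, within S, only
  -- by the overlap and the uncovered part.
  set X' := toMeasurable μ X
  set Y' := toMeasurable μ Y
  have hX' : μ X' = μ X := measure_toMeasurable X
  have hY' : μ Y' = μ Y := measure_toMeasurable Y
  have hun : μ S ≤ μ (X' ∪ Y') := by
    calc μ S ≤ μ ((X ∪ Y) ∪ (S \ (X ∪ Y))) := measure_mono fun p hp => by
          by_cases h : p ∈ X ∪ Y
          · exact Or.inl h
          · exact Or.inr ⟨hp, h⟩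
      _ ≤ μ (X ∪ Y) + 0 := by rw [← hcov]; exact measure_union_le _ _
      _ ≤ μ (X' ∪ Y') := by
          rw [add_zero]
          exact measure_mono (union_subset_union (subset_toMeasurable _ _) (subset_toMeasurable _ _))
  have hadd := measure_union_add_inter (μ := μ) X' (measurableSet_toMeasurable μ Y)
  have hint : μ (X' ∩ Y') = 0 := by
    have h1 : μ (X' ∪ Y') + μ (X' ∩ Y') ≤ μ S := by
      rw [hadd, ← hsum, hX', hY']; exact add_le_add hX hY
    have h2 : μ S + μ (X' ∩ Y') ≤ μ S + 0 := by
      rw [add_zero]; exact (add_le_add_left hun _).trans h1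
    exact nonpos_iff_eq_zero.1 ((ENNReal.add_le_add_iff_left hSf).1 h2)
  have heq : μ X = μ E := by
    refine le_antisymm hX ?_
    have h1 : μ E + μ (S \ E) ≤ μ X + μ (S \ E) := by
      rw [hsum]
      refine hun.trans ((measure_union_le _ _).trans ?_)
      rw [hX', hY']
      gcongr
    exact (ENNReal.add_le_add_iff_right hEf').1 h1
  refine ⟨?_, heq⟩
  have hae : (X' ∩ S : Set Ω) =ᵐ[μ] X := by
    refine (ae_le_set.2 (measure_mono_null ?_ (measure_union_null hint hcov))).antisymm
      (Eventually.of_forall fun p hp => ⟨subset_toMeasurable _ _ hp, hXS hp⟩)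
    rintro p ⟨⟨hpX', hpS⟩, hpX⟩
    by_cases hpY : p ∈ Y
    · exact Or.inl ⟨hpX', subset_toMeasurable _ _ hpY⟩
    · exact Or.inr ⟨hpS, fun h => h.elim hpX hpY⟩
  exact ((measurableSet_toMeasurable μ X).inter hS).nullMeasurableSet.congr hae

namespace DeckSystem

variable {r : Setoid (ℝ × ℝ)} {ε : ℤ → ℝ} {Z : ℝ × ℝ → ℝ × ℝ} (hS : DeckSystem r ε Z)

include hS

/-- A criterion for invariance: planar time images do not increase the invariant measure, and almost
every point can be reached. -/
theorem preservesDensity {ρ : ℝ × ℝ → ℝ} (hρm : Measurable ρ) (hρ0 : ∀ p, 0 < ρ p) {M : ℝ}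
    (hρM : ∀ p, ρ p ≤ M)
    (hdeck : ∀ m k p, ρ (deck ε m k p) = ρ p)
    {f : ℝ × ℝ → ℝ} {c : ℝ} (hf : ∀ p ∈ unitSquare, f p = c * ρ p)
    (hle : ∀ t E, (volume.withDensity fun p => ENNReal.ofReal (ρ p)) (planeImage Z t E) ≤
      (volume.withDensity fun p => ENNReal.ofReal (ρ p)) E)
    (hex : ∀ t, ∀ᵐ q, ∃ γ, IsFilippovSolution Z γ ∧ γ t = q) :
    PreservesDensity r Z f := by
  set μ : Measure (ℝ × ℝ) := volume.withDensity fun p => ENNReal.ofReal (ρ p) with hμ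
  have hρm' : Measurable fun p => ENNReal.ofReal (ρ p) := hρm.ennreal_ofReal
  have hac : volume ≪ μ := withDensity_absolutelyContinuous' hρm'.aemeasurable
    (ae_of_all _ fun p => by simpa using hρ0 p)
  have hac' : μ ≪ volume := withDensity_absolutelyContinuous _ _
  have hμdeck : ∀ m k, MeasurePreserving (deck ε m k) μ μ := by
    intro m k
    refine ⟨(hS.isometry_deck m k).continuous.measurable, ?_⟩
    ext s hs
    have hmeas : Measurable (deck ε m k) := (hS.isometry_deck m k).continuous.measurable
    rw [Measure.map_apply hmeas hs, hμ, withDensity_apply _ (hmeas hs), withDensity_apply _ hs,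
      ← (hS.measurePreserving_deck m k).setLIntegral_comp_preimage hs hρm']
    simp only [hdeck]
  have hfin : μ unitSquare ≠ ⊤ := by
    rw [hμ, withDensity_apply _ measurableSet_unitSquare]
    refine ((setLIntegral_mono measurable_const fun p _ =>
      ENNReal.ofReal_le_ofReal (hρM p)).trans_lt ?_).ne
    rw [setLIntegral_const]
    refine ENNReal.mul_lt_top ENNReal.ofReal_lt_top ?_
    rw [unitSquare, Measure.volume_eq_prod, Measure.prod_prod]
    simp
  have hdens : ∀ B, densityMeasure r f B = c * (μ (overSquare r B)).toReal := by
    intro B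
    have h1 : f =ᵐ[volume.restrict (overSquare r B)] fun p => c * ρ p :=
      ae_restrict_of_ae_restrict_of_subset inter_subset_left
        (ae_restrict_of_forall_mem measurableSet_unitSquare hf)
    rw [densityMeasure, integral_congr_ae h1, integral_const_mul,
      integral_eq_lintegral_of_nonneg_ae (ae_of_all _ fun p => (hρ0 p).le)
        hρm.aestronglyMeasurable, hμ, withDensity_apply']
  intro t A hA
  have hEm := measurableSet_overSquare hA
  have hcompl : overSquare r Aᶜ = unitSquare \ overSquare r A := by
    ext p; simp only [overSquare, unitSquare, mem_inter_iff, mem_preimage, mem_compl_iff, Set.mem_sdiff]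
    tauto
  -- The images of A and of its complement cover almost all of the square, since a solution ending
  -- at q starts over one of the two.
  have key := nullMeasurableSet_of_cover (μ := μ) (S := unitSquare)
    (X := overSquare r (timeImage r Z t A)) (Y := overSquare r (timeImage r Z t Aᶜ))
    (E := overSquare r A) measurableSet_unitSquare hfin hEm inter_subset_left inter_subset_left
    ?_ ((hS.measure_overSquare_timeImage_le hμdeck t A).trans (hle _ _)) ?_
  · exact ⟨key.1.mono_ac hac, by rw [hdens, hdens, key.2]⟩
  · refine hac' (measure_mono_null ?_ (hex t))
    rintro q ⟨hq, hnot⟩ ⟨γ, hγ, rfl⟩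
    refine hnot ?_
    by_cases h0 : Quotient.mk r (γ 0) ∈ A
    · exact Or.inl ⟨hq, γ, hγ, h0, rfl⟩
    · exact Or.inr ⟨hq, γ, hγ, h0, rfl⟩
  · rw [← hcompl]
    exact (hS.measure_overSquare_timeImage_le hμdeck t Aᶜ).trans (hle _ _)

/-- If an open part of the square, on which the density is `α`, moves into a region `R` on which the
lifted density is `α'`, then the areas are related accordingly. -/
theorem mul_volume_eq {f : ℝ × ℝ → ℝ} (hP : PreservesDensity r Z f) {U R : Set (ℝ × ℝ)}
    (hU : IsOpen U) (hUS : U ⊆ unitSquare) (hR : MeasurableSet R) {m k : ℤ}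
    (hRS : ∀ p ∈ R, deck ε m k p ∈ unitSquare) {t α α' : ℝ} (hUR : planeImage Z t U ⊆ R)
    (hf : ∀ p ∈ U, f p = α) (hf' : ∀ p ∈ R, f (deck ε m k p) = α') :
    α * (volume U).toReal = α' * (volume (planeImage Z t U)).toReal := by
  set A : Set (Quotient r) := Quotient.mk r '' U
  have hpre : Quotient.mk r ⁻¹' A = ⋃ mk : ℤ × ℤ, deck ε mk.1 mk.2 ⁻¹' U := by
    ext p
    simp only [A, mem_preimage, mem_image, mem_iUnion]
    constructor
    · rintro ⟨q, hq, hqp⟩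
      obtain ⟨m, k, rfl⟩ := (hS.mk_eq_iff _ _).1 hqp.symm
      exact ⟨(m, k), hq⟩
    · rintro ⟨mk, h⟩
      exact ⟨_, h, hS.mk_deck _ _ _⟩
  have hA : IsOpen A := by
    refine isOpen_coinduced.2 ?_
    change IsOpen (Quotient.mk r ⁻¹' A)
    rw [hpre]
    exact isOpen_iUnion fun mk => hU.preimage (hS.isometry_deck _ _).continuous
  have hAm : MeasurableSet[borel (Quotient r)] A := by
    borelize (Quotient r)
    exact hA.measurableSet
  have hE : overSquare r A = U := by
    ext p
    constructor
    · rintro ⟨hp, q, hq, hqp⟩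
      rwa [← hS.eq_of_mk_eq (hUS hq) hp hqp]
    · exact fun hp => ⟨hUS hp, p, hp, rfl⟩
  -- Every solution starting over A has a lift starting in U itself. Its endpoint then lies in R,
  -- and one deck transformation carries all of R into the square.
  have hE' : overSquare r (timeImage r Z t A) = deck ε m k '' planeImage Z t U := by
    ext q
    constructor
    · rintro ⟨hq, γ, hγ, ⟨p, hp, hpγ⟩, ht⟩
      obtain ⟨m', k', h0⟩ := (hS.mk_eq_iff _ _).1 hpγ.symm
      have hmem : deck ε m' k' (γ t) ∈ planeImage Z t U :=
        ⟨_, hS.solution_deck hγ m' k', by rw [← h0]; exact hp, rfl⟩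
      refine ⟨_, hmem, hS.eq_of_mk_eq (hRS _ (hUR hmem)) hq ?_⟩
      rw [hS.mk_deck, hS.mk_deck, ht]
    · rintro ⟨p, hp, rfl⟩
      refine ⟨hRS _ (hUR hp), ?_⟩
      obtain ⟨γ, hγ, h0, rfl⟩ := hp
      exact ⟨γ, hγ, ⟨_, h0, rfl⟩, (hS.mk_deck _ _ _).symm⟩
  have hemb := hS.measurableEmbedding_deck m k
  have hvol : volume (deck ε m k '' planeImage Z t U) = volume (planeImage Z t U) := by
    rw [← (hS.measurePreserving_deck m k).measure_preimage_emb hemb,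
      preimage_image_eq _ hemb.injective]
  have h1 := (hP t A hAm).2
  rw [densityMeasure, densityMeasure, hE, hE'] at h1
  -- The image of U may fail to be measurable, so the constancy of the density is obtained on the
  -- measurable set containing it and then restricted.
  have h2 : f =ᵐ[volume.restrict (deck ε m k '' planeImage Z t U)] fun _ => α' :=
    ae_restrict_of_ae_restrict_of_subset (image_mono hUR)
      (ae_restrict_of_forall_mem (hemb.measurableSet_image.2 hR) (by
        rintro _ ⟨p, hp, rfl⟩; exact hf' p hp))
  have h3 : f =ᵐ[volume.restrict U] fun _ => α := ae_restrict_of_forall_mem hU.measurableSet hf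
  rw [integral_congr_ae h2, integral_congr_ae h3, setIntegral_const, setIntegral_const, smul_eq_mul,
    smul_eq_mul, measureReal_def, measureReal_def, hvol] at h1
  linarith

end DeckSystem

/-! ### Solutions on intervals -/

/-- An absolutely continuous solution of the Filippov inclusion between the times `s` and `t`. -/
def IsFilippovSolutionOn (Z : ℝ × ℝ → ℝ × ℝ) (γ : ℝ → ℝ × ℝ) (s t : ℝ) : Prop :=
  AbsolutelyContinuousOnInterval γ s t ∧
    ∀ᵐ r : ℝ, r ∈ uIcc s t → ∃ v ∈ filippovSet Z (γ r), HasDerivAt γ v r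

theorem IsFilippovSolution.on {Z : ℝ × ℝ → ℝ × ℝ} {γ : ℝ → ℝ × ℝ} (h : IsFilippovSolution Z γ)
    (s t : ℝ) : IsFilippovSolutionOn Z γ s t :=
  ⟨h.1 s t, h.2.mono fun _ hr _ => hr⟩

theorem IsFilippovSolutionOn.mono {Z : ℝ × ℝ → ℝ × ℝ} {γ : ℝ → ℝ × ℝ} {s t s' t' : ℝ}
    (h : IsFilippovSolutionOn Z γ s t) (hsub : uIcc s' t' ⊆ uIcc s t) :
    IsFilippovSolutionOn Z γ s' t' :=
  ⟨h.1.mono hsub, h.2.mono fun _ hr hm => hr (hsub hm)⟩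

theorem hasDerivAt_fst {γ : ℝ → ℝ × ℝ} {v : ℝ × ℝ} {t : ℝ} (h : HasDerivAt γ v t) :
    HasDerivAt (fun r => (γ r).1) v.1 t :=
  (ContinuousLinearMap.fst ℝ ℝ ℝ).hasFDerivAt.comp_hasDerivAt t h

theorem hasDerivAt_snd {γ : ℝ → ℝ × ℝ} {v : ℝ × ℝ} {t : ℝ} (h : HasDerivAt γ v t) :
    HasDerivAt (fun r => (γ r).2) v.2 t :=
  (ContinuousLinearMap.snd ℝ ℝ ℝ).hasFDerivAt.comp_hasDerivAt t h

theorem AbsolutelyContinuousOnInterval.fst {γ : ℝ → ℝ × ℝ} {s t : ℝ}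
    (h : AbsolutelyContinuousOnInterval γ s t) :
    AbsolutelyContinuousOnInterval (fun r => (γ r).1) s t :=
  LipschitzWith.prod_fst.comp_absolutelyContinuousOnInterval h

theorem AbsolutelyContinuousOnInterval.snd {γ : ℝ → ℝ × ℝ} {s t : ℝ}
    (h : AbsolutelyContinuousOnInterval γ s t) :
    AbsolutelyContinuousOnInterval (fun r => (γ r).2) s t :=
  LipschitzWith.prod_snd.comp_absolutelyContinuousOnInterval h

/-- A field bounded by `V`. -/
def FieldBound (Z : ℝ × ℝ → ℝ × ℝ) (V : ℝ) : Prop := ∀ p, |(Z p).1| ≤ V ∧ |(Z p).2| ≤ V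

theorem FieldBound.filippov {Z : ℝ × ℝ → ℝ × ℝ} {V : ℝ} (hZ : FieldBound Z V) {p v : ℝ × ℝ}
    (hv : v ∈ filippovSet Z p) : |v.1| ≤ V ∧ |v.2| ≤ V := by
  have h := filippovSet_subset (Z := Z) (p := p) (K := Icc (-V) V ×ˢ Icc (-V) V)
    ((convex_Icc _ _).prod (convex_Icc _ _)) (isClosed_Icc.prod isClosed_Icc)
    (Eventually.of_forall fun q => ⟨abs_le.1 (hZ q).1, abs_le.1 (hZ q).2⟩) hv
  exact ⟨abs_le.2 h.1, abs_le.2 h.2⟩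

theorem dist_le_of_ae_hasDerivAt {γ : ℝ → ℝ × ℝ} {s t V : ℝ}
    (hγ : AbsolutelyContinuousOnInterval γ s t)
    (h : ∀ᵐ r, r ∈ uIcc s t → ∃ v : ℝ × ℝ, (|v.1| ≤ V ∧ |v.2| ≤ V) ∧ HasDerivAt γ v r) :
    dist (γ s) (γ t) ≤ V * dist s t := by
  rw [dist_comm, dist_comm s, Prod.dist_eq, Real.dist_eq, Real.dist_eq, Real.dist_eq]
  refine max_le (hγ.fst.abs_sub_le_of_ae_abs_deriv_le V ?_)
    (hγ.snd.abs_sub_le_of_ae_abs_deriv_le V ?_)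
  · filter_upwards [h] with r hr hrs d hd
    obtain ⟨v, hv, hdv⟩ := hr hrs
    rw [hd.unique (hasDerivAt_fst hdv)]
    exact hv.1
  · filter_upwards [h] with r hr hrs d hd
    obtain ⟨v, hv, hdv⟩ := hr hrs
    rw [hd.unique (hasDerivAt_snd hdv)]
    exact hv.2

theorem FieldBound.dist_le {Z : ℝ × ℝ → ℝ × ℝ} {V : ℝ} (hZ : FieldBound Z V) {γ : ℝ → ℝ × ℝ}
    {s t : ℝ} (hγ : IsFilippovSolutionOn Z γ s t) : dist (γ s) (γ t) ≤ V * dist s t :=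
  dist_le_of_ae_hasDerivAt hγ.1 (hγ.2.mono fun _ hr hrs =>
    let ⟨v, hv, hd⟩ := hr hrs
    ⟨v, hZ.filippov hv, hd⟩)

theorem FieldBound.nonneg {Z : ℝ × ℝ → ℝ × ℝ} {V : ℝ} (hZ : FieldBound Z V) : 0 ≤ V :=
  (abs_nonneg _).trans (hZ 0).1

theorem FieldBound.lipschitz {Z : ℝ × ℝ → ℝ × ℝ} {V : ℝ} (hZ : FieldBound Z V) {γ : ℝ → ℝ × ℝ}
    (hγ : IsFilippovSolution Z γ) : LipschitzWith V.toNNReal γ :=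
  LipschitzWith.of_dist_le_mul fun s t => by
    rw [Real.coe_toNNReal _ hZ.nonneg]; exact hZ.dist_le (hγ.on s t)

theorem isFilippovSolution_of_lipschitz {Z : ℝ × ℝ → ℝ × ℝ} {γ : ℝ → ℝ × ℝ} {K : NNReal}
    (hγ : LipschitzWith K γ) (h : ∀ᵐ t : ℝ, ∃ v ∈ filippovSet Z (γ t), HasDerivAt γ v t) :
    IsFilippovSolution Z γ :=
  ⟨fun _ _ => hγ.lipschitzOnWith.absolutelyContinuousOnInterval, h⟩

theorem FieldBound.shift {Z : ℝ × ℝ → ℝ × ℝ} {V : ℝ} (hZ : FieldBound Z V) {γ : ℝ → ℝ × ℝ}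
    (hγ : IsFilippovSolution Z γ) (c : ℝ) : IsFilippovSolution Z (fun t => γ (t + c)) := by
  have hL : LipschitzWith V.toNNReal (fun t => γ (t + c)) := LipschitzWith.of_dist_le_mul
    fun s t => by simpa using (hZ.lipschitz hγ).dist_le_mul (s + c) (t + c)
  refine isFilippovSolution_of_lipschitz hL ?_
  have := (measurePreserving_add_right (volume : Measure ℝ) c).quasiMeasurePreserving.ae hγ.2
  filter_upwards [this] with t ⟨v, hv, hd⟩
  exact ⟨v, hv, hd.comp_add_const t c⟩

/-! ### Strips -/

/-- The heights `0 = h 0 < h 1 < ⋯ < h n = 1`. -/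
structure IsStripPartition {n : ℕ} (h : Fin (n + 1) → ℝ) : Prop where
  mono : StrictMono h
  zero : h 0 = 0
  one : h (Fin.last n) = 1

/-- The heights of the discontinuity lines in the plane. -/
def levels {n : ℕ} (h : Fin (n + 1) → ℝ) : Set ℝ := {y | ∃ i, ∃ l : ℤ, y = h i + l}

/-- The heights of a translate of the `i`-th strip. -/
def strip {n : ℕ} (h : Fin (n + 1) → ℝ) (i : Fin n) (l : ℤ) : Set ℝ :=
  Ioo (h i.castSucc + l) (h i.succ + l)

theorem countable_levels {n : ℕ} (h : Fin (n + 1) → ℝ) : (levels h).Countable := by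
  have : levels h = range fun p : Fin (n + 1) × ℤ => h p.1 + p.2 := by
    ext y; simp [levels, eq_comm]
  rw [this]
  exact countable_range _

theorem isOpen_strip {n : ℕ} (h : Fin (n + 1) → ℝ) (i : Fin n) (l : ℤ) : IsOpen (strip h i l) :=
  isOpen_Ioo

theorem stripValue_eq {n : ℕ} {h : Fin (n + 1) → ℝ} (hm : StrictMono h) {V : Type*}
    [AddCommMonoid V] (v : Fin n → V) {i : Fin n} {y : ℝ}
    (hy : y ∈ Ico (h i.castSucc) (h i.succ)) : stripValue h v y = v i := by
  rw [stripValue, Finset.sum_eq_single i]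
  · exact indicator_of_mem hy _
  · intro j _ hji
    refine indicator_of_notMem (fun hj => ?_) _
    rcases lt_or_gt_of_ne hji with hlt | hlt
    · have : h j.succ ≤ h i.castSucc := hm.monotone (Fin.succ_le_castSucc_iff.2 hlt)
      linarith [hy.1, hj.2]
    · have : h i.succ ≤ h j.castSucc := hm.monotone (Fin.succ_le_castSucc_iff.2 hlt)
      linarith [hy.2, hj.1]
  · simp

namespace IsStripPartition

variable {n : ℕ} {h : Fin (n + 1) → ℝ} (hP : IsStripPartition h)
include hP

theorem nonneg (i : Fin (n + 1)) : 0 ≤ h i := hP.zero ▸ hP.mono.monotone (Fin.zero_le i)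

theorem le_one (i : Fin (n + 1)) : h i ≤ 1 := hP.one ▸ hP.mono.monotone (Fin.le_last i)

theorem exists_mem_Ico {z : ℝ} (h0 : 0 ≤ z) (h1 : z < 1) :
    ∃ i : Fin n, z ∈ Ico (h i.castSucc) (h i.succ) := by
  classical
  obtain ⟨j, hj, hmax⟩ := (Finset.univ.filter fun j => h j ≤ z).exists_maximal
    ⟨0, by simp [hP.zero, h0]⟩
  simp only [Finset.mem_filter, Finset.mem_univ, true_and] at hj hmax
  have hlast : j ≠ Fin.last n := by
    rintro rfl
    rw [hP.one] at hj
    linarith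
  obtain ⟨i, rfl⟩ := Fin.exists_castSucc_eq.2 hlast
  refine ⟨i, hj, lt_of_not_ge fun hle => ?_⟩
  exact absurd (hmax hle i.castSucc_lt_succ.le) (not_le.2 i.castSucc_lt_succ)

theorem exists_index (y : ℝ) : ∃ i : Fin n, Int.fract y ∈ Ico (h i.castSucc) (h i.succ) :=
  hP.exists_mem_Ico (Int.fract_nonneg y) (Int.fract_lt_one y)

/-- The index of the strip over the height `y`. -/
noncomputable def index (y : ℝ) : Fin n := (hP.exists_index y).choose

theorem fract_mem_Ico (y : ℝ) :
    Int.fract y ∈ Ico (h (hP.index y).castSucc) (h (hP.index y).succ) :=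
  (hP.exists_index y).choose_spec

theorem stripValue_fract {V : Type*} [AddCommMonoid V] (v : Fin n → V) (y : ℝ) :
    stripValue h v (Int.fract y) = v (hP.index y) :=
  stripValue_eq hP.mono v (hP.fract_mem_Ico y)

theorem index_eq {y : ℝ} {i : Fin n} (hy : Int.fract y ∈ Ico (h i.castSucc) (h i.succ)) :
    hP.index y = i := by
  -- Taking the index itself as the value on each strip turns well-definedness of `stripValue` into
  -- uniqueness of the index.
  have h1 := hP.stripValue_fract (fun i : Fin n => (i : ℕ)) y
  rw [stripValue_eq hP.mono _ hy] at h1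
  exact (Fin.ext h1).symm

theorem index_eq_of_mem_strip {y : ℝ} {i : Fin n} {l : ℤ} (hy : y ∈ strip h i l) :
    hP.index y = i := by
  have h0 := hP.nonneg i.castSucc
  have h1 := hP.le_one i.succ
  have hf : Int.fract y = y - l := by
    rw [Int.fract_eq_iff]
    exact ⟨by linarith [hy.1], by linarith [hy.2], l, by ring⟩
  exact hP.index_eq ⟨by rw [hf]; linarith [hy.1], by rw [hf]; linarith [hy.2]⟩

theorem index_add_int (y : ℝ) (k : ℤ) : hP.index (y + k) = hP.index y :=
  hP.index_eq (by rw [Int.fract_add_intCast]; exact hP.fract_mem_Ico y)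

theorem exists_mem_strip {y : ℝ} (hy : y ∉ levels h) : ∃ l : ℤ, y ∈ strip h (hP.index y) l := by
  obtain ⟨h1, h2⟩ := hP.fract_mem_Ico y
  have h3 : Int.fract y + ⌊y⌋ = y := Int.fract_add_floor y
  refine ⟨⌊y⌋, lt_of_le_of_ne (by linarith) fun he => hy ⟨_, _, he.symm⟩, by linarith⟩

theorem index_eventuallyEq {y : ℝ} (hy : y ∉ levels h) :
    ∀ᶠ z in 𝓝 y, hP.index z = hP.index y := by
  obtain ⟨l, hl⟩ := hP.exists_mem_strip hy
  filter_upwards [(isOpen_strip h _ l).mem_nhds hl] with z hz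
  exact hP.index_eq_of_mem_strip hz

theorem measurable_comp_index (f : Fin n → ℝ) : Measurable fun y => f (hP.index y) := by
  have h1 : (fun y => f (hP.index y)) = fun y => stripValue h f (Int.fract y) := by
    ext y; rw [hP.stripValue_fract]
  rw [h1]
  have h2 : Measurable (stripValue h f) := by
    unfold stripValue
    exact Finset.measurable_sum _ fun i _ => measurable_const.indicator measurableSet_Ico
  exact h2.comp measurable_fract

omit hP in
-- The reflection y ↦ 1 - y exchanges a strip of [0,1] with its reverse; y ↦ -y differs from it by a
-- unit translation, hence the shift -l - 1.
theorem neg_mem_strip (hsym : ∀ i, h i.rev = 1 - h i) {y : ℝ} {i : Fin n} {l : ℤ}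
    (hy : y ∈ strip h i l) : -y ∈ strip h i.rev (-l - 1) := by
  have h1 : h i.rev.castSucc = 1 - h i.succ := by rw [← Fin.rev_succ, hsym]
  have h2 : h i.rev.succ = 1 - h i.castSucc := by rw [← Fin.rev_castSucc, hsym]
  constructor
  · rw [h1]; push_cast; linarith [hy.2]
  · rw [h2]; push_cast; linarith [hy.1]

omit hP in
theorem neg_mem_levels (hsym : ∀ i, h i.rev = 1 - h i) {y : ℝ} (hy : y ∈ levels h) :
    -y ∈ levels h := by
  obtain ⟨i, l, rfl⟩ := hy
  exact ⟨i.rev, -l - 1, by rw [hsym]; push_cast; ring⟩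

omit hP in
theorem neg_mem_levels_iff (hsym : ∀ i, h i.rev = 1 - h i) {y : ℝ} :
    -y ∈ levels h ↔ y ∈ levels h :=
  ⟨fun hy => by simpa using neg_mem_levels hsym hy, neg_mem_levels hsym⟩

/-- The levels are excluded because the half-open strips are reflected into strips that are closed
on the other side. -/
theorem index_neg (hsym : ∀ i, h i.rev = 1 - h i) {y : ℝ} (hy : y ∉ levels h) :
    hP.index (-y) = (hP.index y).rev := by
  obtain ⟨l, hl⟩ := hP.exists_mem_strip hy
  exact hP.index_eq_of_mem_strip (neg_mem_strip hsym hl)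

end IsStripPartition

/-! ### The fields -/

/-- The field on a column of the plane; `e = 1` on even columns and `e = -1` on odd ones. -/
noncomputable def columnField {n : ℕ} {h : Fin (n + 1) → ℝ} (hP : IsStripPartition h)
    (a b : Fin n → ℝ) (e : ℝ) (p : ℝ × ℝ) : ℝ × ℝ :=
  (a (hP.index (e * p.2)), e * b (hP.index (e * p.2)))

/-- The sign by which a deck transformation of the Klein bottle acts on heights. -/
noncomputable def kleinSign (m : ℤ) : ℝ := if Even m then 1 else -1

theorem kleinSign_eq (m : ℤ) : kleinSign m = 1 ∨ kleinSign m = -1 := by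
  unfold kleinSign; split_ifs <;> simp

theorem kleinSign_mul_self (m : ℤ) : kleinSign m * kleinSign m = 1 := by
  rcases kleinSign_eq m with h | h <;> simp [h]

theorem kleinSign_add (m k : ℤ) : kleinSign (m + k) = kleinSign m * kleinSign k := by
  unfold kleinSign
  by_cases h1 : Even m <;> by_cases h2 : Even k <;> simp [Int.even_add, h1, h2]

section Fields

variable {n : ℕ} {h : Fin (n + 1) → ℝ} (hP : IsStripPartition h) (a b : Fin n → ℝ)

theorem torusField_eq (p : ℝ × ℝ) : torusField h a b p = columnField hP a b 1 p := by
  simp [torusField, columnField, hP.stripValue_fract]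

theorem kleinField_eq (p : ℝ × ℝ) :
    kleinField h a b p = columnField hP a b (kleinSign ⌊p.1⌋) p := by
  unfold kleinField columnField kleinSign
  split_ifs <;> simp [hP.stripValue_fract]

include hP in
theorem deckSystem_torus : DeckSystem torusSetoid (fun _ => 1) (torusField h a b) where
  sign _ := Or.inl rfl
  sign_zero := rfl
  rel_iff p q := by
    refine exists_congr fun m => exists_congr fun k => ?_
    simp [deck, Prod.ext_iff]
  equivariant m k p := by
    simp [torusField_eq hP, columnField, deck, hP.index_add_int]

include hP in
theorem deckSystem_klein : DeckSystem kleinSetoid kleinSign (kleinField h a b) where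
  sign := kleinSign_eq
  sign_zero := by simp [kleinSign]
  rel_iff p q := by
    refine exists_congr fun m => exists_congr fun k => ?_
    simp [deck, Prod.ext_iff, kleinSign]
  equivariant m k p := by
    -- Measured in the orientation of its column, the height changes only by an integer under a deck
    -- transformation, so the strip index does not change.
    have h1 : kleinSign (⌊p.1⌋ + m) * (kleinSign m * p.2 + k) =
        kleinSign ⌊p.1⌋ * p.2 +
          ((if Even (⌊p.1⌋ + m) then k else -k : ℤ) : ℝ) := by
      rw [kleinSign_add]
      have h2 := kleinSign_mul_self m
      have h3 : ((if Even (⌊p.1⌋ + m) then k else -k : ℤ) : ℝ) = kleinSign (⌊p.1⌋ + m) * k := by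
        unfold kleinSign; split_ifs <;> simp
      rw [h3, kleinSign_add]
      linear_combination (kleinSign ⌊p.1⌋ * p.2) * h2
    simp only [kleinField_eq hP, columnField, deck, Int.floor_add_intCast]
    rw [h1, hP.index_add_int, kleinSign_add]
    ext <;> simp only
    ring

theorem abs_columnField_le {e : ℝ} (he : e = 1 ∨ e = -1) (p : ℝ × ℝ) :
    |(columnField hP a b e p).1| ≤ 1 + ∑ i, (|a i| + |b i|) ∧
      |(columnField hP a b e p).2| ≤ 1 + ∑ i, (|a i| + |b i|) := by
  have h1 : ∀ i, |a i| + |b i| ≤ ∑ i, (|a i| + |b i|) := fun i =>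
    Finset.single_le_sum (f := fun i => |a i| + |b i|) (fun i _ => by positivity)
      (Finset.mem_univ i)
  have h2 := h1 (hP.index (e * p.2))
  have h3 := abs_nonneg (a (hP.index (e * p.2)))
  have h4 := abs_nonneg (b (hP.index (e * p.2)))
  have h5 : |e| = 1 := by rcases he with h | h <;> simp [h]
  simp only [columnField, abs_mul, h5, one_mul]
  constructor <;> linarith

include hP in
theorem fieldBound_torus :
    FieldBound (torusField h a b) (1 + ∑ i, (|a i| + |b i|)) := fun p => by
  rw [torusField_eq hP]; exact abs_columnField_le hP a b (Or.inl rfl) p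

include hP in
theorem fieldBound_klein :
    FieldBound (kleinField h a b) (1 + ∑ i, (|a i| + |b i|)) := fun p => by
  rw [kleinField_eq hP]; exact abs_columnField_le hP a b (kleinSign_eq _) p

/-! ### Columns as shear fields, with the height as clock coordinate. -/

variable {b} (hb : ∀ i, 0 < b i)

/-- The shear coordinates of a column. -/
noncomputable def columnData (hb : ∀ i, 0 < b i) (e : ℝ) (he : e = 1 ∨ e = -1) : ShearData where
  τ y := (b (hP.index (e * y)))⁻¹
  -- The slope dx/dy equals a / (e b), which is e (a / b) because e = ±1.
  σ y := e * (a (hP.index (e * y)) / b (hP.index (e * y)))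
  D := (fun y => e * y) ⁻¹' levels h
  m := (1 + ∑ i, b i)⁻¹
  M := ∑ i, ((b i)⁻¹ + |a i / b i|)
  m_pos := by
    have : 0 ≤ ∑ i, b i := Finset.sum_nonneg fun i _ => (hb i).le
    positivity
  le_τ y := by
    have := Finset.single_le_sum (f := b) (fun i _ => (hb i).le) (Finset.mem_univ (hP.index (e * y)))
    exact inv_anti₀ (hb _) (by linarith)
  τ_le y := by
    have h1 : ∀ i, 0 < (b i)⁻¹ := fun i => inv_pos.2 (hb i)
    refine le_trans ?_ (Finset.single_le_sum (f := fun i => (b i)⁻¹ + |a i / b i|)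
      (fun i _ => add_nonneg (h1 i).le (abs_nonneg _)) (Finset.mem_univ (hP.index (e * y))))
    simp
  abs_σ_le y := by
    have h1 : ∀ i, 0 < (b i)⁻¹ := fun i => inv_pos.2 (hb i)
    have h5 : |e| = 1 := by rcases he with h | h <;> simp [h]
    refine le_trans ?_ (Finset.single_le_sum (f := fun i => (b i)⁻¹ + |a i / b i|)
      (fun i _ => add_nonneg (h1 i).le (abs_nonneg _)) (Finset.mem_univ (hP.index (e * y))))
    rw [abs_mul, h5, one_mul]
    simpa using (hb _).le
  measurable_τ := (hP.measurable_comp_index fun i => (b i)⁻¹).comp (measurable_const_mul e)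
  measurable_σ := ((hP.measurable_comp_index fun i => a i / b i).comp
    (measurable_const_mul e)).const_mul e
  countable_D := (countable_levels h).preimage_of_injOn fun x _ y _ hxy => by
    have h5 : e ≠ 0 := by rcases he with h | h <;> simp [h]
    exact mul_left_cancel₀ h5 hxy
  locConst y hy := by
    have h1 : Tendsto (fun z => e * z) (𝓝 y) (𝓝 (e * y)) := (continuous_const_mul e).tendsto y
    filter_upwards [h1.eventually (hP.index_eventuallyEq hy)] with z hz
    rw [hz]; exact ⟨rfl, rfl⟩

variable {Z : ℝ × ℝ → ℝ × ℝ} {U : Set (ℝ × ℝ)} {e : ℝ}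

/-- Away from the discontinuity lines the Filippov set is a single vector. -/
theorem filippovSet_column (hU : IsOpen U) (hZ : ∀ p ∈ U, Z p = columnField hP a b e p)
    {p : ℝ × ℝ} (hp : p ∈ U) (hl : e * p.2 ∉ levels h) :
    filippovSet Z p = {columnField hP a b e p} := by
  refine filippovSet_eq_singleton ?_
  have h1 : Tendsto (fun q : ℝ × ℝ => e * q.2) (𝓝 p) (𝓝 (e * p.2)) :=
    (continuous_const.mul continuous_snd).tendsto p
  filter_upwards [hU.mem_nhds hp, h1.eventually (hP.index_eventuallyEq hl)] with q hq hq'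
  rw [hZ q hq, columnField, columnField, hq']

include hb in
-- The condition that e times the vertical component is at least min b defines a closed half-plane
-- containing all nearby values of the field. It passes to the Filippov set, also on the
-- discontinuity lines inside the column.
theorem filippovSet_column_snd (he : e = 1 ∨ e = -1) (hU : IsOpen U)
    (hZ : ∀ p ∈ U, Z p = columnField hP a b e p)
    {p : ℝ × ℝ} (hp : p ∈ U) {v : ℝ × ℝ} (hv : v ∈ filippovSet Z p) : v.2 ≠ 0 := by
  have hn : Nonempty (Fin n) := ⟨hP.index 0⟩
  obtain ⟨j, hj⟩ := Finite.exists_min b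
  have hK : Convex ℝ {v : ℝ × ℝ | b j ≤ e * v.2} :=
    convex_halfSpace_ge ⟨fun x y => by simp [mul_add], fun c x => by simp; ring⟩ (b j)
  have hKc : IsClosed {v : ℝ × ℝ | b j ≤ e * v.2} :=
    isClosed_le continuous_const (continuous_const.mul continuous_snd)
  have hmem := filippovSet_subset hK hKc (p := p) (Z := Z) (by
    filter_upwards [hU.mem_nhds hp] with q hq
    rw [hZ q hq]
    have : e * e = 1 := by rcases he with h | h <;> simp [h]
    simp only [columnField, ← mul_assoc, this, one_mul]
    exact hj _) hv
  intro h0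
  have h1 : b j ≤ e * v.2 := hmem
  rw [h0, mul_zero] at h1
  exact absurd (hb j) (not_lt.2 h1)

/-- Solutions within a column are translations in shear coordinates. -/
theorem column_conj (he : e = 1 ∨ e = -1) (hU : IsOpen U)
    (hZ : ∀ p ∈ U, Z p = columnField hP a b e p) {γ : ℝ → ℝ × ℝ} {s t : ℝ}
    (hγ : IsFilippovSolutionOn Z γ s t) (hγU : ∀ r ∈ uIcc s t, γ r ∈ U) :
    (columnData hP a hb e he).chart (γ t).swap =
      (columnData hP a hb e he).chart (γ s).swap + (e * (t - s), 0) := by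
  have := (columnData hP a hb e he).conj (v := fun r => (γ r).2) (u := fun r => (γ r).1) (s := e)
    hγ.1.snd hγ.1.fst (by
      filter_upwards [hγ.2] with r hr hrs
      obtain ⟨v, hv, hd⟩ := hr hrs
      refine ⟨v.2, v.1, hasDerivAt_snd hd, hasDerivAt_fst hd,
        filippovSet_column_snd hP a hb he hU hZ (hγU r hrs) hv, fun hl => ?_⟩
      rw [filippovSet_column hP a hU hZ (hγU r hrs) hl] at hv
      obtain rfl : v = _ := hv
      have hbp := (hb (hP.index (e * (γ r).2))).ne'
      have hee : e * e = 1 := by rcases he with h | h <;> simp [h]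
      simp only [columnField, columnData]
      refine ⟨by field_simp, ?_⟩
      field_simp
      rw [pow_two, hee, one_mul])
  simp only [ShearData.chart, Prod.swap, Prod.mk_add_mk, add_zero]
  rw [this.1, this.2]

include hb in
/-- Solutions within a column exist, in both time directions. -/
theorem exists_column_curve (he : e = 1 ∨ e = -1) (p : ℝ × ℝ) {θ : ℝ} (hθ : θ ≠ 0) :
    ∃ (γ : ℝ → ℝ × ℝ) (K : NNReal), γ 0 = p ∧ LipschitzWith K γ ∧
      ∀ᵐ t, e * (γ t).2 ∉ levels h ∧ HasDerivAt γ (θ • columnField hP a b e (γ t)) t := by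
  have he0 : e ≠ 0 := by rcases he with h | h <;> simp [h]
  obtain ⟨v, u, K, hv0, hu0, hv, hu, hae⟩ :=
    (columnData hP a hb e he).exists_curve p.2 p.1 (mul_ne_zero hθ he0)
  refine ⟨fun t => (u t, v t), max K K, by simp [hv0, hu0], hu.prodMk hv, ?_⟩
  filter_upwards [hae] with t ⟨hD, hdv, hdu⟩
  refine ⟨hD, ?_⟩
  have h1 := hdu.prodMk hdv
  convert h1 using 1
  have hbp := (hb (hP.index (e * v t))).ne'
  have hee : e * e = 1 := by rcases he with h | h <;> simp [h]
  ext
  · simp only [columnField, columnData, Prod.smul_mk, smul_eq_mul]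
    field_simp
    rw [pow_two, hee, one_mul]
  · simp only [columnField, columnData, Prod.smul_mk, smul_eq_mul]
    field_simp

end Fields

/-- The invariant measure of a shear field in swapped coordinates. -/
theorem ShearData.withDensity_snd_le_of_translate (c : ShearData) {B B' : Set (ℝ × ℝ)} (e : ℝ × ℝ)
    (h : ∀ q ∈ B', ∃ p ∈ B, c.chart q.swap = c.chart p.swap + e) :
    (volume.withDensity fun p : ℝ × ℝ => ENNReal.ofReal (c.τ p.2)) B' ≤
      (volume.withDensity fun p : ℝ × ℝ => ENNReal.ofReal (c.τ p.2)) B := by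
  have hsw : MeasurePreserving (Prod.swap : ℝ × ℝ → ℝ × ℝ) volume volume :=
    Measure.measurePreserving_swap
  have hmp : MeasurePreserving (Prod.swap : ℝ × ℝ → ℝ × ℝ) c.meas
      (volume.withDensity fun p : ℝ × ℝ => ENNReal.ofReal (c.τ p.2)) := by
    refine ⟨measurable_swap, ?_⟩
    ext s hs
    rw [Measure.map_apply measurable_swap hs, ShearData.meas,
      withDensity_apply _ (measurable_swap hs), withDensity_apply _ hs,
      ← hsw.setLIntegral_comp_preimage hs
        (by exact (c.measurable_τ.comp measurable_snd).ennreal_ofReal)]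
    rfl
  have hemb : MeasurableEmbedding (Prod.swap : ℝ × ℝ → ℝ × ℝ) :=
    MeasurableEquiv.prodComm.measurableEmbedding
  rw [← hmp.measure_preimage_emb hemb, ← hmp.measure_preimage_emb hemb]
  refine c.meas_le_of_translate e fun q hq => ?_
  obtain ⟨p, hp, hpq⟩ := h q.swap hq
  exact ⟨p.swap, by simpa using hp, by simpa using hpq⟩

/-- Invariance on the torus. -/
theorem preservesDensity_torus {n : ℕ} {h : Fin (n + 1) → ℝ} (hP : IsStripPartition h)
    (a b α : Fin n → ℝ) (hb : ∀ i, 0 < b i) {c : ℝ} (hc : ∀ i, α i = c / b i) :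
    PreservesDensity torusSetoid (torusField h a b) (stripDensity h α) := by
  set C := columnData hP a hb 1 (Or.inl rfl) with hC
  have hZ : ∀ p ∈ (univ : Set (ℝ × ℝ)), torusField h a b p = columnField hP a b 1 p :=
    fun p _ => torusField_eq hP a b p
  refine (deckSystem_torus hP a b).preservesDensity (ρ := fun p => C.τ p.2) (M := C.M) (c := c)
    (C.measurable_τ.comp measurable_snd) (fun p => C.τ_pos _) (fun p => C.τ_le _) ?_ ?_ ?_ ?_
  · intro m k p
    simp [hC, columnData, deck, hP.index_add_int]
  · intro p hp
    have hf : Int.fract p.2 = p.2 := Int.fract_eq_self.2 hp.2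
    rw [stripDensity, ← hf, hP.stripValue_fract, hc]
    simp [hC, columnData, div_eq_mul_inv, hf]
  · intro t E
    refine C.withDensity_snd_le_of_translate (1 * (t - 0), 0) ?_
    rintro q ⟨γ, hγ, h0, rfl⟩
    exact ⟨γ 0, h0, column_conj hP a hb (Or.inl rfl) isOpen_univ hZ (hγ.on 0 t) (by simp)⟩
  · intro t
    refine ae_of_all _ fun q => ?_
    obtain ⟨γ, K, h0, hK, hae⟩ := exists_column_curve hP a hb (Or.inl rfl) q one_ne_zero
    have hγ : IsFilippovSolution (torusField h a b) γ := by
      refine isFilippovSolution_of_lipschitz hK ?_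
      filter_upwards [hae] with r ⟨hl, hd⟩
      rw [filippovSet_column hP a isOpen_univ hZ (mem_univ _) hl]
      exact ⟨_, rfl, by simpa using hd⟩
    -- The field is autonomous: a solution through q at time 0 is shifted so as to be at q at time
    -- t.
    exact ⟨_, (fieldBound_torus hP a b).shift hγ (-t), by simp [h0]⟩

/-! ### Horizontal strips of the Klein bottle -/

theorem floor_eventuallyEq {x : ℝ} (hx : x ∉ range ((↑) : ℤ → ℝ)) :
    ∀ᶠ z in 𝓝 x, ⌊z⌋ = ⌊x⌋ := by
  have h1 : (⌊x⌋ : ℝ) < x := lt_of_le_of_ne (Int.floor_le x) fun he => hx ⟨_, he⟩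
  filter_upwards [isOpen_Ioo.mem_nhds (show x ∈ Ioo (⌊x⌋ : ℝ) (⌊x⌋ + 1) from
    ⟨h1, Int.lt_floor_add_one x⟩)] with z hz
  exact Int.floor_eq_iff.2 ⟨hz.1.le, hz.2⟩

/-- The index of the strip that lies in the `m`-th column at the height of the strip `i` of the
zeroth column. -/
def flipIndex {n : ℕ} (i : Fin n) (m : ℤ) : Fin n := if Even m then i else i.rev

section KleinStrips

variable {n : ℕ} {h : Fin (n + 1) → ℝ} (hP : IsStripPartition h)
  (hsym : ∀ i, h i.rev = 1 - h i) (a b : Fin n → ℝ)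

include hP hsym in
-- An odd column shows the square upside down, so at a fixed height the columns alternate between
-- strip i and its reverse.
theorem kleinField_strip {i : Fin n} {l : ℤ} {p : ℝ × ℝ} (hp : p.2 ∈ strip h i l) :
    kleinField h a b p =
      (a (flipIndex i ⌊p.1⌋), kleinSign ⌊p.1⌋ * b (flipIndex i ⌊p.1⌋)) := by
  rw [kleinField_eq hP, columnField]
  have h1 : hP.index (kleinSign ⌊p.1⌋ * p.2) = flipIndex i ⌊p.1⌋ := by
    unfold kleinSign flipIndex
    split_ifs
    · rw [one_mul]; exact hP.index_eq_of_mem_strip hp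
    · rw [neg_one_mul]
      exact hP.index_eq_of_mem_strip (IsStripPartition.neg_mem_strip hsym hp)
  rw [h1]

/-- The shear coordinates of a strip that is crossed in the direction `θ`. -/
noncomputable def stripData (i : Fin n) {θ : ℝ} (hi : 0 < θ * a i) (hi' : 0 < θ * a i.rev) :
    ShearData where
  τ x := (θ * a (flipIndex i ⌊x⌋))⁻¹
  σ x := kleinSign ⌊x⌋ * (b (flipIndex i ⌊x⌋) / a (flipIndex i ⌊x⌋))
  D := range ((↑) : ℤ → ℝ)
  m := min (θ * a i)⁻¹ (θ * a i.rev)⁻¹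
  M := (θ * a i)⁻¹ + (θ * a i.rev)⁻¹ + |b i / a i| + |b i.rev / a i.rev|
  m_pos := lt_min (inv_pos.2 hi) (inv_pos.2 hi')
  le_τ x := by
    unfold flipIndex
    split_ifs
    · exact min_le_left _ _
    · exact min_le_right _ _
  τ_le x := by
    have h1 := inv_pos.2 hi
    have h2 := inv_pos.2 hi'
    have h3 := abs_nonneg (b i / a i)
    have h4 := abs_nonneg (b i.rev / a i.rev)
    unfold flipIndex
    split_ifs <;> linarith
  abs_σ_le x := by
    have h1 := inv_pos.2 hi
    have h2 := inv_pos.2 hi'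
    have h3 := abs_nonneg (b i / a i)
    have h4 := abs_nonneg (b i.rev / a i.rev)
    have h5 : |kleinSign ⌊x⌋| = 1 := by rcases kleinSign_eq ⌊x⌋ with h | h <;> simp [h]
    rw [abs_mul, h5, one_mul]
    unfold flipIndex
    split_ifs <;> linarith
  measurable_τ := (measurable_from_top (f := fun m : ℤ => (θ * a (flipIndex i m))⁻¹)).comp
    Int.measurable_floor
  measurable_σ := (measurable_from_top
    (f := fun m : ℤ => kleinSign m * (b (flipIndex i m) / a (flipIndex i m)))).comp
    Int.measurable_floor
  countable_D := countable_range _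
  locConst x hx := by
    filter_upwards [floor_eventuallyEq hx] with z hz
    rw [hz]; exact ⟨rfl, rfl⟩

variable {a b} {i : Fin n} {θ : ℝ} (hi : 0 < θ * a i) (hi' : 0 < θ * a i.rev)

include hi hi' in
theorem mul_flipIndex_pos (m : ℤ) : 0 < θ * a (flipIndex i m) := by
  unfold flipIndex; split_ifs <;> assumption

include hP hsym in
theorem filippovSet_strip {l : ℤ} {p : ℝ × ℝ} (hp : p.2 ∈ strip h i l)
    (hx : p.1 ∉ range ((↑) : ℤ → ℝ)) :
    filippovSet (kleinField h a b) p =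
      {(a (flipIndex i ⌊p.1⌋), kleinSign ⌊p.1⌋ * b (flipIndex i ⌊p.1⌋))} := by
  refine filippovSet_eq_singleton ?_
  filter_upwards [((isOpen_strip h i l).preimage continuous_snd).mem_nhds hp,
    (continuous_fst.tendsto p).eventually (floor_eventuallyEq hx)] with q hq hq'
  rw [kleinField_strip hP hsym a b hq, hq']

include hP hsym hi hi' in
-- Since a i and a i.rev have the same sign θ, both sides of a wall push across it, and the closed
-- half-plane argument excludes sliding along the wall.
theorem filippovSet_strip_fst {l : ℤ} {p : ℝ × ℝ} (hp : p.2 ∈ strip h i l) {v : ℝ × ℝ}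
    (hv : v ∈ filippovSet (kleinField h a b) p) : v.1 ≠ 0 := by
  have hK : Convex ℝ {v : ℝ × ℝ | min (θ * a i) (θ * a i.rev) ≤ θ * v.1} :=
    convex_halfSpace_ge ⟨fun x y => by simp [mul_add], fun c x => by simp; ring⟩ _
  have hKc : IsClosed {v : ℝ × ℝ | min (θ * a i) (θ * a i.rev) ≤ θ * v.1} :=
    isClosed_le continuous_const (continuous_const.mul continuous_fst)
  have hmem := filippovSet_subset hK hKc (p := p) (Z := kleinField h a b) (by
    filter_upwards [((isOpen_strip h i l).preimage continuous_snd).mem_nhds hp] with q hq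
    rw [kleinField_strip hP hsym a b hq]
    change min (θ * a i) (θ * a i.rev) ≤ θ * a (flipIndex i ⌊q.1⌋)
    unfold flipIndex
    split_ifs
    · exact min_le_left _ _
    · exact min_le_right _ _) hv
  intro h0
  have h1 : min (θ * a i) (θ * a i.rev) ≤ θ * v.1 := hmem
  rw [h0, mul_zero] at h1
  exact absurd (lt_min hi hi') (not_lt.2 h1)

include hP hsym in
/-- Solutions within a strip that is crossed horizontally are translations in shear coordinates. -/
theorem strip_conj {l : ℤ} {γ : ℝ → ℝ × ℝ} {s t : ℝ}
    (hγ : IsFilippovSolutionOn (kleinField h a b) γ s t)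
    (hγU : ∀ r ∈ uIcc s t, (γ r).2 ∈ strip h i l) (hθ : θ = 1 ∨ θ = -1) :
    (stripData a b i hi hi').chart (γ t) =
      (stripData a b i hi hi').chart (γ s) + (θ * (t - s), 0) := by
  have := (stripData a b i hi hi').conj (v := fun r => (γ r).1) (u := fun r => (γ r).2) (s := θ)
    hγ.1.fst hγ.1.snd (by
      filter_upwards [hγ.2] with r hr hrs
      obtain ⟨v, hv, hd⟩ := hr hrs
      refine ⟨v.1, v.2, hasDerivAt_fst hd, hasDerivAt_snd hd,
        filippovSet_strip_fst hP hsym hi hi' (hγU r hrs) hv, fun hl => ?_⟩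
      rw [filippovSet_strip hP hsym (hγU r hrs) hl] at hv
      obtain rfl : v = _ := hv
      have h1 := mul_flipIndex_pos hi hi' ⌊(γ r).1⌋
      have h2 : a (flipIndex i ⌊(γ r).1⌋) ≠ 0 := right_ne_zero_of_mul h1.ne'
      have h3 : θ * θ = 1 := by rcases hθ with h | h <;> simp [h]
      have h4 : θ ≠ 0 := by rcases hθ with h | h <;> simp [h]
      simp only [stripData]
      refine ⟨?_, by field_simp⟩
      field_simp
      rw [pow_two, h3])
  simp only [ShearData.chart, Prod.mk_add_mk, add_zero]
  refine Prod.ext this.1 this.2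

/-- Solutions within a strip that is crossed horizontally exist. -/
theorem exists_strip_curve (hi : 0 < θ * a i) (hi' : 0 < θ * a i.rev) (hθ : θ = 1 ∨ θ = -1)
    (b : Fin n → ℝ) (p : ℝ × ℝ) :
    ∃ (γ : ℝ → ℝ × ℝ) (K : NNReal), γ 0 = p ∧ LipschitzWith K γ ∧
      ∀ᵐ t, (γ t).1 ∉ range ((↑) : ℤ → ℝ) ∧
        HasDerivAt γ (a (flipIndex i ⌊(γ t).1⌋),
          kleinSign ⌊(γ t).1⌋ * b (flipIndex i ⌊(γ t).1⌋)) t := by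
  have hθ0 : θ ≠ 0 := by rcases hθ with h | h <;> simp [h]
  obtain ⟨v, u, K, hv0, hu0, hv, hu, hae⟩ :=
    (stripData a b i hi hi').exists_curve p.1 p.2 hθ0
  refine ⟨fun t => (v t, u t), max K K, by simp [hv0, hu0], hv.prodMk hu, ?_⟩
  filter_upwards [hae] with t ⟨hD, hdv, hdu⟩
  refine ⟨hD, ?_⟩
  have h1 := hdv.prodMk hdu
  convert h1 using 1
  have h1 := mul_flipIndex_pos hi hi' ⌊v t⌋
  have h2 : a (flipIndex i ⌊v t⌋) ≠ 0 := right_ne_zero_of_mul h1.ne'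
  have h3 : θ * θ = 1 := by rcases hθ with h | h <;> simp [h]
  ext
  · simp only [stripData, div_inv_eq_mul, ← mul_assoc, h3, one_mul]
  · simp only [stripData, div_inv_eq_mul, ← mul_assoc, h3, one_mul]
    field_simp

end KleinStrips

/-! ### The triangle wave and the first integral -/

/-- The distance to the nearest even integer, as the primitive of its slope. -/
noncomputable def triangleWave (x : ℝ) : ℝ := ∫ z in (0 : ℝ)..x, kleinSign ⌊z⌋

theorem measurable_kleinSign_floor : Measurable fun z : ℝ => kleinSign ⌊z⌋ :=
  (measurable_from_top (f := kleinSign)).comp Int.measurable_floor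

theorem abs_kleinSign_le (m : ℤ) : |kleinSign m| ≤ 1 := by
  rcases kleinSign_eq m with h | h <;> simp [h]

theorem lipschitz_triangleWave : LipschitzWith 1 triangleWave := by
  have := lipschitzWith_integral measurable_kleinSign_floor (M := 1) fun z => abs_kleinSign_le ⌊z⌋
  rwa [Real.toNNReal_one] at this

theorem hasDerivAt_triangleWave {x : ℝ} (hx : x ∉ range ((↑) : ℤ → ℝ)) :
    HasDerivAt triangleWave (kleinSign ⌊x⌋) x :=
  hasDerivAt_integral_of_eventuallyEq measurable_kleinSign_floor (fun z => abs_kleinSign_le ⌊z⌋)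
    ((floor_eventuallyEq hx).mono fun z hz => by rw [hz])

theorem triangleWave_add_one (k : ℤ) :
    triangleWave (k + 1) = triangleWave k + kleinSign k := by
  have hi := intervalIntegrable_of_abs_le measurable_kleinSign_floor fun z => abs_kleinSign_le ⌊z⌋
  have h1 : triangleWave (k + 1) - triangleWave k = ∫ z in (k : ℝ)..(k + 1), kleinSign ⌊z⌋ :=
    intervalIntegral.integral_interval_sub_left (hi _ _) (hi _ _)
  have h2 : ∫ z in (k : ℝ)..(k + 1), kleinSign ⌊z⌋ = ∫ _ in (k : ℝ)..(k + 1), kleinSign k := by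
    rw [intervalIntegral.integral_of_le (by linarith), intervalIntegral.integral_of_le (by linarith),
      ← integral_Ico_eq_integral_Ioc, ← integral_Ico_eq_integral_Ioc]
    refine setIntegral_congr_fun measurableSet_Ico fun z hz => ?_
    simp only [Int.floor_eq_iff.2 hz]
  rw [h2] at h1
  simp at h1
  linarith

theorem triangleWave_intCast (k : ℤ) : triangleWave k = if Even k then 0 else 1 := by
  induction k using Int.induction_on with
  | zero => simp [triangleWave]
  | succ k ih =>
    have := triangleWave_add_one k
    push_cast at ih this ⊢
    rw [this, ih]
    rcases Nat.even_or_odd k with hk | hk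
    · simp [kleinSign, hk]
    · simp [kleinSign, hk, Nat.not_even_iff_odd.2 hk]
  | pred k ih =>
    have := triangleWave_add_one (-k - 1)
    push_cast at ih this ⊢
    rw [sub_add_cancel] at this
    rw [this] at ih
    by_cases hk : Even (k : ℤ)
    · have h1 : ¬ Even (-(k : ℤ) - 1) := by rw [Int.even_iff] at hk ⊢; omega
      simp only [kleinSign, h1, if_false, even_neg, hk, if_true] at ih ⊢
      linarith
    · have h1 : Even (-(k : ℤ) - 1) := by rw [Int.even_iff] at hk ⊢; omega
      simp only [kleinSign, h1, if_false, even_neg, hk, if_true] at ih ⊢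
      linarith

/-- This serves at times when a curve is momentarily at rest at a point where the Lipschitz function
may have no derivative. -/
theorem LipschitzWith.hasDerivAt_comp_zero {E : Type*} [NormedAddCommGroup E] [NormedSpace ℝ E]
    {K : NNReal} {f : E → ℝ} (hf : LipschitzWith K f) {γ : ℝ → E} {t : ℝ}
    (h : HasDerivAt γ 0 t) : HasDerivAt (fun r => f (γ r)) 0 t := by
  rw [hasDerivAt_iff_isLittleO] at h ⊢
  simp only [smul_zero, sub_zero] at h ⊢
  refine Asymptotics.IsBigO.trans_isLittleO ?_ h
  refine Asymptotics.IsBigO.of_bound K (Eventually.of_forall fun r => ?_)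
  rw [← dist_eq_norm, ← dist_eq_norm]
  exact hf.dist_le_mul _ _

section FirstIntegral

variable {n : ℕ} {h : Fin (n + 1) → ℝ} (hP : IsStripPartition h)
  (hsym : ∀ i, h i.rev = 1 - h i) (a : Fin n → ℝ) {b : Fin n → ℝ} (hb : ∀ i, 0 < b i)

/-- The height dependent part of the first integral. -/
noncomputable def heightIntegral : ℝ → ℝ := (columnData hP a hb 1 (Or.inl rfl)).drift

/-- The first integral of the Klein bottle field. -/
noncomputable def firstIntegral (p : ℝ × ℝ) : ℝ := heightIntegral hP a hb p.2 - triangleWave p.1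

/-- The exceptional values of the first integral. -/
def badValues : Set ℝ :=
  {c | ∃ d ∈ levels h, ∃ k : ℤ, c = heightIntegral hP a hb d - triangleWave k}

theorem hasDerivAt_heightIntegral {y : ℝ} (hy : y ∉ levels h) :
    HasDerivAt (heightIntegral hP a hb) (a (hP.index y) / b (hP.index y)) y := by
  have := (columnData hP a hb 1 (Or.inl rfl)).hasDerivAt_drift (v := y)
    (by simpa [columnData] using hy)
  have h2 : (columnData hP a hb 1 (Or.inl rfl)).σ y = a (hP.index y) / b (hP.index y) := by
    simp [columnData]
  rwa [h2] at this

theorem exists_lipschitz_firstIntegral : ∃ K, LipschitzWith K (firstIntegral hP a hb) :=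
  ⟨_, (((columnData hP a hb 1 (Or.inl rfl)).lipschitz_drift.comp LipschitzWith.prod_snd).sub
    (lipschitz_triangleWave.comp LipschitzWith.prod_fst))⟩

theorem heightIntegral_sub (y z : ℝ) : heightIntegral hP a hb z - heightIntegral hP a hb y =
    ∫ x in y..z, a (hP.index x) / b (hP.index x) := by
  have hi := intervalIntegrable_of_abs_le (columnData hP a hb 1 (Or.inl rfl)).measurable_σ
    (columnData hP a hb 1 (Or.inl rfl)).abs_σ_le
  have := intervalIntegral.integral_interval_sub_left (hi 0 z) (hi 0 y)
  simpa [columnData, heightIntegral, ShearData.drift] using this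

/-- The integrand vanishes on such a strip. Hence wall points of strips with a i = 0 share their
first integral with a corner and are exceptional as well. -/
theorem heightIntegral_eq_of_mem_strip {i : Fin n} {l : ℤ} (hi : a i = 0) {y : ℝ}
    (hy : y ∈ strip h i l) :
    heightIntegral hP a hb y = heightIntegral hP a hb (h i.castSucc + l) := by
  have h1 := heightIntegral_sub hP a hb (h i.castSucc + l) y
  rw [intervalIntegral.integral_of_le hy.1.le, setIntegral_congr_fun measurableSet_Ioc
    (g := fun _ => 0)] at h1
  · simp at h1; linarith
  · intro z hz
    have : hP.index z = i := hP.index_eq_of_mem_strip (l := l) ⟨hz.1, hz.2.trans_lt hy.2⟩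
    simp [this, hi]

/-- The integrand has period one. The exceptional values therefore form finitely many arithmetic
progressions. -/
theorem heightIntegral_add_int (y : ℝ) (l : ℤ) :
    heightIntegral hP a hb (y + l) = heightIntegral hP a hb y + l * heightIntegral hP a hb 1 := by
  have h1 := heightIntegral_sub hP a hb y (y + l)
  have hper : Function.Periodic (fun x => a (hP.index x) / b (hP.index x)) 1 := fun x => by
    have := hP.index_add_int x 1
    simp only [Int.cast_one] at this
    simp only [this]
  have h2 := hper.intervalIntegral_add_zsmul_eq l y (by
    have hi := intervalIntegrable_of_abs_le (columnData hP a hb 1 (Or.inl rfl)).measurable_σ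
      (columnData hP a hb 1 (Or.inl rfl)).abs_σ_le
    simpa [columnData] using hi)
  have h3 := hper.intervalIntegral_add_eq y 0
  have h4 := heightIntegral_sub hP a hb 0 1
  have h5 : heightIntegral hP a hb 0 = 0 := by simp [heightIntegral, ShearData.drift]
  rw [zero_add] at h3
  simp only [zsmul_eq_mul, mul_one] at h2
  rw [h2, h3, ← h4, h5, sub_zero] at h1
  linarith

theorem countable_badValues : (badValues hP a hb).Countable := by
  have h1 := (countable_levels h).prod (countable_univ (α := ℤ))
  refine (h1.image fun q => heightIntegral hP a hb q.1 - triangleWave q.2).mono ?_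
  rintro c ⟨d, hd, k, rfl⟩
  exact ⟨(d, k), ⟨hd, mem_univ _⟩, rfl⟩

theorem isClosed_range_add_mul (x s : ℝ) : IsClosed (range fun l : ℤ => x + l * s) := by
  rcases eq_or_ne s 0 with rfl | hs
  · simp
  · have h1 : (range fun l : ℤ => x + l * s) =
        ((Homeomorph.mulRight₀ s hs).trans (Homeomorph.addLeft x)) '' range ((↑) : ℤ → ℝ) := by
      rw [← range_comp]; rfl
    rw [h1]
    exact (Homeomorph.isClosed_image _).2 Int.isClosedEmbedding_coe_real.isClosed_range

/-- The triangle wave takes only the values 0 and 1 at integers, so finitely many arithmetic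
progressions (possibly single points) remain. Closedness gives every non-exceptional value a
positive distance from the exceptional ones. -/
theorem isClosed_badValues : IsClosed (badValues hP a hb) := by
  have h1 : badValues hP a hb = ⋃ i : Fin (n + 1), ⋃ w : Fin 2, range fun l : ℤ =>
      (heightIntegral hP a hb (h i) - (w : ℕ)) + l * heightIntegral hP a hb 1 := by
    ext c
    simp only [badValues, levels, mem_iUnion, mem_range]
    constructor
    · rintro ⟨_, ⟨i, l, rfl⟩, k, rfl⟩
      rw [heightIntegral_add_int, triangleWave_intCast]
      by_cases hk : Even k
      · exact ⟨i, 0, l, by simp [hk]⟩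
      · exact ⟨i, 1, l, by simp [hk]; ring⟩
    · rintro ⟨i, w, l, rfl⟩
      refine ⟨_, ⟨i, l, rfl⟩, (w : ℕ), ?_⟩
      rw [heightIntegral_add_int, triangleWave_intCast]
      fin_cases w
      · simp
      · simp; ring
  rw [h1]
  exact isClosed_iUnion_of_finite fun i => isClosed_iUnion_of_finite fun w =>
    isClosed_range_add_mul _ _

/-- By Fubini it suffices to fix y. The triangle wave has slope ±1 off the integers, so it takes
values in a countable set only on a null set. -/
theorem volume_preimage_badValues :
    volume (firstIntegral hP a hb ⁻¹' badValues hP a hb) = 0 := by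
  obtain ⟨K, hK⟩ := exists_lipschitz_firstIntegral hP a hb
  have hm := (isClosed_badValues hP a hb).preimage hK.continuous |>.measurableSet
  rw [Measure.volume_eq_prod, Measure.prod_apply_symm hm]
  refine (lintegral_congr fun y => ?_).trans lintegral_zero
  have hc : ((fun c => heightIntegral hP a hb y - c) '' badValues hP a hb).Countable :=
    (countable_badValues hP a hb).image _
  have h1 := ae_hasDerivAt_eq_zero_of_mem_countable triangleWave hc
  refine measure_mono_null (t := {x | ¬ (x ∉ range ((↑) : ℤ → ℝ) ∧ _)}) ?_
    (((countable_range _).ae_notMem volume).and h1)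
  rintro x hx ⟨hxi, hx0⟩
  have h2 := hx0 ⟨_, hx, by simp [firstIntegral]⟩ _ (hasDerivAt_triangleWave hxi)
  rcases kleinSign_eq ⌊x⌋ with h | h <;> rw [h] at h2 <;> norm_num at h2

include hsym in
theorem index_sign_ratio (hκ : ∀ i, a i / b i = a i.rev / b i.rev) {e : ℝ} (he : e = 1 ∨ e = -1)
    {y : ℝ} (hy : y ∉ levels h) :
    a (hP.index (e * y)) / b (hP.index (e * y)) = a (hP.index y) / b (hP.index y) := by
  rcases he with rfl | rfl
  · rw [one_mul]
  · rw [neg_one_mul, hP.index_neg hsym hy, ← hκ]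

theorem sign_mem_levels_iff (hsym : ∀ i, h i.rev = 1 - h i) {e : ℝ} (he : e = 1 ∨ e = -1) {y : ℝ} :
    e * y ∈ levels h ↔ y ∈ levels h := by
  rcases he with rfl | rfl
  · rw [one_mul]
  · rw [neg_one_mul, IsStripPartition.neg_mem_levels_iff hsym]

include hb in
-- Equal slopes and positive b force a i and a i.rev to have the same sign, which is θ.
theorem exists_direction (hκ : ∀ i, a i / b i = a i.rev / b i.rev) {i : Fin n} (hi : a i ≠ 0) :
    ∃ θ : ℝ, (θ = 1 ∨ θ = -1) ∧ 0 < θ * a i ∧ 0 < θ * a i.rev := by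
  have h1 : a i.rev = a i * (b i.rev / b i) := by
    have := hκ i
    have h2 := (hb i).ne'
    have h3 := (hb i.rev).ne'
    field_simp at this ⊢
    linarith
  have h4 : 0 < b i.rev / b i := div_pos (hb _) (hb _)
  rcases lt_or_gt_of_ne hi with h | h
  · refine ⟨-1, Or.inr rfl, by linarith, ?_⟩
    rw [h1]
    have := mul_pos (neg_pos.2 h) h4
    linarith
  · exact ⟨1, Or.inl rfl, by linarith, by rw [h1, one_mul]; exact mul_pos h h4⟩

/-- The open column `k < x < k + 1`. -/
def openColumn (k : ℤ) : Set (ℝ × ℝ) := Prod.fst ⁻¹' Ioo (k : ℝ) (k + 1)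

theorem isOpen_openColumn (k : ℤ) : IsOpen (openColumn k) := isOpen_Ioo.preimage continuous_fst

theorem floor_of_mem_openColumn {k : ℤ} {p : ℝ × ℝ} (hp : p ∈ openColumn k) : ⌊p.1⌋ = k :=
  Int.floor_eq_iff.2 ⟨hp.1.le, hp.2⟩

theorem kleinField_openColumn (b : Fin n → ℝ) (k : ℤ) :
    ∀ p ∈ openColumn k, kleinField h a b p = columnField hP a b (kleinSign k) p := fun p hp => by
  rw [kleinField_eq hP, floor_of_mem_openColumn hp]

include hsym in
/-- The first integral is constant along solutions. -/
theorem firstIntegral_eq (hκ : ∀ i, a i / b i = a i.rev / b i.rev) {γ : ℝ → ℝ × ℝ} {s t : ℝ}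
    (hγ : IsFilippovSolutionOn (kleinField h a b) γ s t) :
    firstIntegral hP a hb (γ t) = firstIntegral hP a hb (γ s) := by
  obtain ⟨K, hK⟩ := exists_lipschitz_firstIntegral hP a hb
  have h1 := (hK.comp_absolutelyContinuousOnInterval hγ.1).sub_eq_of_ae_hasDerivAt 0 (by
    filter_upwards [hγ.2, ae_hasDerivAt_eq_zero_of_mem_countable (fun r => (γ r).1)
      (countable_range ((↑) : ℤ → ℝ)), ae_hasDerivAt_eq_zero_of_mem_countable (fun r => (γ r).2)
      (countable_levels h)] with r hr hrx hry hrs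
    obtain ⟨v, hv, hd⟩ := hr hrs
    by_cases hx : (γ r).1 ∈ range ((↑) : ℤ → ℝ)
    · have hv1 := hrx hx _ (hasDerivAt_fst hd)
      by_cases hy : (γ r).2 ∈ levels h
      · have hv2 := hry hy _ (hasDerivAt_snd hd)
        have hv0 : v = 0 := Prod.ext hv1 hv2
        rw [hv0] at hd
        exact hK.hasDerivAt_comp_zero hd
      · obtain ⟨l, hl⟩ := hP.exists_mem_strip hy
        -- Remaining on a wall requires a horizontal velocity of zero, which transversality excludes
        -- unless a vanishes on the strip; there the height integral is locally constant.
        have ha : a (hP.index (γ r).2) = 0 := by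
          by_contra h0
          obtain ⟨θ, -, hi, hi'⟩ := exists_direction a hb hκ h0
          exact filippovSet_strip_fst hP hsym hi hi' hl hv hv1
        have h2 := (hasDerivAt_heightIntegral hP a hb hy).comp r (hasDerivAt_snd hd)
        rw [ha, zero_div, zero_mul] at h2
        have h3 := hasDerivAt_fst hd
        rw [hv1] at h3
        have h4 := h2.sub (lipschitz_triangleWave.hasDerivAt_comp_zero h3)
        rwa [sub_zero] at h4
    · set e := kleinSign ⌊(γ r).1⌋ with he
      have hU : γ r ∈ openColumn ⌊(γ r).1⌋ :=
        ⟨lt_of_le_of_ne (Int.floor_le _) fun h => hx ⟨_, h⟩, Int.lt_floor_add_one _⟩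
      have hZ := kleinField_openColumn hP a b ⌊(γ r).1⌋
      have hv2 := filippovSet_column_snd hP a hb (kleinSign_eq _) (isOpen_openColumn _) hZ hU hv
      have hy : (γ r).2 ∉ levels h := fun hy => hv2 (hry hy _ (hasDerivAt_snd hd))
      have hey : e * (γ r).2 ∉ levels h := by rwa [sign_mem_levels_iff hsym (kleinSign_eq _)]
      rw [filippovSet_column hP a (isOpen_openColumn _) hZ hU hey] at hv
      obtain rfl : v = _ := hv
      have h2 := ((hasDerivAt_heightIntegral hP a hb hy).comp r (hasDerivAt_snd hd)).sub
        ((hasDerivAt_triangleWave hx).comp r (hasDerivAt_fst hd))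
      rw [← index_sign_ratio hP hsym a hκ (kleinSign_eq ⌊(γ r).1⌋) hy] at h2
      have hbp := (hb (hP.index (kleinSign ⌊(γ r).1⌋ * (γ r).2))).ne'
      -- Inside a column with sign e the derivative is (a/b)(e b) - e a = 0.
      have h3 : a (hP.index (kleinSign ⌊(γ r).1⌋ * (γ r).2)) /
          b (hP.index (kleinSign ⌊(γ r).1⌋ * (γ r).2)) *
          (columnField hP a b (kleinSign ⌊(γ r).1⌋) (γ r)).2 -
          kleinSign ⌊(γ r).1⌋ * (columnField hP a b (kleinSign ⌊(γ r).1⌋) (γ r)).1 = 0 := by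
        simp only [columnField]
        field_simp
        ring
      rw [h3] at h2
      exact h2)
  linarith

end FirstIntegral

/-! ### Gluing solutions -/

theorem FieldBound.shiftOn {Z : ℝ × ℝ → ℝ × ℝ} {V : ℝ} (hZ : FieldBound Z V) {γ : ℝ → ℝ × ℝ}
    {s t : ℝ} (hγ : IsFilippovSolutionOn Z γ s t) (c : ℝ) :
    IsFilippovSolutionOn Z (fun r => γ (r + c)) (s - c) (t - c) := by
  have hmem : ∀ r, r ∈ uIcc (s - c) (t - c) → r + c ∈ uIcc s t := by
    intro r hr
    rw [mem_uIcc] at hr ⊢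
    rcases hr with hr | hr
    · exact Or.inl ⟨by linarith [hr.1], by linarith [hr.2]⟩
    · exact Or.inr ⟨by linarith [hr.1], by linarith [hr.2]⟩
  constructor
  · refine LipschitzOnWith.absolutelyContinuousOnInterval (K := V.toNNReal) ?_
    refine LipschitzOnWith.of_dist_le_mul fun x hx y hy => ?_
    rw [Real.coe_toNNReal _ hZ.nonneg]
    have := hZ.dist_le (hγ.mono (uIcc_subset_uIcc (hmem x hx) (hmem y hy)))
    simpa using this
  · have := (measurePreserving_add_right (volume : Measure ℝ) c).quasiMeasurePreserving.ae hγ.2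
    filter_upwards [this] with r hr hrs
    obtain ⟨v, hv, hd⟩ := hr (hmem r hrs)
    exact ⟨v, hv, hd.comp_add_const r c⟩

/-- All pieces have the same Lipschitz constant V, so the glued curve is Lipschitz; the inclusion
can fail in addition only at the countably many gluing times. -/
theorem FieldBound.glue {Z : ℝ × ℝ → ℝ × ℝ} {V : ℝ} (hZ : FieldBound Z V) {δ : ℝ} (hδ : 0 < δ)
    {f : ℤ → ℝ → ℝ × ℝ} (hf : ∀ j : ℤ, IsFilippovSolutionOn Z (f j) (j * δ) ((j + 1) * δ))
    (hm : ∀ j : ℤ, f j ((j + 1) * δ) = f (j + 1) ((j + 1) * δ)) :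
    IsFilippovSolution Z (fun t => f ⌊t / δ⌋ t) := by
  set γ : ℝ → ℝ × ℝ := fun t => f ⌊t / δ⌋ t with hγ
  have hmono : ∀ j : ℤ, (j : ℝ) * δ ≤ (j + 1) * δ := fun j => by nlinarith
  have hIco : ∀ (j : ℤ) (t : ℝ), (j : ℝ) * δ ≤ t → t < (j + 1) * δ → γ t = f j t := by
    intro j t h1 h2
    have : ⌊t / δ⌋ = j := Int.floor_eq_iff.2 ⟨(le_div_iff₀ hδ).2 h1, (div_lt_iff₀ hδ).2 h2⟩
    simp only [hγ, this]
  have hIcc : ∀ (j : ℤ) (t : ℝ), t ∈ Icc ((j : ℝ) * δ) ((j + 1) * δ) → γ t = f j t := by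
    intro j t ht
    rcases ht.2.lt_or_eq with h2 | h2
    · exact hIco j t ht.1 h2
    · rw [h2, hm]
      refine hIco (j + 1) _ ?_ ?_ <;> push_cast
      · exact le_rfl
      · nlinarith
  have hloc : ∀ (j : ℤ) (s t : ℝ), s ∈ Icc ((j : ℝ) * δ) ((j + 1) * δ) →
      t ∈ Icc ((j : ℝ) * δ) ((j + 1) * δ) → dist (γ s) (γ t) ≤ V * dist s t := by
    intro j s t hs ht
    rw [hIcc j s hs, hIcc j t ht]
    rw [← uIcc_of_le (hmono j)] at hs ht
    exact hZ.dist_le ((hf j).mono (uIcc_subset_uIcc hs ht))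
  -- Induction on the number k of gluing times between the intervals containing s and t.
  have hchain : ∀ (k : ℕ) (j : ℤ) (s t : ℝ), s ∈ Icc ((j : ℝ) * δ) ((j + 1) * δ) →
      t ∈ Icc (((j : ℝ) + k) * δ) ((j + k + 1) * δ) → s ≤ t → dist (γ s) (γ t) ≤ V * (t - s) := by
    intro k
    induction k with
    | zero =>
      intro j s t hs ht hst
      have := hloc j s t hs (by simpa using ht)
      rwa [dist_comm s, Real.dist_eq, abs_of_nonneg (sub_nonneg.2 hst)] at this
    | succ k ih =>
      intro j s t hs ht hst
      push_cast at ht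
      have h1 : s ≤ (j + k + 1) * δ := hs.2.trans (by
        have : (0 : ℝ) ≤ k * δ := by positivity
        nlinarith)
      have h2 : (j + k + 1) * δ ≤ t := by linarith [ht.1]
      have h3 := ih j s ((j + k + 1) * δ) hs ⟨by nlinarith, le_rfl⟩ h1
      have h4 := hloc (j + k + 1) ((j + k + 1) * δ) t (by push_cast; constructor <;> nlinarith)
        (by push_cast; constructor <;> linarith [ht.2])
      rw [dist_comm (_ * δ), Real.dist_eq, abs_of_nonneg (sub_nonneg.2 h2)] at h4
      linarith [dist_triangle (γ s) (γ ((j + k + 1) * δ)) (γ t)]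
  have hfl : ∀ t : ℝ, t ∈ Icc ((⌊t / δ⌋ : ℝ) * δ) ((⌊t / δ⌋ + 1) * δ) := fun t =>
    ⟨(le_div_iff₀ hδ).1 (Int.floor_le _), ((div_lt_iff₀ hδ).1 (Int.lt_floor_add_one _)).le⟩
  have hle : ∀ s t : ℝ, s ≤ t → dist (γ s) (γ t) ≤ V * dist s t := by
    intro s t hst
    have h1 : ⌊s / δ⌋ ≤ ⌊t / δ⌋ := Int.floor_mono (by gcongr)
    have h2 : (⌊s / δ⌋ : ℝ) + ((⌊t / δ⌋ - ⌊s / δ⌋).toNat : ℕ) = ⌊t / δ⌋ := by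
      have : ((⌊t / δ⌋ - ⌊s / δ⌋).toNat : ℤ) = ⌊t / δ⌋ - ⌊s / δ⌋ := Int.toNat_of_nonneg (by omega)
      have h3 : (((⌊t / δ⌋ - ⌊s / δ⌋).toNat : ℤ) : ℝ) = ⌊t / δ⌋ - ⌊s / δ⌋ := by
        rw [this]; push_cast; ring
      rw [Int.cast_natCast] at h3
      linarith
    have h4 := hchain (⌊t / δ⌋ - ⌊s / δ⌋).toNat ⌊s / δ⌋ s t (hfl s) (by rw [h2]; exact hfl t) hst
    rwa [dist_comm s, Real.dist_eq, abs_of_nonneg (sub_nonneg.2 hst)]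
  have hL : LipschitzWith V.toNNReal γ := LipschitzWith.of_dist_le_mul fun s t => by
    rw [Real.coe_toNNReal _ hZ.nonneg]
    rcases le_total s t with hst | hst
    · exact hle s t hst
    · rw [dist_comm, dist_comm s]; exact hle t s hst
  refine isFilippovSolution_of_lipschitz hL ?_
  have h1 : ∀ᵐ t : ℝ, ∀ j : ℤ, t ∈ uIcc ((j : ℝ) * δ) ((j + 1) * δ) →
      ∃ v ∈ filippovSet Z (f j t), HasDerivAt (f j) v t := ae_all_iff.2 fun j => (hf j).2
  filter_upwards [h1, (countable_range fun j : ℤ => (j : ℝ) * δ).ae_notMem volume] with t ht htn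
  obtain ⟨v, hv, hd⟩ := ht ⌊t / δ⌋ (by rw [uIcc_of_le (hmono _)]; exact hfl t)
  have h2 : t ∈ Ioo ((⌊t / δ⌋ : ℝ) * δ) ((⌊t / δ⌋ + 1) * δ) :=
    ⟨lt_of_le_of_ne (hfl t).1 fun he => htn ⟨_, he⟩, (div_lt_iff₀ hδ).1 (Int.lt_floor_add_one _)⟩
  refine ⟨v, hv, hd.congr_of_eventuallyEq ?_⟩
  filter_upwards [isOpen_Ioo.mem_nhds h2] with z hz
  exact hIco _ z hz.1.le hz.2

/-- If every point of `G` has a solution on a uniform time interval which returns to `G` at both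
ends, then solutions starting in `G` exist for all times. -/
theorem FieldBound.exists_solution {Z : ℝ × ℝ → ℝ × ℝ} {V : ℝ} (hZ : FieldBound Z V) {δ : ℝ}
    (hδ : 0 < δ) {G : Set (ℝ × ℝ)} (hloc : ∀ p ∈ G, ∃ γ : ℝ → ℝ × ℝ, γ 0 = p ∧
      IsFilippovSolutionOn Z γ (-δ) δ ∧ γ δ ∈ G ∧ γ (-δ) ∈ G) {p : ℝ × ℝ} (hp : p ∈ G) :
    ∃ γ, IsFilippovSolution Z γ ∧ γ 0 = p := by
  choose Γ h0 hs h1 h2 using fun q : G => hloc q q.2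
  set fwd : ℕ → G := fun k => Nat.rec ⟨p, hp⟩ (fun _ q => ⟨Γ q δ, h1 q⟩) k with hfwd
  set bwd : ℕ → G := fun k => Nat.rec ⟨p, hp⟩ (fun _ q => ⟨Γ q (-δ), h2 q⟩) k with hbwd
  have hfs : ∀ k, (fwd (k + 1) : ℝ × ℝ) = Γ (fwd k) δ := fun k => rfl
  have hbs : ∀ k, (bwd (k + 1) : ℝ × ℝ) = Γ (bwd k) (-δ) := fun k => rfl
  -- The index `Int.negSucc k` stands for the time interval from -(k+1)δ to -kδ. The piece chosen at
  -- the k-th backward point passes through that point at the right end of the interval.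
  set f : ℤ → ℝ → ℝ × ℝ := fun j t => match j with
    | Int.ofNat k => Γ (fwd k) (t + -(k * δ))
    | Int.negSucc k => Γ (bwd k) (t + k * δ) with hfdef
  have hsol := hZ.glue (f := f) hδ ?_ ?_
  · refine ⟨_, hsol, ?_⟩
    have : ⌊(0 : ℝ) / δ⌋ = Int.ofNat 0 := by simp
    simp only [this, hfdef]
    simp only [CharP.cast_eq_zero, zero_mul, neg_zero, add_zero]
    rw [h0]
    rfl
  · rintro (k | k)
    · have h3 := hZ.shiftOn ((hs (fwd k)).mono (s' := 0) (t' := δ)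
        (uIcc_subset_uIcc (by rw [mem_uIcc]; left; constructor <;> linarith) right_mem_uIcc))
        (-(k * δ))
      convert h3 using 1
      · simp
      · simp; ring
    · have h3 := hZ.shiftOn ((hs (bwd k)).mono (s' := -δ) (t' := 0)
        (uIcc_subset_uIcc left_mem_uIcc (by rw [mem_uIcc]; left; constructor <;> linarith)))
        (k * δ)
      convert h3 using 1
      · rw [Int.cast_negSucc]; push_cast; ring
      · rw [Int.cast_negSucc]; push_cast; ring
  · rintro (k | k)
    · change Γ (fwd k) _ = Γ (fwd (k + 1)) _
      have e1 : ((Int.ofNat k : ℤ) + 1 : ℝ) * δ + -(k * δ) = δ := by simp; ring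
      have e2 : ((Int.ofNat k : ℤ) + 1 : ℝ) * δ + -((k + 1 : ℕ) * δ) = 0 := by simp
      rw [e1, e2, h0, hfs]
    · rcases k with - | k
      · change Γ (bwd 0) _ = Γ (fwd 0) _
        have e1 : ((Int.negSucc 0 : ℤ) + 1 : ℝ) * δ + (0 : ℕ) * δ = 0 := by simp
        have e2 : ((Int.negSucc 0 : ℤ) + 1 : ℝ) * δ + -((0 : ℕ) * δ) = 0 := by simp
        rw [e1, e2, h0, h0]
        rfl
      · change Γ (bwd (k + 1)) _ = Γ (bwd k) _
        have e1 : ((Int.negSucc (k + 1) : ℤ) + 1 : ℝ) * δ + (k + 1 : ℕ) * δ = 0 := by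
          rw [Int.cast_negSucc]; push_cast; ring
        have e2 : ((Int.negSucc (k + 1) : ℤ) + 1 : ℝ) * δ + k * δ = -δ := by
          rw [Int.cast_negSucc]; push_cast; ring
        rw [e1, e2, h0, hbs]

/-! ### Invariance on the Klein bottle -/

/-- Only W has to be measurable; B will be a time image. -/
theorem withDensity_eq_mul_of_eqOn {f g : ℝ × ℝ → ENNReal} {k : ENNReal} (hk : k ≠ ⊤)
    {W B : Set (ℝ × ℝ)} (hW : MeasurableSet W) (h : ∀ p ∈ W, f p = k * g p) (hB : B ⊆ W) :
    volume.withDensity f B = k * volume.withDensity g B := by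
  rw [withDensity_apply', withDensity_apply', ← lintegral_const_mul' _ _ hk]
  exact lintegral_congr_ae (ae_restrict_of_ae_restrict_of_subset hB
    (ae_restrict_of_forall_mem hW h))

/-- A monotone-additive operation on sets that does not increase the measure of the pieces of a
countable measurable partition does not increase the measure. -/
theorem measure_le_of_partition {Ω ι : Type*} [MeasurableSpace Ω] [Countable ι] {μ : Measure Ω}
    {R : ι → Set Ω} (hR : ∀ i, MeasurableSet (R i)) (hd : Pairwise (Function.onFun Disjoint R))
    {T : Set Ω → Set Ω} {B : Set Ω} (hT : T B ⊆ ⋃ i, T (B ∩ R i))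
    (hle : ∀ i, μ (T (B ∩ R i)) ≤ μ (B ∩ R i)) : μ (T B) ≤ μ B := by
  calc μ (T B) ≤ ∑' i, μ (T (B ∩ R i)) := (measure_mono hT).trans (measure_iUnion_le _)
    _ ≤ ∑' i, μ.restrict B (R i) := by
        refine ENNReal.tsum_le_tsum fun i => (hle i).trans_eq ?_
        rw [Measure.restrict_apply (hR i), inter_comm]
    _ = μ.restrict B (⋃ i, R i) := (measure_iUnion hd hR).symm
    _ ≤ μ B := (measure_mono (subset_univ _)).trans_eq (Measure.restrict_apply_univ B)

section Klein

variable {n : ℕ} {h : Fin (n + 1) → ℝ} (hP : IsStripPartition h)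
  (hsym : ∀ i, h i.rev = 1 - h i) (a : Fin n → ℝ) {b : Fin n → ℝ} (hb : ∀ i, 0 < b i)

/-- The density of the invariant measure. -/
noncomputable def kleinWeight (b : Fin n → ℝ) (p : ℝ × ℝ) : ℝ :=
  (b (hP.index (kleinSign ⌊p.1⌋ * p.2)))⁻¹

theorem measurable_kleinWeight : Measurable (kleinWeight hP b) :=
  (hP.measurable_comp_index fun i => (b i)⁻¹).comp
    ((measurable_kleinSign_floor.comp measurable_fst).mul measurable_snd)

/-- The invariant measure in the plane. -/
noncomputable def kleinMeasure (b : Fin n → ℝ) : Measure (ℝ × ℝ) :=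
  volume.withDensity fun p => ENNReal.ofReal (kleinWeight hP b p)

/-- The points whose distance from the vertical discontinuity lines is at least `r`, in the
column `k`. -/
def innerColumn (r : ℝ) (k : ℤ) : Set (ℝ × ℝ) := {p | k + r ≤ p.1 ∧ p.1 ≤ k + 1 - r}

/-- The points whose distance from the horizontal discontinuity lines is at least `r`, in the
strip `i`, `l`. -/
def innerStrip (h : Fin (n + 1) → ℝ) (r : ℝ) (i : Fin n) (l : ℤ) : Set (ℝ × ℝ) :=
  {p | h i.castSucc + l + r ≤ p.2 ∧ p.2 ≤ h i.succ + l - r}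

theorem mem_openColumn_of_dist_lt {r : ℝ} {k : ℤ} {p q : ℝ × ℝ} (hp : p ∈ innerColumn r k)
    (hq : dist q p < r) : q ∈ openColumn k := by
  have h1 : |q.1 - p.1| < r := (le_max_left _ _).trans_lt hq
  rw [abs_lt] at h1
  exact ⟨by linarith [hp.1], by linarith [hp.2]⟩

theorem mem_strip_of_dist_lt {r : ℝ} {i : Fin n} {l : ℤ} {p q : ℝ × ℝ}
    (hp : p ∈ innerStrip h r i l) (hq : dist q p < r) : q.2 ∈ strip h i l := by
  have h1 : |q.2 - p.2| < r := (le_max_right _ _).trans_lt hq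
  rw [abs_lt] at h1
  exact ⟨by linarith [hp.1], by linarith [hp.2]⟩

/-- A point at which the first integral takes a value away from the exceptional ones is either far
from the vertical lines, or well inside a strip that is crossed horizontally. -/
theorem mem_inner_of_firstIntegral {K : NNReal} (hK : LipschitzWith K (firstIntegral hP a hb))
    {r : ℝ} (hr : 0 < r) {p : ℝ × ℝ}
    (hp : ∀ c ∈ badValues hP a hb, (K + 1) * r ≤ |firstIntegral hP a hb p - c|)
    (hcol : ∀ k, p ∉ innerColumn r k) :
    ∃ l : ℤ, a (hP.index p.2) ≠ 0 ∧ p.2 ∈ strip h (hP.index p.2) l ∧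
      p ∈ innerStrip h r (hP.index p.2) l := by
  -- Outside all inner columns, p is within r of some wall x = k.
  obtain ⟨k, hk⟩ : ∃ k : ℤ, |p.1 - k| < r := by
    have h1 := hcol ⌊p.1⌋
    simp only [innerColumn, not_and_or, not_le, mem_ofPred_eq] at h1
    have h2 := Int.floor_le p.1
    have h3 := Int.lt_floor_add_one p.1
    rcases h1 with h1 | h1
    · exact ⟨⌊p.1⌋, by rw [abs_of_nonneg (by linarith)]; linarith⟩
    · exact ⟨⌊p.1⌋ + 1, by push_cast; rw [abs_of_neg (by linarith)]; linarith⟩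
  -- A wall point (k, y) with exceptional value and |p.2 - y| < r would be within r of p, so the
  -- values would differ by at most K r, less than (K + 1) r.
  have hfar : ∀ y, heightIntegral hP a hb y - triangleWave k ∈ badValues hP a hb →
      r ≤ |p.2 - y| := by
    intro y hy
    by_contra hlt
    have h1 := hp _ hy
    have h2 := hK.dist_le_mul p ((k : ℝ), y)
    have h3 : dist p ((k : ℝ), y) < r := max_lt hk (not_le.1 hlt)
    have h4 : (K : ℝ) * dist p ((k : ℝ), y) ≤ K * r :=
      mul_le_mul_of_nonneg_left h3.le K.coe_nonneg
    rw [Real.dist_eq] at h2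
    have h5 : (K + 1) * r ≤ K * r := h1.trans (h2.trans h4)
    linarith
  have hlev : ∀ d ∈ levels h, r ≤ |p.2 - d| := fun d hd => hfar d ⟨d, hd, k, rfl⟩
  have hnot : p.2 ∉ levels h := fun hm => by
    have := hlev _ hm
    simp at this
    linarith
  obtain ⟨l, hl⟩ := hP.exists_mem_strip hnot
  refine ⟨l, fun h0 => ?_, hl, ?_, ?_⟩
  -- If a vanished on the strip, the wall point at the height of p itself would have an exceptional
  -- value, at vertical distance zero.
  · have h1 := hfar p.2 ⟨h (hP.index p.2).castSucc + l, ⟨_, _, rfl⟩, k, by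
      rw [heightIntegral_eq_of_mem_strip hP a hb h0 hl]⟩
    simp at h1
    linarith
  · have := hlev _ ⟨(hP.index p.2).castSucc, l, rfl⟩
    rw [abs_of_pos (by linarith [hl.1])] at this
    linarith
  · have := hlev _ ⟨(hP.index p.2).succ, l, rfl⟩
    rw [abs_of_neg (by linarith [hl.2])] at this
    linarith

/-! ### Short-time estimates within a single chart. -/

/-- The bound for the speed. -/
noncomputable def speedBound (a b : Fin n → ℝ) : ℝ := 1 + ∑ i, (|a i| + |b i|)

theorem speedBound_pos (a b : Fin n → ℝ) : 0 < speedBound a b := by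
  have : 0 ≤ ∑ i, (|a i| + |b i|) := Finset.sum_nonneg fun i _ => by positivity
  unfold speedBound
  linarith

theorem dist_zero_le_of_mem_uIcc {t r : ℝ} (hr : r ∈ uIcc 0 t) : dist r 0 ≤ |t| := by
  rw [Real.dist_eq, sub_zero]
  simpa using abs_sub_left_of_mem_uIcc hr

include hP in
theorem dist_solution_lt {γ : ℝ → ℝ × ℝ} (hγ : IsFilippovSolution (kleinField h a b) γ) {t ρ : ℝ}
    (ht : speedBound a b * |t| < ρ) {r : ℝ} (hr : r ∈ uIcc 0 t) : dist (γ r) (γ 0) < ρ :=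
  ((fieldBound_klein hP a b).dist_le (hγ.on r 0)).trans_lt
    ((mul_le_mul_of_nonneg_left (dist_zero_le_of_mem_uIcc hr) (speedBound_pos a b).le).trans_lt ht)

include hb in
theorem kleinMeasure_planeImage_column_le {r t : ℝ} (hr : speedBound a b * |t| < r) (k : ℤ)
    {B : Set (ℝ × ℝ)} (hB : B ⊆ innerColumn r k) :
    kleinMeasure hP b (planeImage (kleinField h a b) t B) ≤ kleinMeasure hP b B := by
  set c := columnData hP a hb (kleinSign k) (kleinSign_eq k) with hc
  have hr0 : 0 < r := (mul_nonneg (speedBound_pos a b).le (abs_nonneg t)).trans_lt hr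
  have hW : ∀ p ∈ openColumn k, ENNReal.ofReal (kleinWeight hP b p) =
      1 * ENNReal.ofReal (c.τ p.2) := fun p hp => by
    rw [one_mul, kleinWeight, floor_of_mem_openColumn hp, hc, columnData]
  have hmW := (isOpen_openColumn k).measurableSet
  have hstay : ∀ γ, IsFilippovSolution (kleinField h a b) γ → γ 0 ∈ B →
      ∀ s ∈ uIcc 0 t, γ s ∈ openColumn k := fun γ hγ h0 s hs =>
    mem_openColumn_of_dist_lt (hB h0) (dist_solution_lt hP a hγ hr hs)
  have h1 : planeImage (kleinField h a b) t B ⊆ openColumn k := by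
    rintro q ⟨γ, hγ, h0, rfl⟩
    exact hstay γ hγ h0 t right_mem_uIcc
  have h2 : B ⊆ openColumn k := fun p hp =>
    mem_openColumn_of_dist_lt (hB hp) (by rwa [dist_self])
  rw [kleinMeasure, withDensity_eq_mul_of_eqOn ENNReal.one_ne_top hmW hW h1,
    withDensity_eq_mul_of_eqOn ENNReal.one_ne_top hmW hW h2, one_mul, one_mul]
  refine c.withDensity_snd_le_of_translate (kleinSign k * (t - 0), 0) ?_
  rintro q ⟨γ, hγ, h0, rfl⟩
  exact ⟨γ 0, h0, column_conj hP a hb (kleinSign_eq k) (isOpen_openColumn k)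
    (kleinField_openColumn hP a b k) (hγ.on 0 t) (hstay γ hγ h0)⟩

include hsym hb in
-- For the given short time solutions stay in the strip and are translations in its horizontal
-- chart. The symmetry of the slopes makes the weight 1/b a constant multiple of the invariant
-- density of that chart.
theorem kleinMeasure_planeImage_strip_le (hκ : ∀ i, a i / b i = a i.rev / b i.rev) {r t : ℝ}
    (hr : speedBound a b * |t| < r) {i : Fin n} (hi0 : a i ≠ 0) (l : ℤ)
    {B : Set (ℝ × ℝ)} (hB : B ⊆ innerStrip h r i l) :
    kleinMeasure hP b (planeImage (kleinField h a b) t B) ≤ kleinMeasure hP b B := by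
  obtain ⟨θ, hθ, hi, hi'⟩ := exists_direction a hb hκ hi0
  set c := stripData a b i hi hi' with hc
  have hr0 : 0 < r := (mul_nonneg (speedBound_pos a b).le (abs_nonneg t)).trans_lt hr
  have hmW : MeasurableSet (Prod.snd ⁻¹' strip h i l : Set (ℝ × ℝ)) :=
    measurable_snd (isOpen_strip h i l).measurableSet
  -- The identity is 1/b = θ(a/b) · 1/(θa), where a/b takes the same value in even and odd columns.
  have hW : ∀ p ∈ (Prod.snd ⁻¹' strip h i l : Set (ℝ × ℝ)), ENNReal.ofReal (kleinWeight hP b p) =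
      ENNReal.ofReal (θ * (a i / b i)) * ENNReal.ofReal (c.τ p.1) := fun p hp => by
    have h1 : hP.index (kleinSign ⌊p.1⌋ * p.2) = flipIndex i ⌊p.1⌋ := by
      unfold kleinSign flipIndex
      split_ifs
      · rw [one_mul]; exact hP.index_eq_of_mem_strip hp
      · rw [neg_one_mul]
        exact hP.index_eq_of_mem_strip (IsStripPartition.neg_mem_strip hsym hp)
    have h2 : a i / b i = a (flipIndex i ⌊p.1⌋) / b (flipIndex i ⌊p.1⌋) := by
      unfold flipIndex; split_ifs
      · rfl
      · exact hκ i
    have h3 := mul_flipIndex_pos hi hi' ⌊p.1⌋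
    rw [← ENNReal.ofReal_mul (by rw [← mul_div_assoc]; exact (div_pos hi (hb i)).le), kleinWeight,
      h1, h2, hc, stripData]
    congr 1
    have h4 := (hb (flipIndex i ⌊p.1⌋)).ne'
    have h5 : a (flipIndex i ⌊p.1⌋) ≠ 0 := right_ne_zero_of_mul h3.ne'
    have h6 : θ ≠ 0 := left_ne_zero_of_mul h3.ne'
    field_simp
  have hstay : ∀ γ, IsFilippovSolution (kleinField h a b) γ → γ 0 ∈ B →
      ∀ s ∈ uIcc 0 t, (γ s).2 ∈ strip h i l := fun γ hγ h0 s hs =>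
    mem_strip_of_dist_lt (hB h0) (dist_solution_lt hP a hγ hr hs)
  have h1 : planeImage (kleinField h a b) t B ⊆ Prod.snd ⁻¹' strip h i l := by
    rintro q ⟨γ, hγ, h0, rfl⟩
    exact hstay γ hγ h0 t right_mem_uIcc
  have h2 : B ⊆ Prod.snd ⁻¹' strip h i l := fun p hp =>
    mem_strip_of_dist_lt (hB hp) (by rwa [dist_self])
  rw [kleinMeasure, withDensity_eq_mul_of_eqOn ENNReal.ofReal_ne_top hmW hW h1,
    withDensity_eq_mul_of_eqOn ENNReal.ofReal_ne_top hmW hW h2]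
  refine mul_le_mul_right (c.meas_le_of_translate (θ * (t - 0), 0) ?_) _
  rintro q ⟨γ, hγ, h0, rfl⟩
  exact ⟨γ 0, h0, strip_conj hP hsym hi hi' (hγ.on 0 t) (hstay γ hγ h0) hθ⟩

/-! ### Regular points and the measure estimate for all times. -/

/-- The points at which the first integral is at distance at least `s` from the exceptional
values. -/
def regularSet (s : ℝ) : Set (ℝ × ℝ) :=
  {p | ∀ c ∈ badValues hP a hb, s ≤ |firstIntegral hP a hb p - c|}

include hsym in
theorem mem_regularSet (hκ : ∀ i, a i / b i = a i.rev / b i.rev) {s t₀ t : ℝ} {γ : ℝ → ℝ × ℝ}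
    (hγ : IsFilippovSolutionOn (kleinField h a b) γ t₀ t) (h0 : γ t₀ ∈ regularSet hP a hb s) :
    γ t ∈ regularSet hP a hb s := by
  intro c hc
  rw [firstIntegral_eq hP hsym a hb hκ hγ]
  exact h0 c hc

/-- The pieces into which the regular points are divided. -/
def piece (h : Fin (n + 1) → ℝ) (r : ℝ) : ℤ ⊕ (Fin n × ℤ) → Set (ℝ × ℝ)
  | Sum.inl k => innerColumn r k
  | Sum.inr il => {p | ∀ k, p ∉ innerColumn r k} ∩ Prod.snd ⁻¹' strip h il.1 il.2

include hP in
theorem pairwise_disjoint_piece {r : ℝ} (hr : 0 < r) :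
    Pairwise (Function.onFun Disjoint (piece h r)) := by
  rintro (k | ⟨i, l⟩) (k' | ⟨i', l'⟩) hne <;> refine disjoint_left.2 fun p hp hp' => ?_
  · have h1 := floor_of_mem_openColumn (mem_openColumn_of_dist_lt hp (by rwa [dist_self]))
    have h2 := floor_of_mem_openColumn (mem_openColumn_of_dist_lt hp' (by rwa [dist_self]))
    exact hne (by rw [← h1, ← h2])
  · exact hp'.1 k hp
  · exact hp.1 k' hp'
  · have h1 := hP.index_eq_of_mem_strip hp.2
    have h2 := hP.index_eq_of_mem_strip hp'.2
    obtain rfl : i = i' := h1.symm.trans h2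
    have h3 : p.2 ∈ strip h i l := hp.2
    have h4 : p.2 ∈ strip h i l' := hp'.2
    have h5 := hP.le_one i.succ
    have h6 := hP.nonneg i.castSucc
    have h7 : (l : ℝ) < l' + 1 := by linarith [h3.1, h4.2]
    have h8 : (l' : ℝ) < l + 1 := by linarith [h4.1, h3.2]
    have h9 : l < l' + 1 := by exact_mod_cast h7
    have h10 : l' < l + 1 := by exact_mod_cast h8
    exact hne (by rw [show l = l' by omega])

theorem measurableSet_innerColumn (r : ℝ) (k : ℤ) : MeasurableSet (innerColumn r k) :=
  (measurableSet_le measurable_const measurable_fst).inter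
    (measurableSet_le measurable_fst measurable_const)

theorem measurableSet_piece (r : ℝ) (j : ℤ ⊕ (Fin n × ℤ)) : MeasurableSet (piece h r j) := by
  rcases j with k | il
  · exact measurableSet_innerColumn r k
  · refine MeasurableSet.inter ?_ (measurable_snd (isOpen_strip h il.1 il.2).measurableSet)
    rw [show {p : ℝ × ℝ | ∀ k, p ∉ innerColumn r k} = ⋂ k, (innerColumn r k)ᶜ by ext; simp]
    exact MeasurableSet.iInter fun k => (measurableSet_innerColumn r k).compl

include hsym in
-- Regular points split into countably many disjoint pieces, each lying well inside one column or
-- one strip, where the respective chart estimate applies.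
theorem kleinMeasure_planeImage_short_le (hκ : ∀ i, a i / b i = a i.rev / b i.rev) {K : NNReal}
    (hK : LipschitzWith K (firstIntegral hP a hb)) {r t : ℝ} (hr : speedBound a b * |t| < r)
    {B : Set (ℝ × ℝ)} (hB : B ⊆ regularSet hP a hb ((K + 1) * r)) :
    kleinMeasure hP b (planeImage (kleinField h a b) t B) ≤ kleinMeasure hP b B := by
  have hr0 : 0 < r := (mul_nonneg (speedBound_pos a b).le (abs_nonneg t)).trans_lt hr
  refine measure_le_of_partition (R := piece h r) (measurableSet_piece r)
    (pairwise_disjoint_piece hP hr0) (T := planeImage (kleinField h a b) t) ?_ ?_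
  · rintro q ⟨γ, hγ, h0, rfl⟩
    by_cases hcol : ∀ k, γ 0 ∉ innerColumn r k
    · obtain ⟨l, -, hl, -⟩ := mem_inner_of_firstIntegral hP a hb hK hr0 (hB h0) hcol
      exact mem_iUnion.2 ⟨Sum.inr (_, l), γ, hγ, ⟨h0, hcol, hl⟩, rfl⟩
    · push Not at hcol
      obtain ⟨k, hk⟩ := hcol
      exact mem_iUnion.2 ⟨Sum.inl k, γ, hγ, ⟨h0, hk⟩, rfl⟩
  · rintro (k | ⟨i, l⟩)
    · exact kleinMeasure_planeImage_column_le hP a hb hr k inter_subset_right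
    -- A point of the piece is needed to know that a i ≠ 0, so the empty piece is treated
    -- separately.
    · rcases (B ∩ piece h r (Sum.inr (i, l))).eq_empty_or_nonempty with he | ⟨p, hp⟩
      · rw [he]
        refine (measure_mono_null ?_ measure_empty).le.trans zero_le
        rintro q ⟨γ, -, h0, -⟩
        exact h0
      · have key : ∀ q ∈ B ∩ piece h r (Sum.inr (i, l)), a i ≠ 0 ∧ q ∈ innerStrip h r i l := by
          rintro q ⟨hqB, hqcol, hqs⟩
          obtain ⟨l', ha, hl', hin⟩ := mem_inner_of_firstIntegral hP a hb hK hr0 (hB hqB) hqcol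
          have h1 : hP.index q.2 = i := hP.index_eq_of_mem_strip hqs
          rw [h1] at ha hl' hin
          obtain rfl : l' = l := by
            by_contra hne
            exact disjoint_left.1 (pairwise_disjoint_piece hP hr0
              (show (Sum.inr (i, l') : ℤ ⊕ (Fin n × ℤ)) ≠ Sum.inr (i, l) by simpa using hne))
              ⟨hqcol, hl'⟩ ⟨hqcol, hqs⟩
          exact ⟨ha, hin⟩
        exact kleinMeasure_planeImage_strip_le hP hsym a hb hκ hr (key p hp).1 l
          fun q hq => (key q hq).2

include hsym in
-- The regular set is invariant because the first integral is constant along solutions. The same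
-- radius r thus serves all N steps of length t / N.
theorem kleinMeasure_planeImage_regular_le (hκ : ∀ i, a i / b i = a i.rev / b i.rev) {K : NNReal}
    (hK : LipschitzWith K (firstIntegral hP a hb)) {r : ℝ} (hr : 0 < r) (t : ℝ)
    {B : Set (ℝ × ℝ)} (hB : B ⊆ regularSet hP a hb ((K + 1) * r)) :
    kleinMeasure hP b (planeImage (kleinField h a b) t B) ≤ kleinMeasure hP b B := by
  have hreg : ∀ s, planeImage (kleinField h a b) s B ⊆ regularSet hP a hb ((K + 1) * r) := by
    rintro s q ⟨γ, hγ, h0, rfl⟩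
    exact mem_regularSet hP hsym a hb hκ (hγ.on 0 s) (hB h0)
  obtain ⟨N, hN⟩ := exists_nat_gt (speedBound a b * |t| / r)
  have hN0 : (0 : ℝ) < N :=
    (div_nonneg (mul_nonneg (speedBound_pos a b).le (abs_nonneg t)) hr.le).trans_lt hN
  set δ := t / N with hδ
  have hδr : speedBound a b * |δ| < r := by
    rw [hδ, abs_div, abs_of_pos hN0, ← mul_div_assoc, div_lt_iff₀ hN0, mul_comm r]
    rwa [div_lt_iff₀ hr] at hN
  have key : ∀ k : ℕ, kleinMeasure hP b (planeImage (kleinField h a b) (k * δ) B) ≤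
      kleinMeasure hP b B := by
    intro k
    induction k with
    | zero =>
      refine measure_mono ?_
      rintro q ⟨γ, -, h0, rfl⟩
      simpa using h0
    | succ k ih =>
      refine le_trans (measure_mono ?_) ((kleinMeasure_planeImage_short_le hP hsym a hb hκ hK hδr
        (hreg (k * δ))).trans ih)
      rintro q ⟨γ, hγ, h0, rfl⟩
      refine ⟨fun s => γ (s + k * δ), (fieldBound_klein hP a b).shift hγ _, ⟨γ, hγ, h0, by simp⟩, ?_⟩
      simp only
      congr 1
      push_cast
      ring
  have := key N
  rwa [hδ, mul_div_cancel₀ t hN0.ne'] at this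

theorem exists_mem_regularSet {K : NNReal} {p : ℝ × ℝ}
    (hp : firstIntegral hP a hb p ∉ badValues hP a hb) :
    ∃ m : ℕ, p ∈ regularSet hP a hb ((K + 1) * (1 / ((m : ℝ) + 1))) := by
  obtain ⟨ε, hε, hball⟩ := Metric.isOpen_iff.1 (isClosed_badValues hP a hb).isOpen_compl _ hp
  obtain ⟨m, hm⟩ := exists_nat_one_div_lt (div_pos hε (by positivity : (0 : ℝ) < K + 1))
  refine ⟨m, fun c hc => ?_⟩
  rw [lt_div_iff₀ (by positivity)] at hm
  by_contra hlt
  refine hball (a := c) ?_ hc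
  rw [Metric.mem_ball, dist_comm, Real.dist_eq]
  linarith [not_le.1 hlt]

include hsym hb in
-- Endpoints with exceptional value form a null set. All others come from starting points in the
-- increasing sets G m, and outer measure is continuous along increasing unions.
theorem kleinMeasure_planeImage_le (hκ : ∀ i, a i / b i = a i.rev / b i.rev) (t : ℝ)
    (E : Set (ℝ × ℝ)) :
    kleinMeasure hP b (planeImage (kleinField h a b) t E) ≤ kleinMeasure hP b E := by
  obtain ⟨K, hK⟩ := exists_lipschitz_firstIntegral hP a hb
  set G : ℕ → Set (ℝ × ℝ) := fun m => regularSet hP a hb ((K + 1) * (1 / ((m : ℝ) + 1)))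
  have hG : Monotone G := by
    intro m m' hmm p hp c hc
    refine le_trans ?_ (hp c hc)
    gcongr
  have hnull : kleinMeasure hP b (firstIntegral hP a hb ⁻¹' badValues hP a hb) = 0 :=
    withDensity_absolutelyContinuous _ _ (volume_preimage_badValues hP a hb)
  have hsub : planeImage (kleinField h a b) t E ⊆
      firstIntegral hP a hb ⁻¹' badValues hP a hb ∪
        ⋃ m, planeImage (kleinField h a b) t (E ∩ G m) := by
    rintro q ⟨γ, hγ, h0, rfl⟩
    by_cases hbad : firstIntegral hP a hb (γ t) ∈ badValues hP a hb
    · exact Or.inl hbad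
    · rw [firstIntegral_eq hP hsym a hb hκ (hγ.on 0 t)] at hbad
      obtain ⟨m, hm⟩ := exists_mem_regularSet hP a hb (K := K) hbad
      exact Or.inr (mem_iUnion.2 ⟨m, γ, hγ, ⟨h0, hm⟩, rfl⟩)
  have hmono : Monotone fun m => planeImage (kleinField h a b) t (E ∩ G m) := fun m m' hmm =>
    planeImage_mono (inter_subset_inter_right _ (hG hmm))
  calc kleinMeasure hP b (planeImage (kleinField h a b) t E)
      ≤ 0 + ⨆ m, kleinMeasure hP b (planeImage (kleinField h a b) t (E ∩ G m)) := by
        rw [← hnull, ← hmono.measure_iUnion]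
        exact (measure_mono hsub).trans (measure_union_le _ _)
    _ ≤ kleinMeasure hP b E := by
        rw [zero_add]
        refine iSup_le fun m => ?_
        exact (kleinMeasure_planeImage_regular_le hP hsym a hb hκ hK (by positivity) t
          inter_subset_right).trans (measure_mono inter_subset_left)

/-! ### Existence of solutions through almost every point. -/

include hb hsym in
/-- Local existence of solutions through regular points. -/
theorem exists_local_solution (hκ : ∀ i, a i / b i = a i.rev / b i.rev) {K : NNReal}
    (hK : LipschitzWith K (firstIntegral hP a hb)) {r δ : ℝ} (hδ : 0 < δ)
    (hr : speedBound a b * δ < r) {p : ℝ × ℝ} (hp : p ∈ regularSet hP a hb ((K + 1) * r)) :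
    ∃ γ : ℝ → ℝ × ℝ, γ 0 = p ∧ IsFilippovSolutionOn (kleinField h a b) γ (-δ) δ := by
  have hr0 : 0 < r := (mul_nonneg (speedBound_pos a b).le hδ.le).trans_lt hr
  -- The explicit curve of a chart solves the inclusion only while it remains in the region of that
  -- chart; the speed bound keeps it there up to time δ.
  have hdist : ∀ {γ : ℝ → ℝ × ℝ} {L : NNReal}, γ 0 = p → LipschitzWith L γ →
      (∀ᵐ t, ∃ v : ℝ × ℝ, (|v.1| ≤ speedBound a b ∧ |v.2| ≤ speedBound a b) ∧ HasDerivAt γ v t) →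
      ∀ t ∈ uIcc (-δ) δ, dist (γ t) p < r := by
    intro γ L h0 hL hae t ht
    have h1 := dist_le_of_ae_hasDerivAt (s := t) (t := 0)
      hL.lipschitzOnWith.absolutelyContinuousOnInterval (hae.mono fun _ hr _ => hr)
    rw [h0, Real.dist_eq, sub_zero] at h1
    rw [uIcc_of_le (by linarith)] at ht
    exact (h1.trans (mul_le_mul_of_nonneg_left (abs_le.2 ht) (speedBound_pos a b).le)).trans_lt hr
  by_cases hcol : ∀ k, p ∉ innerColumn r k
  · obtain ⟨l, ha, -, hin⟩ := mem_inner_of_firstIntegral hP a hb hK hr0 hp hcol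
    obtain ⟨θ, hθ, hi, hi'⟩ := exists_direction a hb hκ ha
    obtain ⟨γ, L, h0, hL, hae⟩ := exists_strip_curve hi hi' hθ b p
    refine ⟨γ, h0, hL.lipschitzOnWith.absolutelyContinuousOnInterval, ?_⟩
    have hd := hdist h0 hL (by
      filter_upwards [hae] with t ⟨_, hd⟩
      refine ⟨_, ?_, hd⟩
      have h1 := Finset.single_le_sum (f := fun i => |a i| + |b i|) (fun i _ => by positivity)
        (Finset.mem_univ (flipIndex (hP.index p.2) ⌊(γ t).1⌋))
      have h2 := abs_nonneg (a (flipIndex (hP.index p.2) ⌊(γ t).1⌋))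
      have h3 := abs_nonneg (b (flipIndex (hP.index p.2) ⌊(γ t).1⌋))
      have h4 : |kleinSign ⌊(γ t).1⌋| = 1 := by rcases kleinSign_eq ⌊(γ t).1⌋ with h | h <;> simp [h]
      simp only [speedBound, abs_mul, h4, one_mul] at h1 ⊢
      constructor <;> linarith)
    filter_upwards [hae] with t ⟨hx, hd'⟩ ht
    have hs := mem_strip_of_dist_lt hin (hd t ht)
    rw [filippovSet_strip hP hsym hs hx]
    exact ⟨_, rfl, hd'⟩
  · push Not at hcol
    obtain ⟨k, hk⟩ := hcol
    obtain ⟨γ, L, h0, hL, hae⟩ := exists_column_curve hP a hb (kleinSign_eq k) p one_ne_zero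
    refine ⟨γ, h0, hL.lipschitzOnWith.absolutelyContinuousOnInterval, ?_⟩
    have hd := hdist h0 hL (by
      filter_upwards [hae] with t ⟨_, hd⟩
      rw [one_smul] at hd
      exact ⟨_, abs_columnField_le hP a b (kleinSign_eq k) _, hd⟩)
    filter_upwards [hae] with t ⟨hy, hd'⟩ ht
    have hs := mem_openColumn_of_dist_lt hk (hd t ht)
    rw [filippovSet_column hP a (isOpen_openColumn k) (kleinField_openColumn hP a b k) hs hy]
    exact ⟨_, rfl, by simpa using hd'⟩

include hP hb hsym in
theorem ae_exists_solution (hκ : ∀ i, a i / b i = a i.rev / b i.rev) (t : ℝ) :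
    ∀ᵐ q, ∃ γ, IsFilippovSolution (kleinField h a b) γ ∧ γ t = q := by
  obtain ⟨K, hK⟩ := exists_lipschitz_firstIntegral hP a hb
  have h1 : ∀ᵐ q : ℝ × ℝ, firstIntegral hP a hb q ∉ badValues hP a hb :=
    measure_eq_zero_iff_ae_notMem.1 (volume_preimage_badValues hP a hb)
  filter_upwards [h1] with q hq
  obtain ⟨m, hm⟩ := exists_mem_regularSet hP a hb (K := K) hq
  have hV := speedBound_pos a b
  set r : ℝ := 1 / ((m : ℝ) + 1) with hr
  have hr0 : 0 < r := by positivity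
  -- Half the time needed to cover the distance r at maximal speed, so that the inequality below is
  -- strict.
  set δ : ℝ := r / (2 * speedBound a b) with hδdef
  have hδ : 0 < δ := by positivity
  have hδr : speedBound a b * δ < r := by
    rw [hδdef]
    field_simp
    norm_num
  obtain ⟨γ, hγ, h0⟩ := (fieldBound_klein hP a b).exists_solution hδ
    (G := regularSet hP a hb ((K + 1) * r)) (fun p hp => by
      obtain ⟨γ, h0, hγ⟩ := exists_local_solution hP hsym a hb hκ hK hδ hδr hp
      rw [← h0] at hp
      have h0m : (0 : ℝ) ∈ uIcc (-δ) δ := by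
        rw [mem_uIcc]; left; constructor <;> linarith
      exact ⟨γ, h0, hγ,
        mem_regularSet hP hsym a hb hκ (hγ.mono (uIcc_subset_uIcc h0m right_mem_uIcc)) hp,
        mem_regularSet hP hsym a hb hκ (hγ.mono (uIcc_subset_uIcc h0m left_mem_uIcc)) hp⟩) hm
  exact ⟨_, (fieldBound_klein hP a b).shift hγ (-t), by simp [h0]⟩

include hP hsym in
/-- Invariance on the Klein bottle. -/
theorem preservesDensity_klein (hb : ∀ i, 0 < b i) {α : Fin n → ℝ} {c : ℝ}
    (hc : ∀ i, α i = c / b i) (hκ : ∀ i, a i / b i = a i.rev / b i.rev) :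
    PreservesDensity kleinSetoid (kleinField h a b) (stripDensity h α) := by
  have hn : Nonempty (Fin n) := ⟨hP.index 0⟩
  obtain ⟨j, hj⟩ := Finite.exists_min b
  refine (deckSystem_klein hP a b).preservesDensity (ρ := kleinWeight hP b) (M := (b j)⁻¹) (c := c)
    (measurable_kleinWeight hP) (fun p => inv_pos.2 (hb _)) (fun p => inv_anti₀ (hb j) (hj _))
    ?_ ?_ (kleinMeasure_planeImage_le hP hsym a hb hκ) (ae_exists_solution hP hsym a hb hκ)
  · intro m k p
    -- The weight is the inverse of the absolute vertical component of the field, so its deck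
    -- invariance follows from the equivariance of the field.
    have h1 : ∀ q, kleinWeight hP b q = |(kleinField h a b q).2|⁻¹ := by
      intro q
      have : |kleinSign ⌊q.1⌋| = 1 := by rcases kleinSign_eq ⌊q.1⌋ with h | h <;> simp [h]
      rw [kleinField_eq hP, columnField, kleinWeight, abs_mul, this, one_mul, abs_of_pos (hb _)]
    have : |kleinSign m| = 1 := by rcases kleinSign_eq m with h | h <;> simp [h]
    rw [h1, h1, (deckSystem_klein hP a b).equivariant, abs_mul, this, one_mul]
  · intro p hp
    have hf : Int.fract p.2 = p.2 := Int.fract_eq_self.2 hp.2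
    have hfl : ⌊p.1⌋ = 0 := Int.floor_eq_iff.2 (by simpa using hp.1)
    rw [stripDensity, ← hf, hP.stripValue_fract, hc, kleinWeight, hfl]
    simp [kleinSign, div_eq_mul_inv]

end Klein

/-! ### Fluxes through the discontinuity lines -/

/-- If x ≠ 0 then s t = 1, which forces both factors in [0,1] to be 1. In this way one-sided flux
comparisons become equalities. -/
theorem eq_of_eq_mul_of_eq_mul {x y s t : ℝ} (hs : s ∈ Icc (0 : ℝ) 1) (ht : t ∈ Icc (0 : ℝ) 1)
    (hx : x = s * y) (hy : y = t * x) : x = y := by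
  rcases eq_or_ne x 0 with h0 | h0
  · rw [hy, h0, mul_zero]
  · have h1 : s * t = 1 := by
      have : (s * t - 1) * x = 0 := by linear_combination (-1 : ℝ) * hx - s * hy
      rcases mul_eq_zero.1 this with h | h
      · linarith
      · exact absurd h h0
    have h2 : s = 1 := le_antisymm hs.2 (by nlinarith [hs.1, ht.2, hs.2])
    rw [hx, h2, one_mul]

namespace ShearData

theorem clock_sub_of_const (c : ShearData) {x y k : ℝ} (hxy : x ≤ y)
    (hk : ∀ z ∈ Ioo x y, c.τ z = k) : c.clock y - c.clock x = k * (y - x) := by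
  rw [c.clock_sub, intervalIntegral.integral_of_le hxy, integral_Ioc_eq_integral_Ioo,
    setIntegral_congr_fun measurableSet_Ioo (g := fun _ => k) hk]
  simp [measureReal_def, hxy, mul_comm]

end ShearData

/-- If `U` moves into `R` without an increase of a measure whose density is `k` on `U` and `k'` on
`R`, then the densities of a preserved measure are related accordingly. -/
theorem DeckSystem.exists_flux_ratio {r : Setoid (ℝ × ℝ)} {ε : ℤ → ℝ} {Z : ℝ × ℝ → ℝ × ℝ}
    (hS : DeckSystem r ε Z) {f : ℝ × ℝ → ℝ} (hP : PreservesDensity r Z f) {U R : Set (ℝ × ℝ)}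
    (hU : IsOpen U) (hUn : U.Nonempty) (hUS : U ⊆ unitSquare) (hR : MeasurableSet R) {m j : ℤ}
    (hRS : ∀ p ∈ R, deck ε m j p ∈ unitSquare) {t α α' : ℝ} (hUR : planeImage Z t U ⊆ R)
    (hf : ∀ p ∈ U, f p = α) (hf' : ∀ p ∈ R, f (deck ε m j p) = α') {g : ℝ × ℝ → ℝ} {k k' : ℝ}
    (hk : 0 < k) (hk' : 0 < k') (hg : ∀ p ∈ U, g p = k) (hg' : ∀ p ∈ R, g p = k')
    (hle : (volume.withDensity fun p => ENNReal.ofReal (g p)) (planeImage Z t U) ≤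
      (volume.withDensity fun p => ENNReal.ofReal (g p)) U) :
    ∃ s ∈ Icc (0 : ℝ) 1, α / k = s * (α' / k') := by
  have h1 := hS.mul_volume_eq hP hU hUS hR hRS hUR hf hf'
  have hfin : volume U ≠ ⊤ := by
    refine measure_ne_top_of_subset hUS ?_
    rw [unitSquare, Measure.volume_eq_prod, Measure.prod_prod]
    simp
  rw [withDensity_eq_mul_of_eqOn (g := 1) (k := ENNReal.ofReal k') ENNReal.ofReal_ne_top hR
    (fun p hp => by rw [hg' p hp]; simp) hUR,
    withDensity_eq_mul_of_eqOn (g := 1) (k := ENNReal.ofReal k) ENNReal.ofReal_ne_top hU.measurableSet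
    (fun p hp => by rw [hg p hp]; simp) Subset.rfl, withDensity_one] at hle
  have h2 : k' * (volume (planeImage Z t U)).toReal ≤ k * (volume U).toReal := by
    have := ENNReal.toReal_mono (ENNReal.mul_ne_top ENNReal.ofReal_ne_top hfin) hle
    rwa [ENNReal.toReal_mul, ENNReal.toReal_mul, ENNReal.toReal_ofReal hk.le,
      ENNReal.toReal_ofReal hk'.le] at this
  have hpos : 0 < (volume U).toReal := ENNReal.toReal_pos (hU.measure_pos volume hUn).ne' hfin
  set u := (volume U).toReal
  set w := (volume (planeImage Z t U)).toReal with hw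
  have hw0 : 0 ≤ w := ENNReal.toReal_nonneg
  -- The factor is the ratio of the reference measures of the image and of U, at most 1 by `h2`; the
  -- relation is then α u = α' w.
  refine ⟨k' * w / (k * u), ⟨by positivity, ?_⟩, ?_⟩
  · rw [div_le_one (by positivity)]; exact h2
  · field_simp
    linarith

section Horizontal

variable {n : ℕ} {h : Fin (n + 1) → ℝ} (hP : IsStripPartition h) {a b : Fin n → ℝ}
  (hb : ∀ i, 0 < b i)

theorem le_speedBound (a b : Fin n → ℝ) (i : Fin n) :
    |a i| ≤ speedBound a b ∧ b i ≤ speedBound a b := by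
  have h1 := Finset.single_le_sum (f := fun i => |a i| + |b i|) (fun i _ => by positivity)
    (Finset.mem_univ i)
  have h2 := abs_nonneg (a i)
  have h3 := abs_nonneg (b i)
  have h4 := le_abs_self (b i)
  simp only [speedBound] at h1 ⊢
  constructor <;> linarith

include hP in
theorem stripDensity_eq {α : Fin n → ℝ} {i : Fin n} {p : ℝ × ℝ} (hp : p.2 ∈ strip h i 0) :
    stripDensity h α p = α i :=
  stripValue_eq hP.mono α ⟨by simpa using hp.1.le, by simpa using hp.2⟩

include hb in
/-- The flux through a horizontal discontinuity line. -/
theorem exists_flux_ratio_horizontal {r : Setoid (ℝ × ℝ)} {ε : ℤ → ℝ} {Z : ℝ × ℝ → ℝ × ℝ}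
    (hS : DeckSystem r ε Z) (hV : FieldBound Z (speedBound a b))
    (hZ : ∀ p ∈ openColumn 0, Z p = columnField hP a b 1 p) {α : Fin n → ℝ}
    (hpres : PreservesDensity r Z (stripDensity h α)) {i j : Fin n} {l : ℤ}
    (hij : h i.succ = h j.castSucc + l) :
    ∃ s ∈ Icc (0 : ℝ) 1, α i * b i = s * (α j * b j) := by
  have hV0 := speedBound_pos a b
  have hgi : 0 < h i.succ - h i.castSucc := sub_pos.2 (hP.mono i.castSucc_lt_succ)
  have hgj : 0 < h j.succ - h j.castSucc := sub_pos.2 (hP.mono j.castSucc_lt_succ)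
  -- The bound 1/4 keeps the cell over (1/4, 3/4) inside the column; the strip heights keep it from
  -- starting below strip i or ending above strip j.
  obtain ⟨ρ, hρ, hρ4, hρi, hρj⟩ : ∃ ρ : ℝ, 0 < ρ ∧ ρ ≤ 1 / 4 ∧ ρ ≤ h i.succ - h i.castSucc ∧
      ρ ≤ h j.succ - h j.castSucc :=
    ⟨min (1 / 4) (min _ _), lt_min (by norm_num) (lt_min hgi hgj), min_le_left _ _,
      (min_le_right _ _).trans (min_le_left _ _), (min_le_right _ _).trans (min_le_right _ _)⟩
  set τ : ℝ := ρ / (2 * speedBound a b) with hτ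
  have hτ0 : 0 < τ := by positivity
  have hτρ : speedBound a b * |τ| < ρ := by
    rw [abs_of_pos hτ0, hτ]; field_simp; norm_num
  have hbτ : b i * τ < ρ := by
    rw [abs_of_pos hτ0] at hτρ
    exact (mul_le_mul_of_nonneg_right (le_speedBound a b i).2 hτ0.le).trans_lt hτρ
  have hbi := hb i
  have hbτ0 : 0 < b i * τ := mul_pos hbi hτ0
  -- The layer has thickness b i * τ, the height climbed in time τ, so all of it crosses the line.
  set U : Set (ℝ × ℝ) := Ioo (1 / 4 : ℝ) (3 / 4) ×ˢ Ioo (h i.succ - b i * τ) (h i.succ) with hU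
  set R : Set (ℝ × ℝ) := Ioo (0 : ℝ) 1 ×ˢ strip h j l with hR
  set c := columnData hP a hb 1 (Or.inl rfl) with hc
  have hUs : ∀ p ∈ U, p.2 ∈ strip h i 0 := fun p hp => by
    constructor
    · simp; linarith [hp.2.1]
    · simpa using hp.2.2
  have hτi : ∀ y ∈ strip h i 0, c.τ y = (b i)⁻¹ := fun y hy => by
    simp only [hc, columnData, one_mul, hP.index_eq_of_mem_strip hy]
  have hτj : ∀ y ∈ strip h j l, c.τ y = (b j)⁻¹ := fun y hy => by
    simp only [hc, columnData, one_mul, hP.index_eq_of_mem_strip hy]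
  have hstay : ∀ γ, IsFilippovSolution Z γ → γ 0 ∈ U → ∀ s ∈ uIcc 0 τ,
      dist (γ s) (γ 0) < ρ := fun γ hγ _ s hs =>
    (hV.dist_le (hγ.on s 0)).trans_lt
      ((mul_le_mul_of_nonneg_left (dist_zero_le_of_mem_uIcc hs) hV0.le).trans_lt hτρ)
  have hcol : ∀ γ, IsFilippovSolution Z γ → γ 0 ∈ U → ∀ s ∈ uIcc 0 τ, γ s ∈ openColumn 0 := by
    intro γ hγ h0 s hs
    have h1 : |(γ s).1 - (γ 0).1| < ρ := (le_max_left _ _).trans_lt (hstay γ hγ h0 s hs)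
    rw [abs_lt] at h1
    constructor <;> push_cast <;> linarith [h0.1.1, h0.1.2]
  have hconj : ∀ γ, IsFilippovSolution Z γ → γ 0 ∈ U →
      c.chart (γ τ).swap = c.chart (γ 0).swap + (1 * (τ - 0), 0) := fun γ hγ h0 =>
    column_conj hP a hb (Or.inl rfl) (isOpen_openColumn 0) hZ (hγ.on 0 τ) (hcol γ hγ h0)
  have hUR : planeImage Z τ U ⊆ R := by
    rintro q ⟨γ, hγ, h0, rfl⟩
    have h1 : |(γ τ).2 - (γ 0).2| < ρ :=
      (le_max_right _ _).trans_lt (hstay γ hγ h0 τ right_mem_uIcc)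
    rw [abs_lt] at h1
    have h2 := hcol γ hγ h0 τ right_mem_uIcc
    have h3 := congrArg Prod.fst (hconj γ hγ h0)
    simp only [ShearData.chart, Prod.swap, Prod.fst_add] at h3
    have h4 := c.clock_sub_of_const h0.2.2.le (k := (b i)⁻¹) fun z hz =>
      hτi z ⟨(hUs _ h0).1.trans hz.1, by simpa using hz.2⟩
    -- The crossing time of the remaining part of strip i is less than τ.
    have h5 : (b i)⁻¹ * (h i.succ - (γ 0).2) < τ := by
      rw [inv_mul_eq_div, div_lt_iff₀ hbi]; linarith [h0.2.1]
    have h6 : h i.succ < (γ τ).2 := c.strictMono_clock.lt_iff_lt.1 (by linarith)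
    refine ⟨by simpa [openColumn] using h2, by rw [← hij]; exact h6, ?_⟩
    linarith [h0.2.2]
  have hdeck : ∀ p ∈ R, deck ε 0 (-l) p = (p.1, p.2 - l) := fun p _ => by
    simp [deck, hS.sign_zero, sub_eq_add_neg]
  obtain ⟨s, hs, hs'⟩ := hS.exists_flux_ratio hpres (U := U) (R := R) (m := 0) (j := -l) (t := τ)
    (α := α i) (α' := α j) (g := fun p => c.τ p.2) (k := (b i)⁻¹) (k' := (b j)⁻¹)
    (isOpen_Ioo.prod isOpen_Ioo)
    ⟨(1 / 2, h i.succ - b i * τ / 2), ⟨by norm_num, by norm_num⟩, by simp only; linarith,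
      by simp only; linarith⟩
    (fun p hp => by
      have h1 := hP.nonneg i.castSucc
      have h2 := hP.le_one i.succ
      exact ⟨⟨by linarith [hp.1.1], by linarith [hp.1.2]⟩, by linarith [hp.2.1],
        by linarith [hp.2.2]⟩)
    (measurableSet_Ioo.prod measurableSet_Ioo)
    (fun p hp => by
      have h1 := hP.nonneg j.castSucc
      have h2 := hP.le_one j.succ
      rw [hdeck p hp]
      exact ⟨⟨hp.1.1.le, hp.1.2⟩, by simp only; linarith [hp.2.1], by simp only; linarith [hp.2.2]⟩)
    hUR (fun p hp => stripDensity_eq hP (hUs p hp))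
    (fun p hp => by
      rw [hdeck p hp]
      refine stripDensity_eq hP ⟨?_, ?_⟩ <;> simp only [Int.cast_zero, add_zero]
      · linarith [hp.2.1]
      · linarith [hp.2.2])
    (inv_pos.2 hbi) (inv_pos.2 (hb j)) (fun p hp => hτi _ (hUs p hp)) (fun p hp => hτj _ hp.2)
    (c.withDensity_snd_le_of_translate (1 * (τ - 0), 0) (by
      rintro q ⟨γ, hγ, h0, rfl⟩
      exact ⟨γ 0, h0, hconj γ hγ h0⟩))
  exact ⟨s, hs, by simpa [div_inv_eq_mul] using hs'⟩

/-- Following the cycle from 0 to i and from i back to 0 expresses each of x 0, x i as a multiple of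
the other with factor in [0,1]. -/
theorem eq_of_cyclic_ratio {N : ℕ} {x : Fin (N + 1) → ℝ}
    (hstep : ∀ i : Fin N, ∃ s ∈ Icc (0 : ℝ) 1, x i.castSucc = s * x i.succ)
    (hwrap : ∃ s ∈ Icc (0 : ℝ) 1, x (Fin.last N) = s * x 0) (i : Fin (N + 1)) : x i = x 0 := by
  have hmul : ∀ {s t : ℝ}, s ∈ Icc (0 : ℝ) 1 → t ∈ Icc (0 : ℝ) 1 → s * t ∈ Icc (0 : ℝ) 1 :=
    fun hs ht => ⟨mul_nonneg hs.1 ht.1, mul_le_one₀ hs.2 ht.1 ht.2⟩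
  have h1 : ∃ s ∈ Icc (0 : ℝ) 1, x 0 = s * x i := by
    induction i using Fin.induction with
    | zero => exact ⟨1, by simp, by simp⟩
    | succ i ih =>
      obtain ⟨s, hs, h⟩ := ih
      obtain ⟨t, ht, h'⟩ := hstep i
      exact ⟨s * t, hmul hs ht, by rw [h, h', mul_assoc]⟩
  have h2 : ∃ s ∈ Icc (0 : ℝ) 1, x i = s * x (Fin.last N) := by
    clear h1
    induction i using Fin.reverseInduction with
    | last => exact ⟨1, by simp, by simp⟩
    | cast i ih =>
      obtain ⟨s, hs, h⟩ := ih
      obtain ⟨t, ht, h'⟩ := hstep i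
      exact ⟨t * s, hmul ht hs, by rw [h', h, mul_assoc]⟩
  obtain ⟨s, hs, h⟩ := h1
  obtain ⟨t, ht, h'⟩ := h2
  obtain ⟨u, hu, h''⟩ := hwrap
  exact eq_of_eq_mul_of_eq_mul (hmul ht hu) hs (by rw [h', h'', mul_assoc]) h

/-- The density of a preserved measure is inversely proportional to the vertical speed. -/
theorem exists_density_eq {r : Setoid (ℝ × ℝ)} {ε : ℤ → ℝ} {Z : ℝ × ℝ → ℝ × ℝ}
    (hS : DeckSystem r ε Z) (hV : FieldBound Z (speedBound a b))
    (hZ : ∀ p ∈ openColumn 0, Z p = columnField hP a b 1 p) {α : Fin n → ℝ}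
    (hpres : PreservesDensity r Z (stripDensity h α)) (hb : ∀ i, 0 < b i) :
    ∃ c : ℝ, ∀ i, α i = c / b i := by
  obtain ⟨N, rfl⟩ : ∃ N, n = N + 1 :=
    Nat.exists_eq_add_one.2 (Fin.pos_iff_nonempty.2 ⟨hP.index 0⟩)
  refine ⟨α 0 * b 0, fun i => ?_⟩
  rw [eq_div_iff (hb i).ne']
  refine eq_of_cyclic_ratio (x := fun i => α i * b i) (fun i => ?_) ?_ i
  · exact exists_flux_ratio_horizontal hP hb hS hV hZ hpres (l := 0)
      (by rw [Int.cast_zero, add_zero]; rfl)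
  -- The line y = 1 leads into the lowest strip, one period higher: hence l = 1.
  · refine exists_flux_ratio_horizontal hP hb hS hV hZ hpres (l := 1) ?_
    rw [Fin.succ_last, hP.one, Fin.castSucc_zero, hP.zero]
    simp

end Horizontal

/-! ### Fluxes through the vertical walls -/

/-- A function that moves up with speed `p` below zero and does not move up above zero reaches zero
and stays there. -/
theorem AbsolutelyContinuousOnInterval.eq_zero_of_sticky {f : ℝ → ℝ} {τ p : ℝ}
    (hf : AbsolutelyContinuousOnInterval f 0 τ) (hτ : 0 ≤ τ) (hp : 0 < p) (h0 : f 0 < 0)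
    (h0' : -(p * τ) < f 0)
    (h : ∀ᵐ t, t ∈ uIcc 0 τ → ∀ d, HasDerivAt f d t → (f t < 0 → d = p) ∧ (0 < f t → d ≤ 0)) :
    f τ = 0 := by
  have hz := ae_hasDerivAt_eq_zero_of_mem_countable f (countable_singleton (0 : ℝ))
  refine le_antisymm ?_ (not_lt.1 fun hneg => ?_)
  -- The positive part of f starts at zero and never increases.
  · have hl : LipschitzWith 1 fun x : ℝ => max x 0 := LipschitzWith.id.max_const 0
    have h1 := (hl.comp_absolutelyContinuousOnInterval hf).sub_le_mul_of_ae_deriv_le hτ 0 (by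
      filter_upwards [h, hz, hf.ae_differentiableAt] with t ht hzt hd hmem e he
      have hdt := (hd hmem).hasDerivAt
      rcases lt_trichotomy (f t) 0 with hlt | heq | hgt
      · have : HasDerivAt (fun r => max (f r) 0) 0 t :=
          (hasDerivAt_const t (0 : ℝ)).congr_of_eventuallyEq
            ((hdt.continuousAt.eventually_lt continuousAt_const hlt).mono fun r hr =>
              max_eq_right hr.le)
        exact (he.unique this).le
      · rw [hzt heq _ hdt] at hdt
        exact (he.unique (hl.hasDerivAt_comp_zero hdt)).le
      · have := he.congr_of_eventuallyEq
          ((continuousAt_const.eventually_lt hdt.continuousAt hgt).mono fun r hr =>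
              (max_eq_left hr.le).symm)
        exact (ht hmem _ this).2 hgt)
    simp only [max_eq_right h0.le] at h1
    linarith [le_max_left (f τ) 0]
  -- The function min(f, 0) never decreases, so f τ < 0 would mean f < 0 throughout. Then f rises at
  -- speed p all the time and ends at f 0 + p τ > 0.
  · have hl : LipschitzWith 1 fun x : ℝ => min x 0 := LipschitzWith.id.min_const 0
    have hk : ∀ r ∈ Icc 0 τ, f r < 0 := fun r hr => by
      have hsub : uIcc r τ ⊆ uIcc 0 τ := by
        rw [uIcc_of_le hr.2, uIcc_of_le hτ]; exact Icc_subset_Icc_left hr.1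
      have h1 := ((hl.comp_absolutelyContinuousOnInterval hf).mono
          hsub).mul_le_sub_of_ae_le_deriv hr.2 0 (by
        filter_upwards [h, hz, hf.ae_differentiableAt] with t ht hzt hd hmem e he
        have hdt := (hd (hsub hmem)).hasDerivAt
        rcases lt_trichotomy (f t) 0 with hlt | heq | hgt
        · have := he.congr_of_eventuallyEq
            ((hdt.continuousAt.eventually_lt continuousAt_const hlt).mono fun r hr =>
                (min_eq_left hr.le).symm)
          exact ((ht (hsub hmem) _ this).1 hlt).symm ▸ hp.le
        · rw [hzt heq _ hdt] at hdt
          exact (he.unique (hl.hasDerivAt_comp_zero hdt)).ge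
        · have : HasDerivAt (fun r => min (f r) 0) 0 t :=
            (hasDerivAt_const t (0 : ℝ)).congr_of_eventuallyEq
              ((continuousAt_const.eventually_lt hdt.continuousAt hgt).mono fun r hr =>
                min_eq_right hr.le)
          exact (he.unique this).ge)
      simp only [min_eq_left hneg.le] at h1
      by_contra hge
      rw [min_eq_right (not_lt.1 hge)] at h1
      linarith
    have h2 := hf.sub_eq_of_ae_hasDerivAt p (by
      filter_upwards [h, hf.ae_differentiableAt] with t ht hd hmem
      have hdt := (hd hmem).hasDerivAt
      rwa [(ht hmem _ hdt).1 (hk t (by rwa [uIcc_of_le hτ] at hmem))] at hdt)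
    linarith

section Walls

variable {n : ℕ} {h : Fin (n + 1) → ℝ} (hP : IsStripPartition h)
  (hsym : ∀ i, h i.rev = 1 - h i) {a b : Fin n → ℝ}

/-- The signed distance from the left wall (`s = -1`) or the right wall (`s = 1`) of the unit
square. -/
noncomputable def wallDist (s x : ℝ) : ℝ := s * (x - (1 + s) / 2)

theorem floor_eq_of_wallDist_neg {s x : ℝ} (hs : s = 1 ∨ s = -1) (h1 : -1 < wallDist s x)
    (h2 : wallDist s x < 0) : ⌊x⌋ = 0 ∧ x ∉ range ((↑) : ℤ → ℝ) := by
  have hx : 0 < x ∧ x < 1 := by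
    rcases hs with rfl | rfl <;> simp only [wallDist] at h1 h2 <;> constructor <;> linarith
  have hf : ⌊x⌋ = 0 := Int.floor_eq_iff.2 ⟨by simpa using hx.1.le, by simpa using hx.2⟩
  refine ⟨hf, ?_⟩
  rintro ⟨k, rfl⟩
  rw [Int.floor_intCast] at hf
  simp [hf] at hx

theorem floor_eq_of_wallDist_pos {s x : ℝ} {m : ℤ} (hs : s = 1 ∨ s = -1) (hm : (m : ℝ) = s)
    (h1 : 0 < wallDist s x) (h2 : wallDist s x < 1) : ⌊x⌋ = m ∧ x ∉ range ((↑) : ℤ → ℝ) := by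
  have hx : m < x ∧ x < m + 1 := by
    rw [hm]
    rcases hs with rfl | rfl <;> simp only [wallDist] at h1 h2 <;> constructor <;> linarith
  have hf : ⌊x⌋ = m := Int.floor_eq_iff.2 ⟨hx.1.le, hx.2⟩
  refine ⟨hf, ?_⟩
  rintro ⟨k, rfl⟩
  rw [Int.floor_intCast] at hf
  simp [hf] at hx

theorem exists_odd_sign {s : ℝ} (hs : s = 1 ∨ s = -1) : ∃ m : ℤ, (m : ℝ) = s ∧ ¬ Even m := by
  rcases hs with rfl | rfl
  · exact ⟨1, by simp, by decide⟩
  · exact ⟨-1, by simp, by decide⟩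

include hP in
/-- A cell whose points would all cross the wall if they could. -/
theorem exists_wall_cell {s : ℝ} (hs : s = 1 ∨ s = -1) {i : Fin n} (hi : 0 < s * a i)
    (b : Fin n → ℝ) :
    ∃ (τ : ℝ) (U : Set (ℝ × ℝ)), 0 < τ ∧ s * a i * τ < 1 ∧ IsOpen U ∧ U.Nonempty ∧ U ⊆ unitSquare ∧
      (∀ p ∈ U, p.2 ∈ strip h i 0 ∧ -(s * a i * τ) < wallDist s p.1 ∧ wallDist s p.1 < 0) ∧
      ∀ γ, IsFilippovSolution (kleinField h a b) γ → γ 0 ∈ U → ∀ r ∈ uIcc 0 τ,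
        (γ r).2 ∈ strip h i 0 ∧ |wallDist s (γ r).1| < 1 := by
  have hV0 := speedBound_pos a b
  have hg : 0 < h i.succ - h i.castSucc := sub_pos.2 (hP.mono i.castSucc_lt_succ)
  -- A margin of at most a third of the strip height on either side leaves a nonempty middle part,
  -- whose points stay in the strip up to time τ.
  obtain ⟨ρ, hρ, hρ4, hρi⟩ : ∃ ρ : ℝ, 0 < ρ ∧ ρ ≤ 1 / 4 ∧ ρ ≤ (h i.succ - h i.castSucc) / 3 :=
    ⟨min (1 / 4) _, lt_min (by norm_num) (by positivity), min_le_left _ _, min_le_right _ _⟩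
  have hτ0 : 0 < ρ / (2 * speedBound a b) := by positivity
  have hτρ : speedBound a b * |ρ / (2 * speedBound a b)| < ρ := by
    rw [abs_of_pos hτ0]; field_simp; norm_num
  set τ : ℝ := ρ / (2 * speedBound a b)
  have hsa : s * a i ≤ speedBound a b := by
    refine le_trans ?_ (le_speedBound a b i).1
    rcases hs with rfl | rfl
    · rw [one_mul]; exact le_abs_self _
    · rw [neg_one_mul]; exact neg_le_abs _
  have haτ : s * a i * τ < ρ := by
    rw [abs_of_pos hτ0] at hτρ
    exact (mul_le_mul_of_nonneg_right hsa hτ0.le).trans_lt hτρ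
  have haτ0 : 0 < s * a i * τ := mul_pos hi hτ0
  have hcont : Continuous fun p : ℝ × ℝ => wallDist s p.1 := by unfold wallDist; fun_prop
  refine ⟨τ, {p | wallDist s p.1 ∈ Ioo (-(s * a i * τ)) 0 ∧
    p.2 ∈ Ioo (h i.castSucc + ρ) (h i.succ - ρ)}, hτ0, by linarith,
    (isOpen_Ioo.preimage hcont).inter (isOpen_Ioo.preimage continuous_snd), ?_, ?_, ?_, ?_⟩
  · refine ⟨((1 + s) / 2 - s * (s * a i * τ / 2), (h i.castSucc + h i.succ) / 2), ?_, ?_⟩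
    · have : wallDist s ((1 + s) / 2 - s * (s * a i * τ / 2)) = -(s * a i * τ) / 2 := by
        rcases hs with rfl | rfl <;> simp only [wallDist] <;> ring
      simp only [this]
      constructor <;> linarith
    · constructor <;> simp only <;> linarith
  · rintro p ⟨⟨h1, h2⟩, h3, h4⟩
    have h5 := hP.nonneg i.castSucc
    have h6 := hP.le_one i.succ
    refine ⟨?_, by linarith, by linarith⟩
    rcases hs with rfl | rfl <;> simp only [wallDist] at h1 h2 <;> constructor <;> linarith
  · rintro p ⟨⟨h1, h2⟩, h3, h4⟩
    exact ⟨⟨by rw [Int.cast_zero]; linarith, by rw [Int.cast_zero]; linarith⟩, h1, h2⟩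
  · rintro γ hγ ⟨⟨h1, h2⟩, h3, h4⟩ r hr
    have h5 := dist_solution_lt hP a hγ hτρ hr
    have h6 : |(γ r).1 - (γ 0).1| < ρ := (le_max_left _ _).trans_lt h5
    have h7 : |(γ r).2 - (γ 0).2| < ρ := (le_max_right _ _).trans_lt h5
    rw [abs_lt] at h6 h7
    refine ⟨⟨by rw [Int.cast_zero]; linarith, by rw [Int.cast_zero]; linarith⟩, ?_⟩
    rw [abs_lt]
    rcases hs with rfl | rfl <;> simp only [wallDist] at h1 h2 ⊢ <;> constructor <;> linarith

include hsym in
theorem one_sub_mem_strip {i : Fin n} {y : ℝ} (hy : y ∈ strip h i 0) :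
    -y + 1 ∈ strip h i.rev 0 := by
  have h1 := hsym i.castSucc
  have h2 := hsym i.succ
  rw [Fin.rev_castSucc] at h1
  rw [Fin.rev_succ] at h2
  have h3 := hy.1
  have h4 := hy.2
  rw [Int.cast_zero, add_zero] at h3 h4
  constructor <;> rw [Int.cast_zero, add_zero] <;> linarith

theorem mem_unitSquare_of_strip (hP : IsStripPartition h) {i : Fin n} {p : ℝ × ℝ} (h0 : 0 ≤ p.1)
    (h1 : p.1 < 1) (hp : p.2 ∈ strip h i 0) : p ∈ unitSquare := by
  have h3 := hp.1
  have h4 := hp.2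
  rw [Int.cast_zero, add_zero] at h3 h4
  exact ⟨⟨h0, h1⟩, (hP.nonneg _).trans h3.le, h4.trans_le (hP.le_one _)⟩

include hP hsym in
/-- The flux through a wall that is crossed. -/
theorem exists_flux_ratio_vertical {s : ℝ} (hs : s = 1 ∨ s = -1) {i : Fin n} (hi : 0 < s * a i)
    (hi' : 0 < s * a i.rev) {α : Fin n → ℝ}
    (hpres : PreservesDensity kleinSetoid (kleinField h a b) (stripDensity h α)) :
    ∃ θ ∈ Icc (0 : ℝ) 1, α i * (s * a i) = θ * (α i.rev * (s * a i.rev)) := by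
  obtain ⟨τ, U, hτ, hτ1, hUo, hUn, hUS, hU, hstay⟩ := exists_wall_cell hP hs hi b
  obtain ⟨m, hm, hmo⟩ := exists_odd_sign hs
  set c := stripData a b i hi hi' with hc
  have hmr : ¬ Even (-m) := by rwa [even_neg]
  have hcU : ∀ x, -1 < wallDist s x → wallDist s x < 0 → c.τ x = (s * a i)⁻¹ := fun x h1 h2 => by
    simp only [hc, stripData, (floor_eq_of_wallDist_neg hs h1 h2).1, flipIndex]
    simp
  have hcR : ∀ x, 0 < wallDist s x → wallDist s x < 1 → c.τ x = (s * a i.rev)⁻¹ :=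
    fun x h1 h2 => by
      simp only [hc, stripData, (floor_eq_of_wallDist_pos hs hm h1 h2).1, flipIndex, if_neg hmo]
  have hconj : ∀ γ, IsFilippovSolution (kleinField h a b) γ → γ 0 ∈ U →
      c.chart (γ τ) = c.chart (γ 0) + (s * (τ - 0), 0) := fun γ hγ h0 =>
    strip_conj hP hsym hi hi' (hγ.on 0 τ) (fun r hr => (hstay γ hγ h0 r hr).1) hs
  have hU1 : ∀ p ∈ U, -1 < wallDist s p.1 := fun p hp => by linarith [(hU p hp).2.1]
  have hUR : planeImage (kleinField h a b) τ U ⊆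
      {p | wallDist s p.1 ∈ Ioo 0 1 ∧ p.2 ∈ strip h i 0} := by
    rintro q ⟨γ, hγ, h0, rfl⟩
    obtain ⟨h1, h2⟩ := hstay γ hγ h0 τ right_mem_uIcc
    refine ⟨⟨?_, (abs_lt.1 h2).2⟩, h1⟩
    have h3 := congrArg Prod.fst (hconj γ hγ h0)
    simp only [ShearData.chart, Prod.fst_add, sub_zero] at h3
    have h4 := (hU _ h0).2
    have h5 := hU1 _ h0
    rw [wallDist] at h5
    rcases hs with rfl | rfl <;> simp only [wallDist] at h4 ⊢
    · have h6 := c.clock_sub_of_const (x := (γ 0).1) (y := 1) (by linarith [h4.2])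
        (k := (1 * a i)⁻¹) fun z hz => hcU z (by simp only [wallDist]; linarith [hz.1])
          (by simp only [wallDist]; linarith [hz.2])
      have h7 : (1 * a i)⁻¹ * (1 - (γ 0).1) < τ := by
        rw [inv_mul_eq_div, div_lt_iff₀ hi]; linarith [h4.1]
      have h8 : 1 < (γ τ).1 := c.strictMono_clock.lt_iff_lt.1 (by linarith)
      linarith
    · have h6 := c.clock_sub_of_const (x := 0) (y := (γ 0).1) (by linarith [h4.2])
        (k := (-1 * a i)⁻¹) fun z hz => hcU z (by simp only [wallDist]; linarith [hz.2])
          (by simp only [wallDist]; linarith [hz.1])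
      have h7 : (-1 * a i)⁻¹ * ((γ 0).1 - 0) < τ := by
        rw [inv_mul_eq_div, div_lt_iff₀ hi]; linarith [h4.1]
      have h8 : (γ τ).1 < 0 := c.strictMono_clock.lt_iff_lt.1 (by linarith)
      linarith
  have hcont : Continuous fun p : ℝ × ℝ => wallDist s p.1 := by unfold wallDist; fun_prop
  have hRm : MeasurableSet {p : ℝ × ℝ | wallDist s p.1 ∈ Ioo 0 1 ∧ p.2 ∈ strip h i 0} :=
    (hcont.measurable measurableSet_Ioo).inter
      (measurable_snd (isOpen_strip h i 0).measurableSet)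
  -- The neighbouring column is brought back to the unit square by (x, y) ↦ (x - s, 1 - y).
  have hdeck : ∀ p, deck kleinSign (-m) 1 p = (p.1 - s, -p.2 + 1) := fun p => by
    simp [deck, kleinSign, hmr, hm, sub_eq_add_neg]
  obtain ⟨θ, hθ, he⟩ := (deckSystem_klein hP a b).exists_flux_ratio hpres hUo hUn hUS hRm
    (m := -m) (j := 1) (α := α i) (α' := α i.rev) (g := fun p => c.τ p.1) (k := (s * a i)⁻¹)
    (k' := (s * a i.rev)⁻¹)
    (fun p hp => by
      rw [hdeck]
      obtain ⟨⟨h1, h2⟩, h3⟩ := hp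
      refine mem_unitSquare_of_strip hP ?_ ?_ (one_sub_mem_strip hsym h3) <;>
      rcases hs with rfl | rfl <;> simp only [wallDist] at h1 h2 ⊢ <;> linarith)
    hUR (fun p hp => stripDensity_eq hP (hU p hp).1)
    (fun p hp => by
      rw [hdeck]
      exact stripDensity_eq hP (one_sub_mem_strip hsym hp.2))
    (inv_pos.2 hi) (inv_pos.2 hi') (fun p hp => hcU _ (hU1 p hp) (hU p hp).2.2)
    (fun p hp => hcR _ hp.1.1 hp.1.2)
    (c.meas_le_of_translate (s * (τ - 0), 0) (by
      rintro q ⟨γ, hγ, h0, rfl⟩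
      exact ⟨γ 0, h0, hconj γ hγ h0⟩))
  exact ⟨θ, hθ, by simpa only [div_inv_eq_mul] using he⟩

include hP hsym in
/-- There is no preserved mass next to a wall that cannot be crossed. -/
theorem density_eq_zero_of_sticky {s : ℝ} (hs : s = 1 ∨ s = -1) {i : Fin n} (hi : 0 < s * a i)
    (hi' : s * a i.rev ≤ 0) {α : Fin n → ℝ}
    (hpres : PreservesDensity kleinSetoid (kleinField h a b) (stripDensity h α)) : α i = 0 := by
  obtain ⟨τ, U, hτ, -, hUo, hUn, hUS, hU, hstay⟩ := exists_wall_cell hP hs hi b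
  obtain ⟨m, hm, hmo⟩ := exists_odd_sign hs
  set w : ℝ := (1 + s) / 2 with hw
  -- Up to the wall the signed distance grows at speed s * a i, and beyond the wall it does not
  -- grow. All points of U therefore end on the wall, a null set.
  have hUR : planeImage (kleinField h a b) τ U ⊆ {w} ×ˢ strip h i 0 := by
    rintro q ⟨γ, hγ, h0, rfl⟩
    refine ⟨?_, (hstay γ hγ h0 τ right_mem_uIcc).1⟩
    have hac : AbsolutelyContinuousOnInterval (fun t => wallDist s (γ t).1) 0 τ := by
      have : LipschitzWith 1 (wallDist s) := by
        refine LipschitzWith.of_dist_le_mul fun x y => ?_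
        have hs1 : |s| = 1 := by rcases hs with rfl | rfl <;> simp
        rw [Real.dist_eq, Real.dist_eq, wallDist, wallDist, ← mul_sub, abs_mul, hs1]
        simp
      exact this.comp_absolutelyContinuousOnInterval (hγ.1 0 τ).fst
    have h1 := hac.eq_zero_of_sticky hτ.le hi (hU _ h0).2.2 (hU _ h0).2.1 (by
      filter_upwards [hγ.2] with t ht hmem d hd
      obtain ⟨v, hv, hdv⟩ := ht
      obtain ⟨h2, h3⟩ := hstay γ hγ h0 t hmem
      rw [abs_lt] at h3
      obtain rfl : d = s * v.1 :=
        hd.unique (((hasDerivAt_fst hdv).sub_const ((1 + s) / 2)).const_mul s)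
      constructor
      · intro hlt
        obtain ⟨h4, h5⟩ := floor_eq_of_wallDist_neg hs h3.1 hlt
        rw [filippovSet_strip hP hsym h2 h5, h4] at hv
        obtain rfl : v = _ := hv
        simp [flipIndex]
      · intro hgt
        obtain ⟨h4, h5⟩ := floor_eq_of_wallDist_pos hs hm hgt h3.2
        rw [filippovSet_strip hP hsym h2 h5, h4] at hv
        obtain rfl : v = _ := hv
        simpa [flipIndex, hmo] using hi')
    have hs0 : s ≠ 0 := by rcases hs with rfl | rfl <;> norm_num
    exact sub_eq_zero.1 ((mul_eq_zero.1 h1).resolve_left hs0)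
  have hnull : volume (planeImage (kleinField h a b) τ U) = 0 := by
    refine measure_mono_null hUR ?_
    rw [Measure.volume_eq_prod, Measure.prod_prod]
    simp
  have hRm : MeasurableSet ({w} ×ˢ strip h i 0 : Set (ℝ × ℝ)) :=
    (measurableSet_singleton w).prod (isOpen_strip h i 0).measurableSet
  -- The left wall x = 0 already belongs to the half-open square; the right wall x = 1 has to be
  -- moved to it by a deck transformation.
  obtain ⟨m', k', α', h1, h2⟩ : ∃ (m' k' : ℤ) (α' : ℝ),
      (∀ p ∈ ({w} ×ˢ strip h i 0 : Set (ℝ × ℝ)), deck kleinSign m' k' p ∈ unitSquare) ∧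
      ∀ p ∈ ({w} ×ˢ strip h i 0 : Set (ℝ × ℝ)), stripDensity h α (deck kleinSign m' k' p) = α' := by
    rcases hs with rfl | rfl
    · have hdeck : ∀ p, deck kleinSign (-1) 1 p = (p.1 - 1, -p.2 + 1) := fun p => by
        simp [deck, kleinSign, sub_eq_add_neg]
      refine ⟨-1, 1, α i.rev, fun p hp => ?_, fun p hp => ?_⟩
      · obtain ⟨h1, h2⟩ := hp
        have h3 : p.1 = w := h1
        rw [hdeck]
        exact mem_unitSquare_of_strip hP (by rw [h3, hw]; norm_num) (by rw [h3, hw]; norm_num)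
          (one_sub_mem_strip hsym h2)
      · rw [hdeck]
        exact stripDensity_eq hP (one_sub_mem_strip hsym hp.2)
    · refine ⟨0, 0, α i, fun p hp => ?_, fun p hp => ?_⟩
      · rw [(deckSystem_klein hP a b).deck_zero]
        obtain ⟨h1, h2⟩ := hp
        have h3 : p.1 = w := h1
        exact mem_unitSquare_of_strip hP (by rw [h3, hw]; norm_num) (by rw [h3, hw]; norm_num) h2
      · rw [(deckSystem_klein hP a b).deck_zero]
        exact stripDensity_eq hP hp.2
  have h3 := (deckSystem_klein hP a b).mul_volume_eq hpres hUo hUS hRm h1 hUR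
    (fun p hp => stripDensity_eq hP (hU p hp).1) h2
  rw [hnull, ENNReal.toReal_zero, mul_zero] at h3
  refine (mul_eq_zero.1 h3).resolve_right
    (ENNReal.toReal_pos (hUo.measure_pos volume hUn).ne' ?_).ne'
  refine measure_ne_top_of_subset hUS ?_
  rw [unitSquare, Measure.volume_eq_prod, Measure.prod_prod]
  simp

include hP hsym in
/-- The slopes of a preserved density on the Klein bottle are symmetric. -/
theorem slope_symm_of_preservesDensity (hb : ∀ i, 0 < b i) {α : Fin n → ℝ} {c : ℝ} (hc : c ≠ 0)
    (hα : ∀ i, α i = c / b i)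
    (hpres : PreservesDensity kleinSetoid (kleinField h a b) (stripDensity h α)) (i : Fin n) :
    a i / b i = a i.rev / b i.rev := by
  have key : ∀ s : ℝ, s = 1 ∨ s = -1 → ∀ j, 0 < s * a j →
      0 < s * a j.rev ∧ a j / b j = a j.rev / b j.rev := by
    intro s hs j hj
    -- Since c ≠ 0 no density value vanishes, so no wall can be sticky.
    have hpos : ∀ l, 0 < s * a l → 0 < s * a l.rev := fun l hl => by
      by_contra hneg
      have h1 := density_eq_zero_of_sticky hP hsym hs hl (not_lt.1 hneg) hpres
      rw [hα, div_eq_zero_iff] at h1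
      exact h1.elim hc (hb l).ne'
    have hj' := hpos j hj
    obtain ⟨θ, hθ, h1⟩ := exists_flux_ratio_vertical hP hsym hs hj hj' hpres
    -- Reflection is an involution, so the comparison also holds with the two strips exchanged.
    obtain ⟨θ', hθ', h2⟩ := exists_flux_ratio_vertical hP hsym hs hj' (by rwa [Fin.rev_rev]) hpres
    rw [Fin.rev_rev] at h2
    have h3 := eq_of_eq_mul_of_eq_mul hθ hθ' h1 h2
    rw [hα, hα] at h3
    refine ⟨hj', ?_⟩
    have hs0 : s ≠ 0 := left_ne_zero_of_mul hj.ne'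
    refine mul_left_cancel₀ (mul_ne_zero hc hs0) ?_
    linear_combination h3
  rcases lt_trichotomy (a i) 0 with hi | hi | hi
  · exact (key (-1) (Or.inr rfl) i (by linarith)).2
  -- A nonzero a i.rev would force a nonzero a i, by `key` applied to the reflected strip.
  · have h1 : a i.rev = 0 := by
      rcases lt_trichotomy (a i.rev) 0 with h | h | h
      · have := (key (-1) (Or.inr rfl) i.rev (by linarith)).1
        rw [Fin.rev_rev, hi] at this
        simp at this
      · exact h
      · have := (key 1 (Or.inl rfl) i.rev (by linarith)).1
        rw [Fin.rev_rev, hi] at this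
        simp at this
    rw [hi, h1, zero_div, zero_div]
  · exact (key 1 (Or.inl rfl) i (by linarith)).2

end Walls

theorem mainTheorem5 (n : ℕ) (h : Fin (n + 1) → ℝ) (h_mono : StrictMono h)
    (h_zero : h 0 = 0) (h_one : h (Fin.last n) = 1)
    (a b α : Fin n → ℝ) (hb : ∀ i, 0 < b i) :
    (PreservesDensity torusSetoid (torusField h a b) (stripDensity h α) ↔
      ∃ c : ℝ, ∀ i, α i = c / b i) ∧
    ((∀ i, h i.rev = 1 - h i) → (∃ i, α i ≠ 0) →
      (PreservesDensity kleinSetoid (kleinField h a b) (stripDensity h α) ↔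
        (∃ c : ℝ, ∀ i, α i = c / b i) ∧ ∀ i, a i / b i = a i.rev / b i.rev)) := by
  have hP : IsStripPartition h := ⟨h_mono, h_zero, h_one⟩
  refine ⟨⟨fun hpres => ?_, fun ⟨c, hc⟩ => preservesDensity_torus hP a b α hb hc⟩,
    fun hsym ⟨j, hj⟩ => ⟨fun hpres => ?_, fun ⟨⟨c, hc⟩, hκ⟩ =>
      preservesDensity_klein hP hsym a hb hc hκ⟩⟩
  · exact exists_density_eq hP (deckSystem_torus hP a b) (fieldBound_torus hP a b)
      (fun p _ => torusField_eq hP a b p) hpres hb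
  · obtain ⟨c, hc⟩ := exists_density_eq hP (deckSystem_klein hP a b) (fieldBound_klein hP a b)
      (fun p hp => by simpa [kleinSign] using kleinField_openColumn hP a b 0 p hp) hpres hb
    -- For c = 0 the density would vanish, and preservation would say nothing about the slopes.
    have hc0 : c ≠ 0 := by
      rintro rfl
      exact hj (by rw [hc, zero_div])
    exact ⟨⟨c, hc⟩, slope_symm_of_preservesDensity hP hsym hb hc0 hc hpres⟩
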